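/- For every real $C$ there is a constant $K>0$, depending only on $C$, such that the following holds. Let $n,p_N,p_L,m$ be natural numbers, let $Z_1,\dots,Z_n\in\mathbb R^{p_N}$ satisfy $\|Z_i\|_2=1$ for all $i$ and $Z_i\not\parallel Z_j$ for all $i\ne j$, let $M_1,\dots,M_n\in\mathbb R^{1+p_L}$ satisfy $\|M_i\|_2\le C$, and let $0<\delta<1$. Let $\lambda_0$ be the least eigenvalue of the matrix $H^\infty\in\mathbb R^{n\times n}$, $$H^\infty_{ij}=\mathbb E_{w\sim N(0,I)}\big[Z_i^\top Z_j\,\mathbb I\{w^\top Z_i\ge 0,\ w^\top Z_j\ge 0\}\big].$$ For $W=(w_1,\dots,w_m)\in(\mathbb R^{p_N})^m$ and $A\in\mathbb R^{m\times(1+p_L)}$ consider the two-layer network and the squared loss $$F(W,A,z)=\frac1{\sqrt m}\sum_{r=1}^m A_r\,\sigma(w_r^\top z)\in\mathbb R^{1+p_L},\qquad L(W,A)=\frac12\sum_{i=1}^n\|F(W,A,Z_i)-M_i\|_2^2,\qquad \sigma(x)=\max(x,0).$$ The second layer $A$ stays fixed and the first layer follows the gradient flow $\dot w_r(t)=-\partial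 L(W(t),A)/\partial w_r$, $t\ge0$, that is, every $w_r$ is locally absolutely continuous on $[0,\infty)$ and, for almost every $t>0$ and every $r$, $$\dot w_r(t)=\sum_{h=1}^{1+p_L}\sum_{j=1}^n\big(M_{jh}-F_h(W(t),A,Z_j)\big)\frac1{\sqrt m}A_{rh}\,g_{rj}(t)\,Z_j$$ with some $g_{rj}(t)\in\partial\sigma(w_r(t)^\top Z_j)$, where $\partial\sigma(x)$ is $\{1\}$ for $x>0$, $\{0\}$ for $x<0$ and $[0,1]$ for $x=0$. If $$m\ \ge\ K\,\frac{(1+p_L)^5\,n^6}{\delta^3\,\lambda_0^4}$$ and the initial values $w_r(0)\sim N(0,I)$ and $A_{rs}\sim\mathrm{unif}\{-1,1\}$ ($r\le m$, $s\le 1+p_L$) are all independent, then with probability at least $1-\delta$ over the initialization, every gradient flow trajectory started from it satisfies, for all $t\ge0$ and all $s\in\{1,\dots,1+p_L\}$, $$\|F_s(t)-M_s\|_2^2\le e^{-\lambda_0t}\,\|F_s(0)-M_s\|_2^2,$$ where $F_s(t)=(F_s(W(t),A,Z_i))_{i=1}^n$ and $M_s=(M_{is})_{i=1}^n$. -/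

import Mathlib

open MeasureTheory ProbabilityTheory
open scoped ENNReal

noncomputable section

namespace TwoLayerReLU

/-- The ReLU activation `σ(x) = max(x, 0)`. -/
def relu (x : ℝ) : ℝ := max x 0

/-- The subdifferential of the convex function `relu` at `x`. -/
def reluSubdiff (x : ℝ) : Set ℝ := {g | ∀ y, relu x + g * (y - x) ≤ relu y}

/-- The subdifferential of ReLU is `{1}` on the positive axis, `{0}` on the negative axis and
`[0, 1]` at the kink. -/
theorem mem_reluSubdiff_iff (x g : ℝ) :
    g ∈ reluSubdiff x ↔ 0 ≤ g ∧ g ≤ 1 ∧ (0 < x → g = 1) ∧ (x < 0 → g = 0) := by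
  simp only [reluSubdiff, relu, Set.mem_ofPred_eq]
  constructor
  · intro h
    have h1 := h (x + 1)
    have h2 := h (x - 1)
    have h3 := h 0
    have h4 := h (2 * x)
    have e1 : max (x + 1) 0 ≤ max x 0 + 1 :=
      max_le (by linarith [le_max_left x 0]) (by linarith [le_max_right x 0])
    have e2 : max (x - 1) 0 ≤ max x 0 := max_le_max (by linarith) le_rfl
    refine ⟨by linarith, by linarith, fun hx => ?_, fun hx => ?_⟩
    · rw [max_eq_left hx.le] at h3 h4
      rw [max_self] at h3
      rw [max_eq_left (by linarith)] at h4
      have a1 : x * (1 - g) ≤ 0 := by nlinarith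
      have a2 : 0 ≤ x * (1 - g) := by nlinarith
      have a3 : x * (1 - g) = 0 := le_antisymm a1 a2
      rcases mul_eq_zero.1 a3 with h0 | h0 <;> linarith
    · rw [max_eq_right hx.le] at h3 h4
      rw [max_self] at h3
      rw [max_eq_right (by linarith)] at h4
      have a3 : x * g = 0 := by nlinarith
      rcases mul_eq_zero.1 a3 with h0 | h0 <;> linarith
  · rintro ⟨h0, h1, hp, hn⟩ y
    rcases lt_trichotomy x 0 with hx | hx | hx
    · rw [hn hx, max_eq_right hx.le]
      simp
    · subst hx
      rcases le_total y 0 with hy | hy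
      · rw [max_eq_right hy]
        simp only [max_self]
        nlinarith
      · rw [max_eq_left hy]
        simp only [max_self]
        nlinarith
    · rw [hp hx, max_eq_left hx.le]
      have := le_max_left y 0
      linarith

variable {d m k n : ℕ}

/-- The two-layer network `F(W, A, z) = m^{-1/2} ∑_r A_r σ(w_rᵀ z) ∈ ℝᵏ`. -/
def network (A : Fin m → Fin k → ℝ) (W : Fin m → EuclideanSpace ℝ (Fin d))
    (z : EuclideanSpace ℝ (Fin d)) : EuclideanSpace ℝ (Fin k) :=
  WithLp.toLp 2 fun s => (1 / √(m : ℝ)) * ∑ r, A r s * relu (inner ℝ (W r) z)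

/-- The squared loss `L(W, A) = ∑_i ½ ‖F(W, A, Z_i) - M_i‖²`. -/
def loss (Z : Fin n → EuclideanSpace ℝ (Fin d)) (M : Fin n → EuclideanSpace ℝ (Fin k))
    (A : Fin m → Fin k → ℝ) (W : Fin m → EuclideanSpace ℝ (Fin d)) : ℝ :=
  ∑ i, (1 / 2 : ℝ) * ‖network A W (Z i) - M i‖ ^ 2

/-- The partial derivative of the loss with respect to `w_r` given by the chain rule,
`∑_j ∑_h (F_h(W, A, Z_j) - M_{jh}) ∂F_h(W, A, Z_j)/∂w_r`
with `∂F_h(W, A, Z_j)/∂w_r = m^{-1/2} A_{rh} g_j Z_j`, where `g_j` stands for the derivative of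
ReLU at `w_rᵀ Z_j`. -/
def lossGrad (Z : Fin n → EuclideanSpace ℝ (Fin d)) (M : Fin n → EuclideanSpace ℝ (Fin k))
    (A : Fin m → Fin k → ℝ) (W : Fin m → EuclideanSpace ℝ (Fin d)) (r : Fin m)
    (g : Fin n → ℝ) : EuclideanSpace ℝ (Fin d) :=
  ∑ j, ∑ h, (network A W (Z j) h - M j h) • (1 / √(m : ℝ) * A r h * g j) • Z j

/-- Where no pre-activation `w_rᵀ Z_j` vanishes, the loss is differentiable in `w_r` and `lossGrad`
is its gradient. -/
theorem hasGradientAt_loss (Z : Fin n → EuclideanSpace ℝ (Fin d))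
    (M : Fin n → EuclideanSpace ℝ (Fin k)) (A : Fin m → Fin k → ℝ)
    (W : Fin m → EuclideanSpace ℝ (Fin d)) (r : Fin m) (g : Fin n → ℝ)
    (hg : ∀ j, g j ∈ reluSubdiff (inner ℝ (W r) (Z j)))
    (hW : ∀ j, (inner ℝ (W r) (Z j) : ℝ) ≠ 0) :
    HasGradientAt (fun v => loss Z M A (Function.update W r v)) (lossGrad Z M A W r g) (W r) := by
  have hrelu : ∀ j, HasDerivAt relu (g j) (inner ℝ (W r) (Z j)) := by
    intro j
    obtain ⟨-, -, hp, hn⟩ := (mem_reluSubdiff_iff _ _).1 (hg j)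
    rcases lt_or_gt_of_ne (hW j) with hx | hx
    · rw [hn hx]
      refine (hasDerivAt_const _ (0 : ℝ)).congr_of_eventuallyEq ?_
      filter_upwards [eventually_lt_nhds hx] with y hy
      exact max_eq_right hy.le
    · rw [hp hx]
      refine (hasDerivAt_id _).congr_of_eventuallyEq ?_
      filter_upwards [eventually_gt_nhds hx] with y hy
      exact max_eq_left hy.le
  have hout : ∀ j h, HasFDerivAt (fun v => network A (Function.update W r v) (Z j) h)
      ((1 / √(m : ℝ) * A r h * g j) • innerSL ℝ (Z j)) (W r) := by
    intro j h
    have hin : HasFDerivAt (fun v : EuclideanSpace ℝ (Fin d) => (inner ℝ v (Z j) : ℝ))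
        (innerSL ℝ (Z j)) (W r) := by
      have h0 := (innerSL ℝ (Z j)).hasFDerivAt (x := W r)
      refine h0.congr_of_eventuallyEq (Filter.Eventually.of_forall fun v => ?_)
      simp [real_inner_comm]
    have hone : HasFDerivAt (fun v : EuclideanSpace ℝ (Fin d) => relu (inner ℝ v (Z j)))
        (g j • innerSL ℝ (Z j)) (W r) := by
      have hr : HasDerivAt relu (g j) ((fun v : EuclideanSpace ℝ (Fin d) =>
        (inner ℝ v (Z j) : ℝ)) (W r)) := hrelu j
      exact hr.comp_hasFDerivAt (W r) hin
    have hsum : ∀ v, network A (Function.update W r v) (Z j) h =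
        1 / √(m : ℝ) * (A r h * relu (inner ℝ v (Z j)) +
          ∑ q ∈ Finset.univ.erase r, A q h * relu (inner ℝ (W q) (Z j))) := by
      intro v
      simp only [network]
      rw [← Finset.add_sum_erase _ _ (Finset.mem_univ r)]
      simp only [Function.update_self]
      congr 2
      refine Finset.sum_congr rfl fun q hq => ?_
      rw [Function.update_of_ne (Finset.ne_of_mem_erase hq)]
    simp only [hsum]
    refine (((hone.const_mul (A r h)).add_const _).const_mul _).congr_fderiv ?_
    ext v
    simp
    ring
  have hloss : ∀ v, loss Z M A (Function.update W r v) =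
      ∑ j, ∑ h, (1 / 2 : ℝ) * (network A (Function.update W r v) (Z j) h - M j h) ^ 2 := by
    intro v
    simp [loss, EuclideanSpace.norm_sq_eq, Finset.mul_sum]
  rw [hasGradientAt_iff_hasFDerivAt]
  simp only [hloss]
  have key : ∀ j h, HasFDerivAt
      (fun v => (1 / 2 : ℝ) * (network A (Function.update W r v) (Z j) h - M j h) ^ 2)
      ((network A W (Z j) h - M j h) • (1 / √(m : ℝ) * A r h * g j) • innerSL ℝ (Z j))
      (W r) := by
    intro j h
    refine ((((hout j h).sub_const (M j h)).pow 2).const_mul (1 / 2)).congr_fderiv ?_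
    ext v
    simp [Function.update_eq_self]
    ring
  refine (HasFDerivAt.fun_sum fun j _ => HasFDerivAt.fun_sum fun h _ => key j h).congr_fderiv ?_
  ext v
  simp [lossGrad]

/-- `W` is a trajectory, on the time interval `[0, ∞)`, of the gradient flow
`dw_r/dt = -∂L(W, A)/∂w_r` (with the second layer `A` fixed) started at `W₀`: every `w_r` is locally
absolutely continuous, and at almost every time the equation holds, where the derivative of ReLU
may take any value in the subdifferential (so only its value at the kink `0` is not prescribed;
the convention `σ'(0) = 1` is one of the choices that are allowed). -/
structure IsGradientFlow (Z : Fin n → EuclideanSpace ℝ (Fin d))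
    (M : Fin n → EuclideanSpace ℝ (Fin k)) (A : Fin m → Fin k → ℝ)
    (W₀ : Fin m → EuclideanSpace ℝ (Fin d)) (W : ℝ → Fin m → EuclideanSpace ℝ (Fin d)) :
    Prop where
  init : W 0 = W₀
  absolutelyContinuous : ∀ r, ∀ T : ℝ, 0 < T →
    AbsolutelyContinuousOnInterval (fun t => W t r) 0 T
  hasDerivAt : ∀ᵐ t ∂(volume.restrict (Set.Ioi (0 : ℝ))), ∀ r, ∃ g : Fin n → ℝ,
    (∀ j, g j ∈ reluSubdiff (inner ℝ (W t r) (Z j))) ∧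
      HasDerivAt (fun τ => W τ r) (-lossGrad Z M A (W t) r g) t

/-- The vector `F_s = (F_s(W, A, Z_i))_{i ≤ n}` of the `s`-th outputs on the data. -/
def outputs (Z : Fin n → EuclideanSpace ℝ (Fin d)) (A : Fin m → Fin k → ℝ)
    (W : Fin m → EuclideanSpace ℝ (Fin d)) (s : Fin k) : EuclideanSpace ℝ (Fin n) :=
  WithLp.toLp 2 fun i => network A W (Z i) s

/-- The vector `M_s = (M_{is})_{i ≤ n}` of the `s`-th targets. -/
def targets (M : Fin n → EuclideanSpace ℝ (Fin k)) (s : Fin k) : EuclideanSpace ℝ (Fin n) :=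
  WithLp.toLp 2 fun i => M i s

/-- The limiting Gram matrix
`H^∞_{ij} = E_{w ∼ N(0, I)} [Z_iᵀ Z_j 1{wᵀ Z_i ≥ 0, wᵀ Z_j ≥ 0}]`. -/
def ntkGram (Z : Fin n → EuclideanSpace ℝ (Fin d)) : Matrix (Fin n) (Fin n) ℝ :=
  Matrix.of fun i j => ∫ w,
    Set.indicator {w : EuclideanSpace ℝ (Fin d) | 0 ≤ inner ℝ w (Z i) ∧ 0 ≤ inner ℝ w (Z j)}
      (fun _ => (inner ℝ (Z i) (Z j) : ℝ)) w ∂(stdGaussian (EuclideanSpace ℝ (Fin d)))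

/-- The least eigenvalue `λ₀` of (the real symmetric matrix) `H^∞`. -/
def leastEigenvalue (Z : Fin n → EuclideanSpace ℝ (Fin d)) : ℝ :=
  sInf (spectrum ℝ (ntkGram Z))

/-- The uniform distribution on `{-1, 1}`. -/
def signLaw : Measure ℝ := (2⁻¹ : ℝ≥0∞) • (Measure.dirac (-1) + Measure.dirac 1)

/-- The law of the initialization: all `w_r ∼ N(0, I)` and `A_{rs} ∼ unif{-1, 1}` are
independent. -/
def initLaw (d m k : ℕ) :
    Measure ((Fin m → EuclideanSpace ℝ (Fin d)) × (Fin m → Fin k → ℝ)) :=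
  (Measure.pi fun _ => stdGaussian (EuclideanSpace ℝ (Fin d))).prod
    (Measure.pi fun _ => Measure.pi fun _ => signLaw)

end TwoLayerReLU

end

/-!
# Convergence of gradient flow for wide two-layer ReLU networks with several outputs

Write `u_s` for the vector of residuals `F_s - M_s` of the `s`-th output, and `u` for all of them.
Along the flow the residuals solve the kernel equation `u̇ = -G u`, where `G` is the empirical
tangent kernel, a matrix with blocks `G_{sh} ∈ ℝⁿˣⁿ`
(`IsGradientFlow.ae_hasDerivAt_residual`). No convention for `σ'(0)` is needed: where `w_rᵀ Z_j`
vanishes and the trajectory is differentiable, the derivative of `σ(w_rᵀ Z_j)` is zero anyway. At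
initialization `G` is close to the block diagonal matrix with blocks `H^∞`, since the second-layer
signs average out off the diagonal, and `H^∞` is positive definite for pairwise non-parallel data
(`leastEigenvalue_pos`). Were `G` equal to this matrix, each `‖u_s‖²` would decay at rate `2 λ₀`;
the rate `λ₀` of the theorem leaves room for an error `G - diag(H^∞)` of operator size `κ`.

The error couples the outputs: it adds to the derivative of `‖u_s‖²` up to `2 κ ‖u_s‖ ‖u‖`, which
is harmless only if `κ ‖u‖` is small compared with `λ₀ ‖u_s‖`. The total `‖u‖²` decays at rate
`λ₀` from an initial value at most `B²`. A lower bound on `‖u_s‖` comes from anti-concentration: no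
output starts with `‖u_s‖ < ε`, and the decay of `‖u_s‖²` has only to be established at the times
when `e^{λ₀ t} ‖u_s(t)‖²` exceeds its initial value, hence exceeds `ε²`. At such times
`2 κ B ≤ λ₀ ε` suffices, and a barrier argument concludes (`le_of_ae_hasDerivAt_nonpos_of_lt`,
`GoodInit.sum_sq_residual_le`).

The kernel `G` changes along the flow only through the neurons that come close to a kink. As
`‖ẇ_r‖ ≤ (n k / m)^{1/2} ‖u‖` is integrable in time, no neuron ever moves by more than a small `R`
(`GoodInit.norm_sub_lt`), so only the neurons with `|w_r(0)ᵀ Z_j| ≤ R` matter, about `R m` of them.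
These depend on the first layer only, so their second-layer weights are still independent random
signs, and they contribute to `κ` a term of order `n R`, without the loss of a factor `√k` that the
norms `‖A_r‖ = √k` would suggest (`GoodInit.abs_form_sub_le`).

All these properties of the initialization are collected in the structure `GoodInit`, and
`exists_goodInit_event` shows that they hold with probability at least `1 - δ`. Besides Chebyshev's
inequality this takes fourth moments of sub-Gaussian sums, where second moments would give too large
a power of `δ⁻¹`, and an anti-concentration bound for sums of ReLU units, obtained by Gaussian
integration by parts (`integral_deriv_mul_sum_le`). The choice of `ε`, `B`, `κ` and `R` in
`exists_parameters` then yields the stated lower bound on the width.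
-/

namespace TwoLayerReLU

/-! ### Absolutely continuous functions -/

theorem absolutelyContinuousOnInterval_of_dist_le {X Y : Type*} [PseudoMetricSpace X]
    [PseudoMetricSpace Y] {f : ℝ → X} {g : ℝ → Y} {a b K : ℝ} (hK : 0 ≤ K)
    (h : ∀ x y, dist (g x) (g y) ≤ K * dist (f x) (f y))
    (hf : AbsolutelyContinuousOnInterval f a b) : AbsolutelyContinuousOnInterval g a b := by
  rw [absolutelyContinuousOnInterval_iff] at hf ⊢
  intro ε hε
  obtain ⟨δ, hδ, H⟩ := hf (ε / (K + 1)) (by positivity)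
  refine ⟨δ, hδ, fun E hE hlt => ?_⟩
  have h1 := H E hE hlt
  calc _ ≤ ∑ i ∈ Finset.range E.1, K * dist (f (E.2 i).1) (f (E.2 i).2) :=
        Finset.sum_le_sum fun i _ => h _ _
    _ = K * ∑ i ∈ Finset.range E.1, dist (f (E.2 i).1) (f (E.2 i).2) := by rw [Finset.mul_sum]
    _ ≤ K * (ε / (K + 1)) := by gcongr
    _ < (K + 1) * (ε / (K + 1)) := by gcongr; linarith
    _ = ε := by field_simp

theorem absolutelyContinuousOnInterval_const {a b : ℝ} (c : ℝ) :
    AbsolutelyContinuousOnInterval (fun _ => c) a b :=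
  (LipschitzWith.const c).lipschitzOnWith.absolutelyContinuousOnInterval

theorem absolutelyContinuousOnInterval_sum {ι : Type*} (s : Finset ι) {f : ι → ℝ → ℝ} {a b : ℝ}
    (h : ∀ i ∈ s, AbsolutelyContinuousOnInterval (f i) a b) :
    AbsolutelyContinuousOnInterval (fun t => ∑ i ∈ s, f i t) a b := by
  classical
  induction s using Finset.induction_on with
  | empty => simpa using absolutelyContinuousOnInterval_const 0
  | insert i s hi ih =>
    simp only [Finset.sum_insert hi]
    exact (h i (Finset.mem_insert_self _ _)).fun_add
      (ih fun j hj => h j (Finset.mem_insert_of_mem hj))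

theorem abs_relu_sub_le (x y : ℝ) : |relu x - relu y| ≤ |x - y| :=
  abs_max_sub_max_le_abs x y 0

theorem relu_nonneg (x : ℝ) : 0 ≤ relu x := le_max_right _ _

theorem absolutelyContinuousOnInterval_relu_comp {f : ℝ → ℝ} {a b : ℝ}
    (hf : AbsolutelyContinuousOnInterval f a b) :
    AbsolutelyContinuousOnInterval (fun t => relu (f t)) a b :=
  absolutelyContinuousOnInterval_of_dist_le zero_le_one
    (fun x y => by simpa [Real.dist_eq] using abs_relu_sub_le (f x) (f y)) hf

/-- Integrating the derivative: an absolutely continuous function with almost everywhere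
nonpositive derivative does not increase. -/
theorem le_of_ae_hasDerivAt_nonpos {f : ℝ → ℝ} {a b : ℝ} (hab : a ≤ b)
    (hf : AbsolutelyContinuousOnInterval f a b)
    (h : ∀ᵐ t, t ∈ Set.Ioo a b → ∃ f', HasDerivAt f f' t ∧ f' ≤ 0) : f b ≤ f a := by
  have h1 := hf.integral_deriv_eq_sub
  have h2 : ∫ x in a..b, deriv f x ≤ 0 := by
    rw [intervalIntegral.integral_of_le hab, integral_Ioc_eq_integral_Ioo]
    refine integral_nonpos_of_ae ?_
    rw [Filter.EventuallyLE, ae_restrict_iff' measurableSet_Ioo]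
    filter_upwards [h] with t ht hmem
    obtain ⟨f', hd, hle⟩ := ht hmem
    simpa [hd.deriv] using hle
  linarith

/-- The chain rule for ReLU, for any choice of subgradient: at a zero of `f` where both `f` and
`relu ∘ f` are differentiable, both derivatives vanish, since `relu ∘ f` and `relu ∘ f - f` attain
their minimum `0` there. -/
theorem hasDerivAt_relu_comp {f : ℝ → ℝ} {f' t g : ℝ} (hf : HasDerivAt f f' t)
    (hd : DifferentiableAt ℝ (fun τ => relu (f τ)) t) (hg : g ∈ reluSubdiff (f t)) :
    HasDerivAt (fun τ => relu (f τ)) (g * f') t := by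
  obtain ⟨-, -, hp, hn⟩ := (mem_reluSubdiff_iff _ _).1 hg
  rcases lt_trichotomy (f t) 0 with hx | hx | hx
  · rw [hn hx, zero_mul]
    refine (hasDerivAt_const _ (0 : ℝ)).congr_of_eventuallyEq ?_
    filter_upwards [hf.continuousAt.eventually_lt continuousAt_const hx] with y hy
    exact max_eq_right hy.le
  · have hr : relu (f t) = 0 := by simp [relu, hx]
    have h0 : deriv (fun τ => relu (f τ)) t = 0 :=
      IsLocalMin.deriv_eq_zero (Filter.Eventually.of_forall fun y => by
        simpa [hr] using relu_nonneg (f y))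
    have h1 := hd.hasDerivAt
    rw [h0] at h1
    have h2 : HasDerivAt (fun τ => relu (f τ) - f τ) (0 - f') t := h1.sub hf
    have h3 : 0 - f' = 0 :=
      IsLocalMin.hasDerivAt_eq_zero (Filter.Eventually.of_forall fun y => by
        have hy : f y ≤ relu (f y) := le_max_left _ _
        have h0 : relu 0 = 0 := max_self 0
        simp only [hx, h0]
        linarith) h2
    have h4 : f' = 0 := by linarith
    rw [h4, mul_zero]
    exact h1
  · rw [hp hx, one_mul]
    refine hf.congr_of_eventuallyEq ?_
    filter_upwards [continuousAt_const.eventually_lt hf.continuousAt hx] with y hy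
    exact max_eq_left hy.le

/-- A barrier argument: an absolutely continuous function whose derivative is nonpositive at almost
every time at which it exceeds its initial value never exceeds its initial value. -/
theorem le_of_ae_hasDerivAt_nonpos_of_lt {f : ℝ → ℝ} {a b : ℝ} (hab : a ≤ b)
    (hf : AbsolutelyContinuousOnInterval f a b)
    (h : ∀ᵐ t, t ∈ Set.Ioo a b → ∃ f', HasDerivAt f f' t ∧ (f a < f t → f' ≤ 0)) :
    f b ≤ f a := by
  have hsub : AbsolutelyContinuousOnInterval (fun t => f t - f a) a b :=
    hf.fun_sub (absolutelyContinuousOnInterval_const _)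
  have hrelu : AbsolutelyContinuousOnInterval (fun t => relu (f t - f a)) a b :=
    absolutelyContinuousOnInterval_relu_comp hsub
  have key : relu (f b - f a) ≤ relu (f a - f a) := by
    refine le_of_ae_hasDerivAt_nonpos (f := fun t => relu (f t - f a)) hab hrelu ?_
    filter_upwards [h, hrelu.ae_differentiableAt] with t ht hdiff hmem
    obtain ⟨f', hd, hle⟩ := ht hmem
    have hdiff' := hdiff (Set.Ioo_subset_Icc_self.trans Set.Icc_subset_uIcc hmem)
    by_cases hlt : f a < f t
    · refine ⟨1 * f', hasDerivAt_relu_comp (hd.sub_const (f a)) hdiff' ?_, by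
        simpa using hle hlt⟩
      rw [mem_reluSubdiff_iff]
      exact ⟨zero_le_one, le_rfl, fun _ => rfl, fun h => by linarith⟩
    · refine ⟨0 * f', hasDerivAt_relu_comp (hd.sub_const (f a)) hdiff' ?_, by simp⟩
      rw [mem_reluSubdiff_iff]
      exact ⟨le_rfl, zero_le_one, fun h => by linarith, fun _ => rfl⟩
  have h1 : f b - f a ≤ relu (f b - f a) := le_max_left _ _
  have h2 : relu (f a - f a) = 0 := by simp [relu]
  linarith

/-! ### The dynamics of the residuals -/

/-- The residual `F_s(W, A, Z_i) - M_{is}`. -/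
noncomputable def residual {d m k n : ℕ} (Z : Fin n → EuclideanSpace ℝ (Fin d))
    (M : Fin n → EuclideanSpace ℝ (Fin k)) (A : Fin m → Fin k → ℝ)
    (W : Fin m → EuclideanSpace ℝ (Fin d)) (s : Fin k) (i : Fin n) : ℝ :=
  network A W (Z i) s - M i s

/-- The entry `((s, i), (h, j))` of the empirical tangent kernel
`m⁻¹ ∑_r A_{rs} A_{rh} g_{ri} g_{rj} Z_iᵀ Z_j`, where `g_{ri}` stands for the derivative of ReLU at
`w_rᵀ Z_i`. -/
noncomputable def gram {d m k n : ℕ} (Z : Fin n → EuclideanSpace ℝ (Fin d))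
    (A : Fin m → Fin k → ℝ) (g : Fin m → Fin n → ℝ) (s : Fin k) (i : Fin n) (h : Fin k)
    (j : Fin n) : ℝ :=
  1 / (m : ℝ) * ∑ r, A r s * A r h * (g r i * g r j) * inner ℝ (Z i) (Z j)

section Flow

variable {d m k n : ℕ} {Z : Fin n → EuclideanSpace ℝ (Fin d)}
  {M : Fin n → EuclideanSpace ℝ (Fin k)} {A : Fin m → Fin k → ℝ}
  {W₀ : Fin m → EuclideanSpace ℝ (Fin d)} {W : ℝ → Fin m → EuclideanSpace ℝ (Fin d)}

theorem residual_eq (W : Fin m → EuclideanSpace ℝ (Fin d)) (s : Fin k) (i : Fin n) :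
    residual Z M A W s i =
      (1 / √(m : ℝ)) * ∑ r, A r s * relu (inner ℝ (W r) (Z i)) - M i s := rfl

theorem norm_sq_outputs_sub_targets (W : Fin m → EuclideanSpace ℝ (Fin d)) (s : Fin k) :
    ‖outputs Z A W s - targets M s‖ ^ 2 = ∑ i, residual Z M A W s i ^ 2 := by
  simp [EuclideanSpace.norm_sq_eq, outputs, targets, residual]

theorem IsGradientFlow.absolutelyContinuous_inner (hW : IsGradientFlow Z M A W₀ W) (r : Fin m)
    (v w : EuclideanSpace ℝ (Fin d)) {T : ℝ} (hT : 0 < T) :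
    AbsolutelyContinuousOnInterval (fun t => (inner ℝ (W t r - w) v : ℝ)) 0 T := by
  refine absolutelyContinuousOnInterval_of_dist_le (norm_nonneg v) (fun x y => ?_)
    (hW.absolutelyContinuous r T hT)
  rw [Real.dist_eq, ← inner_sub_left, sub_sub_sub_cancel_right, dist_eq_norm, mul_comm]
  exact abs_real_inner_le_norm _ _

theorem IsGradientFlow.absolutelyContinuous_relu (hW : IsGradientFlow Z M A W₀ W) (r : Fin m)
    (v : EuclideanSpace ℝ (Fin d)) {T : ℝ} (hT : 0 < T) :
    AbsolutelyContinuousOnInterval (fun t => relu (inner ℝ (W t r) v)) 0 T := by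
  have := hW.absolutelyContinuous_inner r v 0 hT
  simp only [sub_zero] at this
  exact absolutelyContinuousOnInterval_relu_comp this

theorem IsGradientFlow.absolutelyContinuous_residual (hW : IsGradientFlow Z M A W₀ W)
    (s : Fin k) (i : Fin n) {T : ℝ} (hT : 0 < T) :
    AbsolutelyContinuousOnInterval (fun t => residual Z M A (W t) s i) 0 T := by
  simp only [residual_eq]
  exact ((absolutelyContinuousOnInterval_sum _ fun r _ =>
    (hW.absolutelyContinuous_relu r (Z i) hT).const_mul (A r s)).const_mul _).fun_sub
      (absolutelyContinuousOnInterval_const _)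

theorem inner_neg_lossGrad (W : Fin m → EuclideanSpace ℝ (Fin d)) (r : Fin m) (g : Fin n → ℝ)
    (v : EuclideanSpace ℝ (Fin d)) :
    inner ℝ (-lossGrad Z M A W r g) v =
      -∑ h, ∑ j, residual Z M A W h j * (1 / √(m : ℝ) * A r h * g j) * inner ℝ (Z j) v := by
  rw [Finset.sum_comm]
  simp [lossGrad, residual, sum_inner, inner_smul_left, inner_neg_left, mul_assoc]

/-- At almost every time the residuals obey the kernel equation `u̇ = -G u`, where `G` is the
empirical tangent kernel. -/
theorem IsGradientFlow.ae_hasDerivAt_residual (hW : IsGradientFlow Z M A W₀ W) {T : ℝ}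
    (hT : 0 < T) :
    ∀ᵐ t, t ∈ Set.Ioo 0 T → ∃ g : Fin m → Fin n → ℝ,
      (∀ r j, g r j ∈ reluSubdiff (inner ℝ (W t r) (Z j))) ∧
      (∀ r, HasDerivAt (fun τ => W τ r) (-lossGrad Z M A (W t) r (g r)) t) ∧
      ∀ s i, HasDerivAt (fun τ => residual Z M A (W τ) s i)
        (-∑ h, ∑ j, gram Z A g s i h j * residual Z M A (W t) h j) t := by
  have h1 : ∀ᵐ t, ∀ (r : Fin m) (i : Fin n), t ∈ Set.uIcc 0 T →
      DifferentiableAt ℝ (fun τ => relu (inner ℝ (W τ r) (Z i))) t :=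
    ae_all_iff.2 fun r => ae_all_iff.2 fun i =>
      (hW.absolutelyContinuous_relu r (Z i) hT).ae_differentiableAt
  have h2 := (ae_restrict_iff' measurableSet_Ioi).1 hW.hasDerivAt
  filter_upwards [h1, h2] with t h1 h2 ht
  choose g hg hd using h2 ht.1
  refine ⟨g, hg, hd, fun s i => ?_⟩
  have h3 : ∀ r, HasDerivAt (fun τ => relu (inner ℝ (W τ r) (Z i)))
      (g r i * inner ℝ (-lossGrad Z M A (W t) r (g r)) (Z i)) t := fun r => by
    refine hasDerivAt_relu_comp ?_
      (h1 r i (Set.Ioo_subset_Icc_self.trans Set.Icc_subset_uIcc ht)) (hg r i)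
    have := (hd r).inner ℝ (hasDerivAt_const t (Z i))
    simpa using this
  have h4 : HasDerivAt (fun τ => residual Z M A (W τ) s i) ((1 / √(m : ℝ)) * ∑ r, A r s *
      (g r i * inner ℝ (-lossGrad Z M A (W t) r (g r)) (Z i))) t := by
    simp only [residual_eq]
    exact ((HasDerivAt.fun_sum fun r _ => (h3 r).const_mul (A r s)).const_mul _).sub_const _
  refine h4.congr_deriv ?_
  have hm : (1 / √(m : ℝ)) * (1 / √(m : ℝ)) = 1 / (m : ℝ) := by
    rw [div_mul_div_comm, Real.mul_self_sqrt (Nat.cast_nonneg _), one_mul]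
  simp only [inner_neg_lossGrad, gram, mul_neg, Finset.sum_neg_distrib, neg_inj,
    Finset.mul_sum, Finset.sum_mul, ← hm]
  rw [Finset.sum_comm]
  refine Finset.sum_congr rfl fun h _ => ?_
  rw [Finset.sum_comm]
  refine Finset.sum_congr rfl fun j _ => Finset.sum_congr rfl fun r _ => ?_
  rw [real_inner_comm]
  ring

end Flow

/-! ### Perturbation of the tangent kernel -/

theorem abs_sum_mul_le_sqrt_mul_sqrt {ι : Type*} (s : Finset ι) (f g : ι → ℝ) :
    |∑ i ∈ s, f i * g i| ≤ √(∑ i ∈ s, f i ^ 2) * √(∑ i ∈ s, g i ^ 2) := by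
  rw [← Real.sqrt_mul (Finset.sum_nonneg fun i _ => sq_nonneg _)]
  exact Real.abs_le_sqrt (Finset.sum_mul_sq_le_sq_mul_sq s f g)

/-- The derivative of ReLU at `w_rᵀ Z_i`, with the convention `σ'(0) = 1` of `ntkGram`. -/
noncomputable def slope {d m n : ℕ} (Z : Fin n → EuclideanSpace ℝ (Fin d))
    (W : Fin m → EuclideanSpace ℝ (Fin d)) (r : Fin m) (i : Fin n) : ℝ :=
  if 0 ≤ (inner ℝ (W r) (Z i) : ℝ) then 1 else 0

/-- The indicator that the pre-activation `w_rᵀ Z_i` lies within `R` of the kink; only then can a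
displacement of `w_r` by at most `R` change the slope of ReLU there. -/
noncomputable def nearKink {d m n : ℕ} (R : ℝ) (Z : Fin n → EuclideanSpace ℝ (Fin d))
    (W : Fin m → EuclideanSpace ℝ (Fin d)) (r : Fin m) (i : Fin n) : ℝ :=
  if |(inner ℝ (W r) (Z i) : ℝ)| ≤ R then 1 else 0

/-- The properties of the initialization that force the convergence: the residuals are not too
large in total (`B`) and no output starts with a tiny residual (`ε`), the initial tangent kernel
is close to `H` on the diagonal blocks and to `0` off them (`τ`), and the neurons that are close to
a kink are few, with second-layer weights spread evenly over all directions. -/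
structure GoodInit {d m k n : ℕ} (Z : Fin n → EuclideanSpace ℝ (Fin d))
    (M : Fin n → EuclideanSpace ℝ (Fin k)) (H : Matrix (Fin n) (Fin n) ℝ) (R B ε τ : ℝ)
    (W : Fin m → EuclideanSpace ℝ (Fin d)) (A : Fin m → Fin k → ℝ) : Prop where
  sign : ∀ r s, |A r s| = 1
  total : ∑ s, ∑ i, residual Z M A W s i ^ 2 ≤ B ^ 2
  lower : ∀ s, ε ^ 2 ≤ ∑ i, residual Z M A W s i ^ 2
  kernel : ∀ s, ∑ i, ∑ h, ∑ j,
    (gram Z A (slope Z W) s i h j - if s = h then H i j else 0) ^ 2 ≤ τ ^ 2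
  near_count : ∀ i, ∑ r, nearKink R Z W r i ≤ 2 * R * m
  near_form : ∀ i (v : Fin k → ℝ),
    ∑ r, nearKink R Z W r i * (∑ h, A r h * v h) ^ 2 ≤ 2 * R * m * ∑ h, v h ^ 2

section Perturbation

variable {d m k n : ℕ} {Z : Fin n → EuclideanSpace ℝ (Fin d)}
  {M : Fin n → EuclideanSpace ℝ (Fin k)} {H : Matrix (Fin n) (Fin n) ℝ} {R B ε τ : ℝ}
  {A : Fin m → Fin k → ℝ} {W₀ W : Fin m → EuclideanSpace ℝ (Fin d)} {g : Fin m → Fin n → ℝ}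

theorem nearKink_nonneg (r : Fin m) (i : Fin n) : 0 ≤ nearKink R Z W r i := by
  unfold nearKink; split_ifs <;> norm_num

theorem nearKink_sq (r : Fin m) (i : Fin n) : nearKink R Z W r i ^ 2 = nearKink R Z W r i := by
  unfold nearKink; split_ifs <;> norm_num

theorem slope_mem_Icc (r : Fin m) (i : Fin n) : slope Z W r i ∈ Set.Icc (0 : ℝ) 1 := by
  unfold slope; split_ifs <;> norm_num

theorem eq_slope_of_nearKink_eq_zero (hZ : ∀ i, ‖Z i‖ = 1) {r : Fin m} (hW : ‖W r - W₀ r‖ ≤ R)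
    {i : Fin n} (hg : g r i ∈ reluSubdiff (inner ℝ (W r) (Z i)))
    (h : nearKink R Z W₀ r i = 0) : g r i = slope Z W₀ r i := by
  have hlt : R < |(inner ℝ (W₀ r) (Z i) : ℝ)| := by
    unfold nearKink at h
    split_ifs at h with h'
    · norm_num at h
    · exact not_le.1 h'
  have hd : |(inner ℝ (W r) (Z i) : ℝ) - inner ℝ (W₀ r) (Z i)| ≤ R := by
    rw [← inner_sub_left]
    refine (abs_real_inner_le_norm _ _).trans ?_
    rw [hZ, mul_one]
    exact hW
  obtain ⟨-, -, hp, hn⟩ := (mem_reluSubdiff_iff _ _).1 hg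
  rw [abs_le] at hd
  unfold slope
  split_ifs with hs
  · rw [abs_of_nonneg hs] at hlt
    exact hp (by linarith)
  · rw [abs_of_neg (not_le.1 hs)] at hlt
    exact hn (by linarith)

theorem abs_slopes_sub_le (hZ : ∀ i, ‖Z i‖ = 1) {r : Fin m} (hW : ‖W r - W₀ r‖ ≤ R)
    (hg : ∀ j, g r j ∈ reluSubdiff (inner ℝ (W r) (Z j))) (i j : Fin n) :
    |g r i * g r j - slope Z W₀ r i * slope Z W₀ r j| ≤
      nearKink R Z W₀ r i + nearKink R Z W₀ r j := by
  have hb : ∀ l, nearKink R Z W₀ r l = 0 ∨ nearKink R Z W₀ r l = 1 := fun l => by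
    unfold nearKink; split_ifs <;> simp
  have hone : |g r i * g r j - slope Z W₀ r i * slope Z W₀ r j| ≤ 1 := by
    obtain ⟨a0, a1, -⟩ := (mem_reluSubdiff_iff _ _).1 (hg i)
    obtain ⟨b0, b1, -⟩ := (mem_reluSubdiff_iff _ _).1 (hg j)
    obtain ⟨c0, c1⟩ := slope_mem_Icc (Z := Z) (W := W₀) r i
    obtain ⟨d0, d1⟩ := slope_mem_Icc (Z := Z) (W := W₀) r j
    have e1 := mul_le_one₀ a1 b0 b1
    have e2 := mul_le_one₀ c1 d0 d1
    have e3 := mul_nonneg a0 b0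
    have e4 := mul_nonneg c0 d0
    rw [abs_le]
    constructor <;> linarith
  rcases hb i with hi | hi
  · rcases hb j with hj | hj
    · rw [eq_slope_of_nearKink_eq_zero hZ hW (hg i) hi,
        eq_slope_of_nearKink_eq_zero hZ hW (hg j) hj, hi, hj]
      simp
    · rw [hi, hj]
      linarith
  · have := nearKink_nonneg (R := R) (Z := Z) (W := W₀) r j
    rw [hi]
    linarith

/-- Cauchy–Schwarz over the neurons near a kink. The number of these neurons and the quadratic form
of their second-layer weights both scale like `R m`, so no factor `√k` is lost against the trivial
bound `|A_r · v| ≤ √k ‖v‖`. -/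
theorem GoodInit.sum_nearKink_mul_abs_le (h : GoodInit Z M H R B ε τ W₀ A) (hR : 0 ≤ R)
    (i : Fin n) (v : Fin k → ℝ) :
    ∑ r, nearKink R Z W₀ r i * |∑ h, A r h * v h| ≤ 2 * R * m * √(∑ h, v h ^ 2) := by
  have h1 := Real.sum_mul_le_sqrt_mul_sqrt Finset.univ (fun r => nearKink R Z W₀ r i)
    (fun r => nearKink R Z W₀ r i * |∑ h, A r h * v h|)
  have h2 : ∀ r, nearKink R Z W₀ r i * (nearKink R Z W₀ r i * |∑ h, A r h * v h|) =
      nearKink R Z W₀ r i * |∑ h, A r h * v h| := fun r => by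
    rw [← mul_assoc, ← sq, nearKink_sq]
  simp only [mul_pow, sq_abs, nearKink_sq, h2] at h1
  refine h1.trans ?_
  have h0 : 0 ≤ 2 * R * m := by positivity
  calc _ ≤ √(2 * R * m) * √(2 * R * m * ∑ h, v h ^ 2) :=
        mul_le_mul (Real.sqrt_le_sqrt (h.near_count i)) (Real.sqrt_le_sqrt (h.near_form i v))
          (Real.sqrt_nonneg _) (Real.sqrt_nonneg _)
    _ = _ := by rw [Real.sqrt_mul h0, ← mul_assoc, Real.mul_self_sqrt h0]

theorem GoodInit.abs_sum_gram_sub_le (h : GoodInit Z M H R B ε τ W₀ A) (hR : 0 ≤ R)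
    (hZ : ∀ i, ‖Z i‖ = 1) (hW : ∀ r, ‖W r - W₀ r‖ ≤ R)
    (hg : ∀ r j, g r j ∈ reluSubdiff (inner ℝ (W r) (Z j))) (s : Fin k) (i j : Fin n)
    (v : Fin k → ℝ) :
    |∑ h, (gram Z A g s i h j - gram Z A (slope Z W₀) s i h j) * v h| ≤
      4 * R * √(∑ h, v h ^ 2) := by
  have h1 : ∑ h, (gram Z A g s i h j - gram Z A (slope Z W₀) s i h j) * v h =
      1 / (m : ℝ) * ∑ r, A r s * (g r i * g r j - slope Z W₀ r i * slope Z W₀ r j) *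
        inner ℝ (Z i) (Z j) * ∑ h, A r h * v h := by
    simp only [gram, ← mul_sub, ← Finset.sum_sub_distrib, Finset.mul_sum, Finset.sum_mul]
    rw [Finset.sum_comm]
    refine Finset.sum_congr rfl fun r _ => Finset.sum_congr rfl fun h _ => ?_
    ring
  rw [h1, abs_mul, abs_of_nonneg (by positivity : (0 : ℝ) ≤ 1 / m)]
  have hin : |(inner ℝ (Z i) (Z j) : ℝ)| ≤ 1 := by
    simpa [hZ] using abs_real_inner_le_norm (Z i) (Z j)
  have h2 : |∑ r, A r s * (g r i * g r j - slope Z W₀ r i * slope Z W₀ r j) *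
      inner ℝ (Z i) (Z j) * ∑ h, A r h * v h| ≤ 4 * R * m * √(∑ h, v h ^ 2) := by
    calc _ ≤ ∑ r, (nearKink R Z W₀ r i * |∑ h, A r h * v h| +
          nearKink R Z W₀ r j * |∑ h, A r h * v h|) := by
          refine (Finset.abs_sum_le_sum_abs _ _).trans (Finset.sum_le_sum fun r _ => ?_)
          rw [abs_mul, abs_mul, abs_mul, h.sign, one_mul, ← add_mul]
          refine mul_le_mul_of_nonneg_right ?_ (abs_nonneg _)
          calc _ ≤ |g r i * g r j - slope Z W₀ r i * slope Z W₀ r j| * 1 :=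
                mul_le_mul_of_nonneg_left hin (abs_nonneg _)
            _ ≤ _ := by
                rw [mul_one]
                exact abs_slopes_sub_le hZ (hW r) (hg r) i j
      _ ≤ 2 * R * m * √(∑ h, v h ^ 2) + 2 * R * m * √(∑ h, v h ^ 2) := by
          rw [Finset.sum_add_distrib]
          exact add_le_add (h.sum_nearKink_mul_abs_le hR i v) (h.sum_nearKink_mul_abs_le hR j v)
      _ = _ := by ring
  have h3 : 1 / (m : ℝ) * m ≤ 1 := by
    rw [one_div]
    exact inv_mul_le_one
  calc _ ≤ 1 / (m : ℝ) * (4 * R * m * √(∑ h, v h ^ 2)) :=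
        mul_le_mul_of_nonneg_left h2 (by positivity)
    _ = (1 / (m : ℝ) * m) * (4 * R * √(∑ h, v h ^ 2)) := by ring
    _ ≤ 1 * (4 * R * √(∑ h, v h ^ 2)) := mul_le_mul_of_nonneg_right h3 (by positivity)
    _ = _ := one_mul _

/-- As long as no neuron has moved by more than `R`, the `s`-th block row of the tangent kernel
acts on the residuals like `H` on the `s`-th residual, up to an error `τ + 4 n R`. -/
theorem GoodInit.abs_form_sub_le (h : GoodInit Z M H R B ε τ W₀ A) (hR : 0 ≤ R) (hτ : 0 ≤ τ)
    (hZ : ∀ i, ‖Z i‖ = 1) (hW : ∀ r, ‖W r - W₀ r‖ ≤ R)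
    (hg : ∀ r j, g r j ∈ reluSubdiff (inner ℝ (W r) (Z j))) (u : Fin k → Fin n → ℝ) (s : Fin k) :
    |∑ i, u s i * (∑ h, ∑ j, gram Z A g s i h j * u h j) - ∑ i, ∑ j, u s i * H i j * u s j| ≤
      (τ + 4 * n * R) * (√(∑ i, u s i ^ 2) * √(∑ h, ∑ j, u h j ^ 2)) := by
  set Q : ℝ := ∑ h, ∑ j, u h j ^ 2 with hQ
  have hQ0 : 0 ≤ Q := by positivity
  set X : Fin n → ℝ := fun i => ∑ j, ∑ h,
    (gram Z A g s i h j - gram Z A (slope Z W₀) s i h j) * u h j with hX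
  set Y : Fin n → ℝ := fun i => ∑ p : Fin k × Fin n,
    (gram Z A (slope Z W₀) s i p.1 p.2 - if s = p.1 then H i p.2 else 0) * u p.1 p.2 with hY
  have hsplit : ∑ i, u s i * (∑ h, ∑ j, gram Z A g s i h j * u h j) -
      ∑ i, ∑ j, u s i * H i j * u s j = ∑ i, u s i * X i + ∑ i, u s i * Y i := by
    rw [← Finset.sum_add_distrib, ← Finset.sum_sub_distrib]
    refine Finset.sum_congr rfl fun i _ => ?_
    have e1 : ∑ j, u s i * H i j * u s j = u s i * ∑ j, H i j * u s j := by
      rw [Finset.mul_sum]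
      exact Finset.sum_congr rfl fun j _ => by ring
    rw [e1, ← mul_sub, ← mul_add]
    congr 1
    have e2 : ∑ j, H i j * u s j = ∑ h, ∑ j, (if s = h then H i j else 0) * u h j := by
      rw [Finset.sum_eq_single s]
      · simp
      · intro b _ hb
        simp [Ne.symm hb]
      · simp
    have e3 : X i = ∑ h, ∑ j, (gram Z A g s i h j - gram Z A (slope Z W₀) s i h j) * u h j :=
      Finset.sum_comm
    rw [e2, e3, hY]
    simp only [Fintype.sum_prod_type, ← Finset.sum_add_distrib, ← Finset.sum_sub_distrib]
    refine Finset.sum_congr rfl fun h _ => Finset.sum_congr rfl fun j _ => ?_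
    ring
  have hXi : ∀ i, X i ^ 2 ≤ (4 * R) ^ 2 * (n * Q) := by
    intro i
    have e1 : |X i| ≤ 4 * R * ∑ j, √(∑ h, u h j ^ 2) := by
      rw [Finset.mul_sum]
      exact (Finset.abs_sum_le_sum_abs _ _).trans
        (Finset.sum_le_sum fun j _ => h.abs_sum_gram_sub_le hR hZ hW hg s i j fun h => u h j)
    have e2 : (∑ j, √(∑ h, u h j ^ 2)) ^ 2 ≤ n * Q := by
      refine sq_sum_le_card_mul_sum_sq.trans (le_of_eq ?_)
      rw [Finset.card_univ, Fintype.card_fin, hQ, Finset.sum_comm]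
      congr 1
      exact Finset.sum_congr rfl fun j _ =>
        Real.sq_sqrt (Finset.sum_nonneg fun h _ => sq_nonneg _)
    calc X i ^ 2 = |X i| ^ 2 := (sq_abs _).symm
      _ ≤ (4 * R * ∑ j, √(∑ h, u h j ^ 2)) ^ 2 := pow_le_pow_left₀ (abs_nonneg _) e1 2
      _ = (4 * R) ^ 2 * (∑ j, √(∑ h, u h j ^ 2)) ^ 2 := mul_pow _ _ _
      _ ≤ _ := mul_le_mul_of_nonneg_left e2 (sq_nonneg _)
  have hXs : √(∑ i, X i ^ 2) ≤ 4 * n * R * √Q := by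
    rw [← Real.sqrt_sq (by positivity : 0 ≤ 4 * n * R), ← Real.sqrt_mul (sq_nonneg _)]
    refine Real.sqrt_le_sqrt ((Finset.sum_le_sum fun i _ => hXi i).trans (le_of_eq ?_))
    simp
    ring
  have hYs : √(∑ i, Y i ^ 2) ≤ τ * √Q := by
    rw [← Real.sqrt_sq hτ, ← Real.sqrt_mul (sq_nonneg _)]
    refine Real.sqrt_le_sqrt ?_
    refine le_trans ?_ (mul_le_mul_of_nonneg_right (h.kernel s) hQ0)
    rw [Finset.sum_mul]
    refine Finset.sum_le_sum fun i _ => ?_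
    refine (Finset.sum_mul_sq_le_sq_mul_sq _ _ _).trans (le_of_eq ?_)
    rw [hQ, Fintype.sum_prod_type, Fintype.sum_prod_type]
  have hq0 := Real.sqrt_nonneg (∑ i, u s i ^ 2)
  rw [hsplit]
  calc _ ≤ |∑ i, u s i * X i| + |∑ i, u s i * Y i| := abs_add_le _ _
    _ ≤ √(∑ i, u s i ^ 2) * (4 * n * R * √Q) + √(∑ i, u s i ^ 2) * (τ * √Q) :=
        add_le_add
          ((abs_sum_mul_le_sqrt_mul_sqrt _ _ _).trans (mul_le_mul_of_nonneg_left hXs hq0))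
          ((abs_sum_mul_le_sqrt_mul_sqrt _ _ _).trans (mul_le_mul_of_nonneg_left hYs hq0))
    _ = _ := by ring

end Perturbation

/-! ### Convergence from a good initialization -/

section Convergence

variable {d m k n : ℕ} {Z : Fin n → EuclideanSpace ℝ (Fin d)}
  {M : Fin n → EuclideanSpace ℝ (Fin k)} {H : Matrix (Fin n) (Fin n) ℝ} {R B ε τ lam : ℝ}
  {A : Fin m → Fin k → ℝ} {W₀ : Fin m → EuclideanSpace ℝ (Fin d)}
  {W : ℝ → Fin m → EuclideanSpace ℝ (Fin d)}

theorem hasDerivAt_exp_mul {f : ℝ → ℝ} {f' t : ℝ} (c : ℝ) (hf : HasDerivAt f f' t) :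
    HasDerivAt (fun τ => Real.exp (c * τ) * f τ) (Real.exp (c * t) * (c * f t + f')) t := by
  have h1 : HasDerivAt (fun τ => Real.exp (c * τ)) (Real.exp (c * t) * (c * 1)) t :=
    ((hasDerivAt_id t).const_mul c).exp
  exact (h1.mul hf).congr_deriv (by ring)

theorem absolutelyContinuousOnInterval_exp_mul (c a b : ℝ) :
    AbsolutelyContinuousOnInterval (fun t => Real.exp (c * t)) a b :=
  ContDiffOn.absolutelyContinuousOnInterval (by fun_prop)

theorem IsGradientFlow.absolutelyContinuous_sum_sq (hW : IsGradientFlow Z M A W₀ W) (s : Fin k)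
    {T : ℝ} (hT : 0 < T) :
    AbsolutelyContinuousOnInterval (fun t => ∑ i, residual Z M A (W t) s i ^ 2) 0 T := by
  simp only [sq]
  exact absolutelyContinuousOnInterval_sum _ fun i _ =>
    (hW.absolutelyContinuous_residual s i hT).fun_mul (hW.absolutelyContinuous_residual s i hT)

/-- The energy inequality for a single output: decay at rate `2 lam`, up to a coupling with the
other outputs. -/
theorem GoodInit.ae_hasDerivAt_sum_sq (h : GoodInit Z M H R B ε τ W₀ A)
    (hW : IsGradientFlow Z M A W₀ W) (hZ : ∀ i, ‖Z i‖ = 1) (hR : 0 ≤ R) (hτ : 0 ≤ τ)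
    (hH : ∀ v : Fin n → ℝ, lam * ∑ i, v i ^ 2 ≤ ∑ i, ∑ j, v i * H i j * v j) {T : ℝ}
    (hT : 0 < T) (hWR : ∀ t ∈ Set.Ioo 0 T, ∀ r, ‖W t r - W₀ r‖ ≤ R) :
    ∀ᵐ t, t ∈ Set.Ioo 0 T → ∀ s, ∃ q',
      HasDerivAt (fun t => ∑ i, residual Z M A (W t) s i ^ 2) q' t ∧
      q' ≤ -2 * lam * (∑ i, residual Z M A (W t) s i ^ 2) + 2 * ((τ + 4 * n * R) *
        (√(∑ i, residual Z M A (W t) s i ^ 2) * √(∑ h, ∑ j, residual Z M A (W t) h j ^ 2))) := by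
  filter_upwards [hW.ae_hasDerivAt_residual hT] with t ht hmem s
  obtain ⟨g, hg, -, hd⟩ := ht hmem
  refine ⟨_, HasDerivAt.fun_sum fun i _ => (hd s i).fun_pow 2, ?_⟩
  have h1 := h.abs_form_sub_le hR hτ hZ (hWR t hmem) hg (fun h j => residual Z M A (W t) h j) s
  have h2 := hH fun i => residual Z M A (W t) s i
  rw [abs_le] at h1
  have h3 : ∑ i, ((2 : ℕ) : ℝ) * residual Z M A (W t) s i ^ (2 - 1) *
      (-∑ h, ∑ j, gram Z A g s i h j * residual Z M A (W t) h j) =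
      -(2 * ∑ i, residual Z M A (W t) s i *
        (∑ h, ∑ j, gram Z A g s i h j * residual Z M A (W t) h j)) := by
    rw [Finset.mul_sum, ← Finset.sum_neg_distrib]
    refine Finset.sum_congr rfl fun i _ => ?_
    norm_num
    ring
  rw [h3]
  linarith [h1.1]

/-- While no neuron has moved by more than `R`, the total squared residual decays at rate `lam`. -/
theorem GoodInit.exp_mul_total_le (h : GoodInit Z M H R B ε τ W₀ A)
    (hW : IsGradientFlow Z M A W₀ W) (hZ : ∀ i, ‖Z i‖ = 1) (hR : 0 ≤ R) (hτ : 0 ≤ τ)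
    (hH : ∀ v : Fin n → ℝ, lam * ∑ i, v i ^ 2 ≤ ∑ i, ∑ j, v i * H i j * v j)
    (hk : 2 * (τ + 4 * n * R) * √(k : ℝ) ≤ lam) {T : ℝ}
    (hT : 0 < T) (hWR : ∀ t ∈ Set.Ioo 0 T, ∀ r, ‖W t r - W₀ r‖ ≤ R) :
    Real.exp (lam * T) * ∑ s, ∑ i, residual Z M A (W T) s i ^ 2 ≤ B ^ 2 := by
  have hac : AbsolutelyContinuousOnInterval
      (fun t => Real.exp (lam * t) * ∑ s, ∑ i, residual Z M A (W t) s i ^ 2) 0 T :=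
    (absolutelyContinuousOnInterval_exp_mul lam 0 T).fun_mul
      (absolutelyContinuousOnInterval_sum _ fun s _ => hW.absolutelyContinuous_sum_sq s hT)
  have key := le_of_ae_hasDerivAt_nonpos hT.le hac ?_
  · refine key.trans ?_
    rw [mul_zero, Real.exp_zero, one_mul, hW.init]
    exact h.total
  filter_upwards [h.ae_hasDerivAt_sum_sq hW hZ hR hτ hH hT hWR] with t ht hmem
  choose q' hd hq using ht hmem
  refine ⟨_, hasDerivAt_exp_mul lam (HasDerivAt.fun_sum fun s _ => hd s), ?_⟩
  refine mul_nonpos_of_nonneg_of_nonpos (Real.exp_pos _).le ?_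
  set q : Fin k → ℝ := fun s => ∑ i, residual Z M A (W t) s i ^ 2 with hqdef
  have hq0 : ∀ s, 0 ≤ q s := fun s => Finset.sum_nonneg fun i _ => sq_nonneg _
  have hQ0 : 0 ≤ ∑ s, q s := Finset.sum_nonneg fun s _ => hq0 s
  have hκ : 0 ≤ τ + 4 * n * R := by positivity
  have h1 : ∑ s, q' s ≤ -2 * lam * ∑ s, q s +
      2 * ((τ + 4 * n * R) * ((∑ s, √(q s)) * √(∑ s, q s))) := by
    rw [Finset.mul_sum, Finset.sum_mul, Finset.mul_sum, Finset.mul_sum, ← Finset.sum_add_distrib]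
    exact Finset.sum_le_sum fun s _ => hq s
  have h2 : ∑ s, √(q s) ≤ √(k : ℝ) * √(∑ s, q s) := by
    rw [← Real.sqrt_mul (Nat.cast_nonneg _)]
    refine Real.le_sqrt_of_sq_le (sq_sum_le_card_mul_sum_sq.trans (le_of_eq ?_))
    rw [Finset.card_univ, Fintype.card_fin]
    congr 1
    exact Finset.sum_congr rfl fun s _ => Real.sq_sqrt (hq0 s)
  have h3 : (∑ s, √(q s)) * √(∑ s, q s) ≤ √(k : ℝ) * ∑ s, q s := by
    calc _ ≤ √(k : ℝ) * √(∑ s, q s) * √(∑ s, q s) :=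
          mul_le_mul_of_nonneg_right h2 (Real.sqrt_nonneg _)
      _ = _ := by rw [mul_assoc, Real.mul_self_sqrt hQ0]
  have h4 : 2 * ((τ + 4 * n * R) * ((∑ s, √(q s)) * √(∑ s, q s))) ≤ lam * ∑ s, q s := by
    calc _ ≤ 2 * ((τ + 4 * n * R) * (√(k : ℝ) * ∑ s, q s)) := by gcongr
      _ = 2 * (τ + 4 * n * R) * √(k : ℝ) * ∑ s, q s := by ring
      _ ≤ _ := mul_le_mul_of_nonneg_right hk hQ0
  linarith

theorem norm_lossGrad_le (hA : ∀ r s, |A r s| = 1) (hZ : ∀ i, ‖Z i‖ = 1)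
    (W : Fin m → EuclideanSpace ℝ (Fin d)) (r : Fin m) {g : Fin n → ℝ}
    (hg : ∀ j, g j ∈ reluSubdiff (inner ℝ (W r) (Z j))) :
    ‖lossGrad Z M A W r g‖ ≤
      √(n * k / m : ℝ) * √(∑ s, ∑ i, residual Z M A W s i ^ 2) := by
  have h1 : ‖lossGrad Z M A W r g‖ ≤
      1 / √(m : ℝ) * ∑ p : Fin k × Fin n, |residual Z M A W p.1 p.2| := by
    rw [Fintype.sum_prod_type, Finset.sum_comm, Finset.mul_sum]
    refine (norm_sum_le _ _).trans (Finset.sum_le_sum fun j _ => ?_)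
    rw [Finset.mul_sum]
    refine (norm_sum_le _ _).trans (Finset.sum_le_sum fun h _ => ?_)
    obtain ⟨g0, g1, -⟩ := (mem_reluSubdiff_iff _ _).1 (hg j)
    rw [norm_smul, norm_smul, hZ, mul_one, Real.norm_eq_abs, Real.norm_eq_abs, abs_mul, abs_mul,
      hA, mul_one, abs_of_nonneg g0, abs_of_nonneg (by positivity : 0 ≤ 1 / √(m : ℝ)), mul_comm]
    refine mul_le_mul_of_nonneg_right ?_ (abs_nonneg _)
    exact mul_le_of_le_one_right (by positivity) g1
  have h2 : ∑ p : Fin k × Fin n, |residual Z M A W p.1 p.2| ≤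
      √(n * k : ℝ) * √(∑ s, ∑ i, residual Z M A W s i ^ 2) := by
    rw [← Real.sqrt_mul (by positivity)]
    refine Real.le_sqrt_of_sq_le (sq_sum_le_card_mul_sum_sq.trans (le_of_eq ?_))
    simp only [Finset.card_univ, Fintype.card_prod, Fintype.card_fin, sq_abs,
      Fintype.sum_prod_type, Nat.cast_mul]
    ring
  refine h1.trans ((mul_le_mul_of_nonneg_left h2 (by positivity)).trans (le_of_eq ?_))
  rw [Real.sqrt_div (by positivity)]
  ring

/-- While no neuron has moved by more than `R`, the exponential decay of the residuals confines the
neurons to a ball of radius `2 (n k / m)^{1/2} B / lam`. -/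
theorem GoodInit.norm_sub_le (h : GoodInit Z M H R B ε τ W₀ A)
    (hW : IsGradientFlow Z M A W₀ W) (hZ : ∀ i, ‖Z i‖ = 1) (hR : 0 ≤ R) (hτ : 0 ≤ τ) (hB : 0 ≤ B)
    (hlam : 0 < lam)
    (hH : ∀ v : Fin n → ℝ, lam * ∑ i, v i ^ 2 ≤ ∑ i, ∑ j, v i * H i j * v j)
    (hk : 2 * (τ + 4 * n * R) * √(k : ℝ) ≤ lam) {T : ℝ}
    (hT : 0 < T) (hWR : ∀ t ∈ Set.Ioo 0 T, ∀ r, ‖W t r - W₀ r‖ ≤ R) (r : Fin m) :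
    ‖W T r - W₀ r‖ ≤ 2 * √(n * k / m : ℝ) * B / lam := by
  set v := W T r - W₀ r with hv
  set c := √(n * k / m : ℝ) * B with hc
  have hc0 : 0 ≤ c := by positivity
  have hac : AbsolutelyContinuousOnInterval
      (fun t => (inner ℝ (W t r - W₀ r) v : ℝ) +
        2 * c * ‖v‖ / lam * Real.exp (-(lam / 2) * t)) 0 T :=
    (hW.absolutelyContinuous_inner r v _ hT).fun_add
      ((absolutelyContinuousOnInterval_exp_mul _ 0 T).const_mul _)
  have key := le_of_ae_hasDerivAt_nonpos hT.le hac ?_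
  · have e0 : W 0 r - W₀ r = 0 := by rw [hW.init, sub_self]
    simp only [e0, inner_zero_left, mul_zero, Real.exp_zero, mul_one, zero_add, ← hv,
      real_inner_self_eq_norm_sq] at key
    have e1 : 0 ≤ 2 * c * ‖v‖ / lam * Real.exp (-(lam / 2) * T) := by positivity
    have e2 : ‖v‖ ^ 2 ≤ 2 * c / lam * ‖v‖ := by
      calc ‖v‖ ^ 2 ≤ 2 * c * ‖v‖ / lam := by linarith
        _ = _ := by ring
    have e3 : ‖v‖ ≤ 2 * c / lam := by
      rcases (norm_nonneg v).eq_or_lt with h0 | h0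
      · rw [← h0]; positivity
      · rw [sq] at e2
        exact le_of_mul_le_mul_right e2 h0
    calc ‖v‖ ≤ 2 * c / lam := e3
      _ = _ := by rw [hc]; ring
  filter_upwards [hW.ae_hasDerivAt_residual hT] with t ht hmem
  obtain ⟨g, hg, hd, -⟩ := ht hmem
  have hd1 : HasDerivAt (fun τ => (inner ℝ (W τ r - W₀ r) v : ℝ))
      (inner ℝ (-lossGrad Z M A (W t) r (g r)) v) t := by
    simpa using ((hd r).sub_const (W₀ r)).inner ℝ (hasDerivAt_const t v)
  have hd2 : HasDerivAt (fun τ => Real.exp (-(lam / 2) * τ))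
      (Real.exp (-(lam / 2) * t) * (-(lam / 2) * 1)) t :=
    ((hasDerivAt_id t).const_mul _).exp
  refine ⟨_, hd1.add (hd2.const_mul _), ?_⟩
  have hQ := h.exp_mul_total_le hW hZ hR hτ hH hk hmem.1
    fun t' ht' => hWR t' ⟨ht'.1, ht'.2.trans hmem.2⟩
  have hsq : √(∑ s, ∑ i, residual Z M A (W t) s i ^ 2) ≤ Real.exp (-(lam / 2) * t) * B := by
    refine Real.sqrt_le_iff.2 ⟨by positivity, ?_⟩
    rw [mul_pow, ← Real.exp_nat_mul]
    have e1 : ((2 : ℕ) : ℝ) * (-(lam / 2) * t) = -(lam * t) := by push_cast; ring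
    rw [e1, Real.exp_neg, ← div_eq_inv_mul, le_div_iff₀ (Real.exp_pos _), mul_comm]
    exact hQ
  have hin : (inner ℝ (-lossGrad Z M A (W t) r (g r)) v : ℝ) ≤
      c * ‖v‖ * Real.exp (-(lam / 2) * t) := by
    calc _ ≤ ‖-lossGrad Z M A (W t) r (g r)‖ * ‖v‖ := real_inner_le_norm _ _
      _ ≤ √(n * k / m : ℝ) * (Real.exp (-(lam / 2) * t) * B) * ‖v‖ := by
          rw [norm_neg]
          refine mul_le_mul_of_nonneg_right ?_ (norm_nonneg _)
          exact (norm_lossGrad_le h.sign hZ (W t) r (hg r)).trans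
            (mul_le_mul_of_nonneg_left hsq (Real.sqrt_nonneg _))
      _ = _ := by rw [hc]; ring
  have e4 : 2 * c * ‖v‖ / lam * (Real.exp (-(lam / 2) * t) * (-(lam / 2) * 1)) =
      -(c * ‖v‖ * Real.exp (-(lam / 2) * t)) := by field_simp
  rw [e4]
  linarith

/-- No neuron ever leaves the ball of radius `R` about its initial position: at the first exit
time the bound of `GoodInit.norm_sub_le` would be violated. -/
theorem GoodInit.norm_sub_lt (h : GoodInit Z M H R B ε τ W₀ A)
    (hW : IsGradientFlow Z M A W₀ W) (hZ : ∀ i, ‖Z i‖ = 1) (hτ : 0 ≤ τ) (hB : 0 ≤ B)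
    (hlam : 0 < lam)
    (hH : ∀ v : Fin n → ℝ, lam * ∑ i, v i ^ 2 ≤ ∑ i, ∑ j, v i * H i j * v j)
    (hk : 2 * (τ + 4 * n * R) * √(k : ℝ) ≤ lam)
    (hmove : 2 * √(n * k / m : ℝ) * B / lam < R) {t : ℝ} (ht : 0 ≤ t) (r : Fin m) :
    ‖W t r - W₀ r‖ < R := by
  have hR : 0 < R := lt_of_le_of_lt (by positivity) hmove
  by_contra hcon
  rw [not_lt] at hcon
  have ht0 : 0 < t := by
    rcases ht.eq_or_lt with h0 | h0
    · rw [← h0, hW.init, sub_self, norm_zero] at hcon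
      linarith
    · exact h0
  set S : Set ℝ := ⋃ q : Fin m, Set.Icc 0 t ∩ (fun τ => ‖W τ q - W₀ q‖) ⁻¹' Set.Ici R with hS
  have hScomp : IsCompact S := by
    refine isCompact_iUnion fun q => ?_
    have hcont : ContinuousOn (fun τ => ‖W τ q - W₀ q‖) (Set.Icc 0 t) := by
      have := (hW.absolutelyContinuous q t ht0).continuousOn
      rw [Set.uIcc_of_le ht] at this
      exact (this.sub continuousOn_const).norm
    exact isCompact_Icc.of_isClosed_subset
      (hcont.preimage_isClosed_of_isClosed isClosed_Icc isClosed_Ici) Set.inter_subset_left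
  obtain ⟨T, hTS, hTmin⟩ := hScomp.exists_isLeast ⟨t, Set.mem_iUnion.2 ⟨r, ⟨ht, le_rfl⟩, hcon⟩⟩
  obtain ⟨q, ⟨hT0, hTt⟩, hTq⟩ := Set.mem_iUnion.1 hTS
  have hTq : R ≤ ‖W T q - W₀ q‖ := hTq
  have hTpos : 0 < T := by
    rcases hT0.eq_or_lt with h0 | h0
    · rw [← h0, hW.init, sub_self, norm_zero] at hTq
      linarith
    · exact h0
  have hbefore : ∀ t' ∈ Set.Ioo 0 T, ∀ r', ‖W t' r' - W₀ r'‖ ≤ R := by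
    intro t' ht' r'
    by_contra hlt
    have : T ≤ t' := hTmin (Set.mem_iUnion.2
      ⟨r', ⟨ht'.1.le, ht'.2.le.trans hTt⟩, (not_le.1 hlt).le⟩)
    linarith [ht'.2]
  have := h.norm_sub_le hW hZ hR.le hτ hB hlam hH hk hTpos hbefore q
  linarith

/-- From a good initialization each output converges to its targets at rate `lam`: whenever
`e^{lam t} ‖u_s‖²` exceeds its initial value, which is at least `ε²`, the residual `u_s` is large
enough compared with the total residual for the coupling to be dominated by the decay. -/
theorem GoodInit.sum_sq_residual_le (h : GoodInit Z M H R B ε τ W₀ A)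
    (hW : IsGradientFlow Z M A W₀ W) (hZ : ∀ i, ‖Z i‖ = 1) (hτ : 0 ≤ τ) (hB : 0 ≤ B)
    (hlam : 0 < lam)
    (hH : ∀ v : Fin n → ℝ, lam * ∑ i, v i ^ 2 ≤ ∑ i, ∑ j, v i * H i j * v j)
    (hk : 2 * (τ + 4 * n * R) * √(k : ℝ) ≤ lam)
    (hBε : 2 * (τ + 4 * n * R) * B ≤ lam * ε)
    (hmove : 2 * √(n * k / m : ℝ) * B / lam < R) {T : ℝ} (hT0 : 0 ≤ T) (s : Fin k) :
    ∑ i, residual Z M A (W T) s i ^ 2 ≤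
      Real.exp (-lam * T) * ∑ i, residual Z M A (W 0) s i ^ 2 := by
  rcases hT0.eq_or_lt with h0 | hT
  · simp [← h0]
  have hR : 0 ≤ R := le_trans (by positivity) hmove.le
  have hWR : ∀ t ∈ Set.Ioo 0 T, ∀ r, ‖W t r - W₀ r‖ ≤ R := fun t ht r =>
    (h.norm_sub_lt hW hZ hτ hB hlam hH hk hmove ht.1.le r).le
  have hac : AbsolutelyContinuousOnInterval
      (fun t => Real.exp (lam * t) * ∑ i, residual Z M A (W t) s i ^ 2) 0 T :=
    (absolutelyContinuousOnInterval_exp_mul lam 0 T).fun_mul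
      (hW.absolutelyContinuous_sum_sq s hT)
  have key := le_of_ae_hasDerivAt_nonpos_of_lt hT0 hac ?_
  · rw [mul_zero, Real.exp_zero, one_mul] at key
    rw [neg_mul, Real.exp_neg, ← div_eq_inv_mul, le_div_iff₀ (Real.exp_pos _), mul_comm]
    exact key
  filter_upwards [h.ae_hasDerivAt_sum_sq hW hZ hR hτ hH hT hWR] with t ht hmem
  obtain ⟨q', hd, hq'⟩ := ht hmem s
  refine ⟨_, hasDerivAt_exp_mul lam hd, fun hlt => ?_⟩
  refine mul_nonpos_of_nonneg_of_nonpos (Real.exp_pos _).le ?_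
  rw [mul_zero, Real.exp_zero, one_mul, hW.init] at hlt
  have hQ := h.exp_mul_total_le hW hZ hR hτ hH hk hmem.1
    fun t' ht' => hWR t' ⟨ht'.1, ht'.2.trans hmem.2⟩
  set q : ℝ := ∑ i, residual Z M A (W t) s i ^ 2 with hq
  set Q : ℝ := ∑ s, ∑ i, residual Z M A (W t) s i ^ 2
  have hq0 : 0 ≤ q := Finset.sum_nonneg fun i _ => sq_nonneg _
  have hκ : 0 ≤ τ + 4 * n * R := by positivity
  have he : 0 ≤ √(Real.exp (lam * t)) := Real.sqrt_nonneg _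
  have h1 : √(Real.exp (lam * t)) * √Q ≤ B := by
    rw [← Real.sqrt_mul (Real.exp_pos _).le]
    exact Real.sqrt_le_iff.2 ⟨hB, hQ⟩
  have h2 : ε ≤ √(Real.exp (lam * t)) * √q := by
    rw [← Real.sqrt_mul (Real.exp_pos _).le]
    exact Real.le_sqrt_of_sq_le ((h.lower s).trans hlt.le)
  have h3 : 2 * (τ + 4 * n * R) * √Q ≤ lam * √q := by
    have hpos : 0 < √(Real.exp (lam * t)) := Real.sqrt_pos.2 (Real.exp_pos _)
    refine le_of_mul_le_mul_left ?_ hpos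
    calc √(Real.exp (lam * t)) * (2 * (τ + 4 * n * R) * √Q)
        = 2 * (τ + 4 * n * R) * (√(Real.exp (lam * t)) * √Q) := by ring
      _ ≤ 2 * (τ + 4 * n * R) * B := by gcongr
      _ ≤ lam * ε := hBε
      _ ≤ lam * (√(Real.exp (lam * t)) * √q) := by gcongr
      _ = _ := by ring
  have h4 : 2 * ((τ + 4 * n * R) * (√q * √Q)) ≤ lam * q := by
    calc _ = √q * (2 * (τ + 4 * n * R) * √Q) := by ring
      _ ≤ √q * (lam * √q) := mul_le_mul_of_nonneg_left h3 (Real.sqrt_nonneg _)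
      _ = lam * (√q * √q) := by ring
      _ = lam * q := by rw [Real.mul_self_sqrt hq0]
  linarith

end Convergence

/-! ### The limiting Gram matrix -/

section Gram

variable {d n : ℕ} {Z : Fin n → EuclideanSpace ℝ (Fin d)}

theorem isOpenPosMeasure_stdGaussian :
    (stdGaussian (EuclideanSpace ℝ (Fin d))).IsOpenPosMeasure := by
  have h1 : (gaussianReal 0 1).IsOpenPosMeasure :=
    (gaussianReal_absolutelyContinuous' 0 one_ne_zero).isOpenPosMeasure
  rw [← map_pi_eq_stdGaussian]
  exact (PiLp.continuous_toLp 2 _).isOpenPosMeasure_map (WithLp.toLp_surjective 2)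

/-- The indicator of the active half-space of `z`. -/
noncomputable def active (z w : EuclideanSpace ℝ (Fin d)) : ℝ :=
  if 0 ≤ (inner ℝ w z : ℝ) then 1 else 0

theorem measurable_active (z : EuclideanSpace ℝ (Fin d)) : Measurable (active z) :=
  Measurable.ite (measurableSet_le measurable_const (by fun_prop)) measurable_const
    measurable_const

theorem active_mem_Icc (z w : EuclideanSpace ℝ (Fin d)) : active z w ∈ Set.Icc (0 : ℝ) 1 := by
  unfold active; split_ifs <;> norm_num

theorem abs_active_le (z w : EuclideanSpace ℝ (Fin d)) : |active z w| ≤ 1 := by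
  obtain ⟨h0, h1⟩ := active_mem_Icc z w
  rwa [abs_of_nonneg h0]

theorem integrable_active_mul_active {μ : Measure (EuclideanSpace ℝ (Fin d))} [IsFiniteMeasure μ]
    (z z' : EuclideanSpace ℝ (Fin d)) (c : ℝ) :
    Integrable (fun w => active z w * active z' w * c) μ := by
  refine (Integrable.of_bound
    ((measurable_active z).mul (measurable_active z')).aestronglyMeasurable 1
    (Filter.Eventually.of_forall fun w => ?_)).mul_const c
  rw [Pi.mul_apply, Real.norm_eq_abs, abs_mul]
  exact mul_le_one₀ (abs_active_le z w) (abs_nonneg _) (abs_active_le z' w)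

theorem ntkGram_apply (i j : Fin n) :
    ntkGram Z i j = ∫ w, active (Z i) w * active (Z j) w * inner ℝ (Z i) (Z j)
      ∂(stdGaussian (EuclideanSpace ℝ (Fin d))) := by
  rw [ntkGram, Matrix.of_apply]
  refine integral_congr_ae (Filter.Eventually.of_forall fun w => ?_)
  by_cases h1 : 0 ≤ (inner ℝ w (Z i) : ℝ) <;> by_cases h2 : 0 ≤ (inner ℝ w (Z j) : ℝ) <;>
    simp [active, Set.indicator, h1, h2]

theorem isHermitian_ntkGram : (ntkGram Z).IsHermitian := by
  ext i j
  simp only [Matrix.conjTranspose_apply, star_trivial, ntkGram_apply]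
  refine integral_congr_ae (Filter.Eventually.of_forall fun w => ?_)
  simp only [real_inner_comm]
  ring

/-- The quadratic form of `H^∞` is the mean square of the feature vector
`∑_i v_i 1{wᵀ Z_i ≥ 0} Z_i`. -/
theorem sum_ntkGram_eq (v : Fin n → ℝ) :
    ∑ i, ∑ j, v i * ntkGram Z i j * v j =
      ∫ w, ‖∑ i, (v i * active (Z i) w) • Z i‖ ^ 2
        ∂(stdGaussian (EuclideanSpace ℝ (Fin d))) := by
  have h1 : ∀ w, ‖∑ i, (v i * active (Z i) w) • Z i‖ ^ 2 =
      ∑ i, ∑ j, active (Z i) w * active (Z j) w * (v i * v j * inner ℝ (Z i) (Z j)) := fun w => by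
    rw [← real_inner_self_eq_norm_sq, sum_inner]
    refine Finset.sum_congr rfl fun i _ => ?_
    rw [inner_sum]
    refine Finset.sum_congr rfl fun j _ => ?_
    rw [inner_smul_left, inner_smul_right]
    simp
    ring
  simp only [h1]
  rw [integral_finsetSum _ fun i _ => integrable_finsetSum _ fun j _ =>
    integrable_active_mul_active _ _ _]
  refine Finset.sum_congr rfl fun i _ => ?_
  rw [integral_finsetSum _ fun j _ => integrable_active_mul_active _ _ _]
  refine Finset.sum_congr rfl fun j _ => ?_
  rw [ntkGram_apply, ← integral_const_mul, ← integral_mul_const]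
  refine integral_congr_ae (Filter.Eventually.of_forall fun w => ?_)
  simp only
  ring

theorem integrable_norm_sq_feature (v : Fin n → ℝ) :
    Integrable (fun w => ‖∑ i, (v i * active (Z i) w) • Z i‖ ^ 2)
      (stdGaussian (EuclideanSpace ℝ (Fin d))) := by
  have hmeas : Measurable fun w => ‖∑ i, (v i * active (Z i) w) • Z i‖ ^ 2 :=
    (Finset.measurable_sum _ fun i _ =>
      ((measurable_active (Z i)).const_mul (v i)).smul_const (Z i)).norm.pow_const 2
  refine Integrable.of_bound hmeas.aestronglyMeasurable ((∑ i, |v i| * ‖Z i‖) ^ 2)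
    (Filter.Eventually.of_forall fun w => ?_)
  rw [Real.norm_eq_abs, abs_of_nonneg (sq_nonneg _)]
  refine pow_le_pow_left₀ (norm_nonneg _) ((norm_sum_le _ _).trans
    (Finset.sum_le_sum fun i _ => ?_)) 2
  rw [norm_smul, Real.norm_eq_abs, abs_mul]
  refine mul_le_mul_of_nonneg_right ?_ (norm_nonneg _)
  exact mul_le_of_le_one_right (abs_nonneg _) (abs_active_le _ _)

/-- On each hyperplane `Z_iᗮ` some point avoids all the other hyperplanes `Z_jᗮ`. -/
theorem exists_inner_eq_zero_forall_ne (hZ : ∀ i, ‖Z i‖ = 1)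
    (hlin : ∀ i j, i ≠ j → LinearIndependent ℝ ![Z i, Z j]) (i : Fin n) :
    ∃ w : EuclideanSpace ℝ (Fin d), (inner ℝ w (Z i) : ℝ) = 0 ∧
      ∀ j, j ≠ i → (inner ℝ w (Z j) : ℝ) ≠ 0 := by
  have hex : ∀ j : {j : Fin n // j ≠ i}, ∃ x ∈ LinearMap.ker (innerₛₗ ℝ (Z i)),
      (innerₛₗ ℝ (Z j)) x ≠ 0 := by
    rintro ⟨j, hj⟩
    set c : ℝ := inner ℝ (Z i) (Z j) with hc
    refine ⟨Z j - c • Z i, ?_, ?_⟩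
    · simp [inner_sub_right, inner_smul_right, hZ, hc]
    · have hp : Z j - c • Z i ≠ 0 := by
        intro h0
        have := (LinearIndependent.pair_iff.1 (hlin i j hj.symm)) (-c) 1 (by
          rw [← h0]; simp [sub_eq_neg_add])
        exact one_ne_zero this.2
      have h1 : (inner ℝ (Z j - c • Z i) (Z j - c • Z i) : ℝ) =
          inner ℝ (Z j) (Z j - c • Z i) := by
        rw [inner_sub_left, inner_smul_left]
        simp [inner_sub_right, inner_smul_right, hZ, ← hc]
      simp only [innerₛₗ_apply_apply]
      rw [← h1]
      exact fun h => hp (inner_self_eq_zero.1 h)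
  obtain ⟨w, hw, hne⟩ := Module.Dual.exists_forall_mem_ne_zero_of_forall_exists
    (LinearMap.ker (innerₛₗ ℝ (Z i)))
    (fun j : {j : Fin n // j ≠ i} => innerₛₗ ℝ (Z j)) hex
  refine ⟨w, ?_, fun j hj => ?_⟩
  · rw [real_inner_comm]
    simpa using hw
  · rw [real_inner_comm]
    simpa using hne ⟨j, hj⟩

/-- The feature vector `∑_i v_i 1{wᵀ Z_i ≥ 0} Z_i` jumps by `v_i Z_i` across `Z_iᗮ`, hence it
vanishes almost everywhere only for `v = 0`. -/
theorem eq_zero_of_ae_feature_eq_zero (hZ : ∀ i, ‖Z i‖ = 1)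
    (hlin : ∀ i j, i ≠ j → LinearIndependent ℝ ![Z i, Z j]) {v : Fin n → ℝ}
    (h : ∀ᵐ w ∂(stdGaussian (EuclideanSpace ℝ (Fin d))),
      ∑ i, (v i * active (Z i) w) • Z i = 0) : v = 0 := by
  have hopen := isOpenPosMeasure_stdGaussian (d := d)
  funext i
  obtain ⟨w₀, hw₀, hne⟩ := exists_inner_eq_zero_forall_ne hZ hlin i
  have hii : (inner ℝ (Z i) (Z i) : ℝ) = 1 := by rw [real_inner_self_eq_norm_sq, hZ]; norm_num
  -- For both signs `σ`, the feature vector vanishes somewhere near `w₀` on that side of `Z_iᗮ`.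
  have hside : ∀ σ : ℝ, σ ≠ 0 → ∃ w : EuclideanSpace ℝ (Fin d), 0 < σ * inner ℝ w (Z i) ∧
      (∀ j, j ≠ i → active (Z j) w = active (Z j) w₀) ∧
      ∑ i, (v i * active (Z i) w) • Z i = 0 := by
    intro σ hσ
    set V : Set (EuclideanSpace ℝ (Fin d)) := {w | ∀ j, j ≠ i →
      0 < (inner ℝ w₀ (Z j) : ℝ) * inner ℝ w (Z j)} with hV
    have hVo : IsOpen V := by
      simp only [hV, Set.ofPred_forall]
      refine isOpen_iInter_of_finite fun j => isOpen_iInter_of_finite fun _ => ?_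
      exact isOpen_lt continuous_const (by fun_prop)
    have hV0 : w₀ ∈ V := fun j hj => mul_self_pos.2 (hne j hj)
    set U : Set (EuclideanSpace ℝ (Fin d)) := V ∩ {w | 0 < σ * (inner ℝ w (Z i) : ℝ)} with hU
    have hUo : IsOpen U := hVo.inter (isOpen_lt continuous_const (by fun_prop))
    have hUne : U.Nonempty := by
      have hcont : Filter.Tendsto (fun t : ℝ => w₀ + (t * σ) • Z i) (nhdsWithin 0 (Set.Ioi 0))
          (nhds w₀) := by
        have : Continuous fun t : ℝ => w₀ + (t * σ) • Z i := by fun_prop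
        have h0 := this.tendsto 0
        simp only [zero_mul, zero_smul, add_zero] at h0
        exact h0.mono_left nhdsWithin_le_nhds
      obtain ⟨t, ht, htpos⟩ := ((hcont.eventually (hVo.mem_nhds hV0)).and
        self_mem_nhdsWithin).exists
      refine ⟨_, ht, ?_⟩
      change 0 < σ * (inner ℝ (w₀ + (t * σ) • Z i) (Z i) : ℝ)
      rw [inner_add_left, hw₀, inner_smul_left, hii]
      simp only [zero_add, mul_one, conj_trivial]
      have : 0 < σ * σ := mul_self_pos.2 hσ
      have htpos : 0 < t := htpos
      nlinarith
    have hpos : stdGaussian (EuclideanSpace ℝ (Fin d)) U ≠ 0 := hUo.measure_ne_zero _ hUne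
    obtain ⟨w, hw, hwU⟩ := (Filter.Eventually.and_frequently h
      (frequently_ae_mem_iff.2 hpos)).exists
    refine ⟨w, hwU.2, fun j hj => ?_, hw⟩
    have := hwU.1 j hj
    unfold active
    congr 1
    rw [eq_iff_iff]
    constructor
    · intro h0
      by_contra hneg
      nlinarith [not_le.1 hneg]
    · intro h0
      by_contra hneg
      nlinarith [not_le.1 hneg]
  obtain ⟨w₁, h1, h1', e1⟩ := hside 1 one_ne_zero
  obtain ⟨w₂, h2, h2', e2⟩ := hside (-1) (by norm_num)
  have a1 : active (Z i) w₁ = 1 := if_pos (by linarith)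
  have a2 : active (Z i) w₂ = 0 := if_neg (by linarith)
  have hdiff : ∑ j, (v j * active (Z j) w₁) • Z j - ∑ j, (v j * active (Z j) w₂) • Z j =
      v i • Z i := by
    rw [← Finset.sum_sub_distrib, Finset.sum_eq_single i]
    · simp [a1, a2]
    · intro j _ hj
      rw [h1' j hj, h2' j hj, sub_self]
    · simp
  rw [e1, e2, sub_self] at hdiff
  have hZi : Z i ≠ 0 := fun h0 => by
    have := hZ i
    rw [h0, norm_zero] at this
    exact zero_ne_one this
  exact (smul_eq_zero.1 hdiff.symm).resolve_right hZi

theorem dotProduct_mulVec_ntkGram (v : Fin n → ℝ) :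
    star v ⬝ᵥ (ntkGram Z).mulVec v = ∑ i, ∑ j, v i * ntkGram Z i j * v j := by
  simp [dotProduct, Matrix.mulVec, Finset.mul_sum, mul_assoc]

theorem posDef_ntkGram (hZ : ∀ i, ‖Z i‖ = 1)
    (hlin : ∀ i j, i ≠ j → LinearIndependent ℝ ![Z i, Z j]) : (ntkGram Z).PosDef := by
  refine Matrix.PosDef.of_dotProduct_mulVec_pos isHermitian_ntkGram fun v hv => ?_
  rw [dotProduct_mulVec_ntkGram, sum_ntkGram_eq]
  have hnn : ∀ w, 0 ≤ ‖∑ i, (v i * active (Z i) w) • Z i‖ ^ 2 := fun w => sq_nonneg _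
  refine (integral_nonneg hnn).lt_of_ne fun h0 => hv ?_
  refine eq_zero_of_ae_feature_eq_zero hZ hlin ?_
  have := (integral_eq_zero_iff_of_nonneg hnn (integrable_norm_sq_feature v)).1 h0.symm
  filter_upwards [this] with w hw
  simpa using hw

theorem leastEigenvalue_pos (hn : 0 < n) (hZ : ∀ i, ‖Z i‖ = 1)
    (hlin : ∀ i j, i ≠ j → LinearIndependent ℝ ![Z i, Z j]) : 0 < leastEigenvalue Z := by
  have hH := isHermitian_ntkGram (Z := Z)
  have hmem : leastEigenvalue Z ∈ spectrum ℝ (ntkGram Z) := by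
    rw [leastEigenvalue, hH.spectrum_real_eq_range_eigenvalues]
    exact Set.Nonempty.csInf_mem ⟨_, Set.mem_range_self ⟨0, hn⟩⟩ (Set.finite_range _)
  rw [hH.spectrum_real_eq_range_eigenvalues] at hmem
  obtain ⟨i, hi⟩ := hmem
  rw [← hi]
  exact (posDef_ntkGram hZ hlin).eigenvalues_pos i

theorem leastEigenvalue_mul_sum_sq_le (v : Fin n → ℝ) :
    leastEigenvalue Z * ∑ i, v i ^ 2 ≤ ∑ i, ∑ j, v i * ntkGram Z i j * v j := by
  have hH := isHermitian_ntkGram (Z := Z)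
  have hpsd : (ntkGram Z - algebraMap ℝ _ (leastEigenvalue Z)).PosSemidef := by
    rw [Matrix.posSemidef_iff_isHermitian_and_spectrum_nonneg]
    refine ⟨hH.sub ?_, ?_⟩
    · rw [Matrix.algebraMap_eq_diagonal]
      exact Matrix.isHermitian_diagonal _
    · rw [← spectrum.sub_singleton_eq]
      rintro x ⟨a, ha, b, rfl, rfl⟩
      have : leastEigenvalue Z ≤ a := by
        refine csInf_le ?_ ha
        rw [hH.spectrum_real_eq_range_eigenvalues]
        exact (Set.finite_range _).bddBelow
      simpa using this
  have h1 := hpsd.dotProduct_mulVec_nonneg v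
  rw [Matrix.sub_mulVec, dotProduct_sub, dotProduct_mulVec_ntkGram, Matrix.algebraMap_eq_diagonal,
    sub_nonneg] at h1
  refine le_trans (le_of_eq ?_) h1
  simp only [dotProduct, Matrix.mulVec_diagonal, Finset.mul_sum, Pi.algebraMap_apply]
  refine Finset.sum_congr rfl fun i _ => ?_
  simp
  ring

theorem abs_ntkGram_le (hZ : ∀ i, ‖Z i‖ = 1) (i j : Fin n) : |ntkGram Z i j| ≤ 1 := by
  rw [ntkGram_apply, ← Real.norm_eq_abs]
  refine (norm_integral_le_of_norm_le_const (C := 1)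
    (Filter.Eventually.of_forall fun w => ?_)).trans (by simp)
  rw [Real.norm_eq_abs, abs_mul, abs_mul]
  refine mul_le_one₀ (mul_le_one₀ (abs_active_le _ _) (abs_nonneg _) (abs_active_le _ _))
    (abs_nonneg _) ?_
  simpa [hZ] using abs_real_inner_le_norm (Z i) (Z j)

theorem leastEigenvalue_le_one (hn : 0 < n) (hZ : ∀ i, ‖Z i‖ = 1) : leastEigenvalue Z ≤ 1 := by
  have h1 := leastEigenvalue_mul_sum_sq_le (Z := Z) (Pi.single ⟨0, hn⟩ 1)
  have h2 := (abs_le.1 (abs_ntkGram_le hZ ⟨0, hn⟩ ⟨0, hn⟩)).2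
  simp [Pi.single_apply] at h1
  exact h1.trans h2

end Gram

/-! ### The law of the initialization -/

instance isProbabilityMeasure_signLaw : IsProbabilityMeasure signLaw := by
  constructor
  simp only [signLaw, Measure.smul_apply, Measure.add_apply, measure_univ, smul_eq_mul]
  rw [one_add_one_eq_two]
  exact ENNReal.inv_mul_cancel two_ne_zero ENNReal.ofNat_ne_top

theorem integral_signLaw (f : ℝ → ℝ) : ∫ x, f x ∂signLaw = (f (-1) + f 1) / 2 := by
  have hi : ∀ a : ℝ, Integrable f (Measure.dirac a) := fun a => integrable_dirac (by simp)
  rw [signLaw, integral_smul_measure, integral_add_measure (hi _) (hi _), integral_dirac,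
    integral_dirac]
  simp
  ring

theorem ae_abs_eq_one_signLaw : ∀ᵐ x ∂signLaw, |x| = 1 := by
  rw [signLaw]
  refine Measure.ae_smul_measure ?_ _
  rw [ae_add_measure_iff, ae_dirac_eq, ae_dirac_eq]
  simp

/-- The joint law of the weights `(w_r, A_r)` of a single neuron. -/
noncomputable def neuronLaw (d k : ℕ) : Measure (EuclideanSpace ℝ (Fin d) × (Fin k → ℝ)) :=
  (stdGaussian (EuclideanSpace ℝ (Fin d))).prod (Measure.pi fun _ => signLaw)

section Law

variable {d m k : ℕ}

instance isProbabilityMeasure_neuronLaw : IsProbabilityMeasure (neuronLaw d k) := by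
  unfold neuronLaw; infer_instance

instance isProbabilityMeasure_initLaw : IsProbabilityMeasure (initLaw d m k) := by
  unfold initLaw; infer_instance

/-- The neurons are independent with law `neuronLaw`. -/
theorem measurePreserving_neurons :
    MeasurePreserving
      (fun (p : (Fin m → EuclideanSpace ℝ (Fin d)) × (Fin m → Fin k → ℝ)) r => (p.1 r, p.2 r))
      (initLaw d m k) (Measure.pi fun _ => neuronLaw d k) :=
  (measurePreserving_arrowProdEquivProdArrow (EuclideanSpace ℝ (Fin d)) (Fin k → ℝ) (Fin m)
    (fun _ => stdGaussian (EuclideanSpace ℝ (Fin d)))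
    (fun _ => Measure.pi fun _ => signLaw)).symm

theorem measurePreserving_neuron (r : Fin m) :
    MeasurePreserving
      (fun (p : (Fin m → EuclideanSpace ℝ (Fin d)) × (Fin m → Fin k → ℝ)) => (p.1 r, p.2 r))
      (initLaw d m k) (neuronLaw d k) :=
  (measurePreserving_eval (fun _ : Fin m => neuronLaw d k) r).comp measurePreserving_neurons

theorem iIndepFun_neurons :
    iIndepFun
      (fun r (p : (Fin m → EuclideanSpace ℝ (Fin d)) × (Fin m → Fin k → ℝ)) => (p.1 r, p.2 r))
      (initLaw d m k) := by
  rw [iIndepFun_iff_map_fun_eq_pi_map fun r => (measurePreserving_neuron r).measurable.aemeasurable]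
  simp only [(measurePreserving_neuron _).map_eq]
  exact measurePreserving_neurons.map_eq

theorem ae_abs_eq_one_pi_signLaw :
    ∀ᵐ a ∂(Measure.pi fun _ : Fin k => signLaw), ∀ s, |a s| = 1 :=
  ae_all_iff.2 fun s =>
    (measurePreserving_eval (fun _ : Fin k => signLaw) s).quasiMeasurePreserving.ae
      ae_abs_eq_one_signLaw

theorem ae_abs_eq_one_neuronLaw : ∀ᵐ p ∂(neuronLaw d k), ∀ s, |p.2 s| = 1 :=
  measurePreserving_snd.quasiMeasurePreserving.ae ae_abs_eq_one_pi_signLaw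

theorem ae_abs_eq_one_initLaw : ∀ᵐ p ∂(initLaw d m k), ∀ r s, |p.2 r s| = 1 :=
  ae_all_iff.2 fun r =>
    (measurePreserving_neuron r).quasiMeasurePreserving.ae ae_abs_eq_one_neuronLaw

theorem hasSubgaussianMGF_sum_neurons {f : EuclideanSpace ℝ (Fin d) × (Fin k → ℝ) → ℝ}
    (hf : Measurable f) (h : HasSubgaussianMGF f 1 (neuronLaw d k)) :
    HasSubgaussianMGF (fun p => ∑ r, f (p.1 r, p.2 r)) m (initLaw d m k) := by
  have h1 := HasSubgaussianMGF.sum_of_iIndepFun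
    (iIndepFun_neurons.comp (fun _ => f) fun _ => hf) (c := fun _ => 1) (s := Finset.univ)
    (fun r _ => HasSubgaussianMGF.of_map (measurePreserving_neuron (m := m) r).aemeasurable
      (by rwa [(measurePreserving_neuron r).map_eq]))
  simpa using h1

/-- Chebyshev's computation for a sum of identically distributed functions of the neurons. -/
theorem integral_sum_neurons_sub_sq_le {f : EuclideanSpace ℝ (Fin d) × (Fin k → ℝ) → ℝ}
    (hf : Measurable f) (h2 : MemLp f 2 (neuronLaw d k)) {c : ℝ}
    (hc : ∫ p, f p ^ 2 ∂(neuronLaw d k) ≤ c) :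
    MemLp (fun p => ∑ r, f (p.1 r, p.2 r)) 2 (initLaw d m k) ∧
    ∫ p, (∑ r, f (p.1 r, p.2 r) - m * ∫ q, f q ∂(neuronLaw d k)) ^ 2 ∂(initLaw d m k) ≤
      m * c := by
  have hmem : ∀ r : Fin m, MemLp (fun p : (Fin m → EuclideanSpace ℝ (Fin d)) ×
      (Fin m → Fin k → ℝ) => f (p.1 r, p.2 r)) 2 (initLaw d m k) := fun r =>
    h2.comp_measurePreserving (measurePreserving_neuron r)
  have hsum : MemLp (fun p : (Fin m → EuclideanSpace ℝ (Fin d)) × (Fin m → Fin k → ℝ) =>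
      ∑ r, f (p.1 r, p.2 r)) 2 (initLaw d m k) := memLp_finsetSum _ fun r _ => hmem r
  refine ⟨hsum, ?_⟩
  have hmean : ∫ p, ∑ r, f (p.1 r, p.2 r) ∂(initLaw d m k) = m * ∫ q, f q ∂(neuronLaw d k) := by
    rw [integral_finsetSum _ fun r _ => (hmem r).integrable one_le_two]
    have : ∀ r : Fin m, ∫ p, f (p.1 r, p.2 r) ∂(initLaw d m k) = ∫ q, f q ∂(neuronLaw d k) :=
      fun r => by
        rw [← (measurePreserving_neuron (m := m) r).map_eq,
          integral_map (measurePreserving_neuron r).aemeasurable hf.aestronglyMeasurable]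
    simp [this]
  rw [← hmean, ← variance_eq_integral hsum.aemeasurable]
  have hvar := IndepFun.variance_sum (μ := initLaw d m k) (s := Finset.univ)
    (X := fun (r : Fin m) p => f (p.1 r, p.2 r)) (fun r _ => hmem r)
    (fun r _ q _ hrq => (iIndepFun_neurons.comp (fun _ => f) fun _ => hf).indepFun hrq)
  have hfun : (∑ r : Fin m, fun p : (Fin m → EuclideanSpace ℝ (Fin d)) × (Fin m → Fin k → ℝ) =>
      f (p.1 r, p.2 r)) = fun p => ∑ r, f (p.1 r, p.2 r) := by
    ext p; simp
  rw [hfun] at hvar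
  rw [hvar]
  have hone : ∀ r : Fin m, variance (fun p : (Fin m → EuclideanSpace ℝ (Fin d)) ×
      (Fin m → Fin k → ℝ) => f (p.1 r, p.2 r)) (initLaw d m k) ≤ c := fun r => by
    refine (variance_le_expectation_sq (hmem r).aestronglyMeasurable).trans ?_
    refine le_trans (le_of_eq ?_) hc
    rw [← (measurePreserving_neuron (m := m) r).map_eq,
      integral_map (measurePreserving_neuron r).aemeasurable
        (hf.pow_const 2).aestronglyMeasurable]
    rfl
  refine (Finset.sum_le_sum fun r _ => hone r).trans ?_
  simp

theorem integral_pow_four_le {Ω : Type*} [MeasurableSpace Ω] {μ : Measure Ω} {X : Ω → ℝ}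
    {c : NNReal} (h : HasSubgaussianMGF X c μ) : ∫ ω, X ω ^ 4 ∂μ ≤ 33 * (c : ℝ) ^ 2 := by
  rcases eq_or_ne c 0 with rfl | hc
  · have h0 := h.ae_eq_zero_of_hasSubgaussianMGF_zero
    have : ∫ ω, X ω ^ 4 ∂μ = 0 := by
      refine integral_eq_zero_of_ae ?_
      filter_upwards [h0] with ω hω
      simp [hω]
    simp [this]
  have hcpos : (0 : ℝ) < c := by positivity
  -- The exponent `t² = 2 / c` balances the two sides of the moment bound.
  set t : ℝ := √(2 / c) with ht
  have ht2 : t ^ 2 = 2 / c := Real.sq_sqrt (by positivity)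
  have hpt : ∀ ω, X ω ^ 4 ≤ 6 * (c : ℝ) ^ 2 * (Real.exp (t * X ω) + Real.exp (-t * X ω)) := by
    intro ω
    have h1 := Real.pow_div_factorial_le_exp _ (abs_nonneg (t * X ω)) 4
    have h2 : Real.exp |t * X ω| ≤ Real.exp (t * X ω) + Real.exp (-t * X ω) := by
      rcases abs_cases (t * X ω) with ⟨h, -⟩ | ⟨h, -⟩
      · rw [h]; linarith [Real.exp_pos (-t * X ω)]
      · rw [h, neg_mul]; linarith [Real.exp_pos (t * X ω)]
    have h3 : |t * X ω| ^ 4 = (2 / c) ^ 2 * X ω ^ 4 := by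
      rw [Even.pow_abs (by decide : Even 4), mul_pow, ← ht2]; ring
    rw [h3] at h1
    have h4 : X ω ^ 4 = 6 * (c : ℝ) ^ 2 * ((2 / c) ^ 2 * X ω ^ 4 / (Nat.factorial 4 : ℝ)) := by
      have : (Nat.factorial 4 : ℝ) = 24 := by norm_num [Nat.factorial]
      rw [this]
      field_simp
      ring
    rw [h4]
    exact mul_le_mul_of_nonneg_left (h1.trans h2) (by positivity)
  have hint : Integrable
      (fun ω => 6 * (c : ℝ) ^ 2 * (Real.exp (t * X ω) + Real.exp (-t * X ω))) μ :=
    ((h.integrable_exp_mul t).add (h.integrable_exp_mul (-t))).const_mul _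
  calc ∫ ω, X ω ^ 4 ∂μ ≤ ∫ ω, 6 * (c : ℝ) ^ 2 * (Real.exp (t * X ω) + Real.exp (-t * X ω)) ∂μ := by
        refine integral_mono_of_nonneg (Filter.Eventually.of_forall fun ω => ?_) hint
          (Filter.Eventually.of_forall hpt)
        exact (by decide : Even 4).pow_nonneg _
    _ = 6 * (c : ℝ) ^ 2 * (mgf X μ t + mgf X μ (-t)) := by
        rw [integral_const_mul, integral_add (h.integrable_exp_mul t) (h.integrable_exp_mul (-t))]
        rfl
    _ ≤ 6 * (c : ℝ) ^ 2 * (Real.exp (c * t ^ 2 / 2) + Real.exp (c * (-t) ^ 2 / 2)) := by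
        gcongr
        · exact h.mgf_le t
        · exact h.mgf_le (-t)
    _ = 12 * Real.exp 1 * (c : ℝ) ^ 2 := by
        rw [neg_sq, ht2]
        have : (c : ℝ) * (2 / c) / 2 = 1 := by field_simp
        rw [this]
        ring
    _ ≤ 33 * (c : ℝ) ^ 2 := by
        have := Real.exp_one_lt_d9
        gcongr
        linarith

end Law

/-! ### Moments of a single neuron -/

section Neuron

variable {d m k n : ℕ}

theorem measurePreserving_inner {z : EuclideanSpace ℝ (Fin d)} (hz : ‖z‖ = 1) :
    MeasurePreserving (fun w : EuclideanSpace ℝ (Fin d) => (inner ℝ w z : ℝ))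
      (stdGaussian (EuclideanSpace ℝ (Fin d))) (gaussianReal 0 1) := by
  refine ⟨by fun_prop, ?_⟩
  have h := IsGaussian.map_eq_gaussianReal (μ := stdGaussian (EuclideanSpace ℝ (Fin d)))
    (innerSL ℝ z)
  rw [integral_strongDual_stdGaussian, variance_dual_stdGaussian, innerSL_apply_norm, hz] at h
  simp only [one_pow, Real.toNNReal_one] at h
  rw [← h]
  congr 1
  ext w
  simp [real_inner_comm]

theorem integral_neuronLaw_mul (f : EuclideanSpace ℝ (Fin d) → ℝ) (g : (Fin k → ℝ) → ℝ) :
    ∫ p, f p.1 * g p.2 ∂(neuronLaw d k) =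
      (∫ w, f w ∂(stdGaussian (EuclideanSpace ℝ (Fin d)))) *
        ∫ a, g a ∂(Measure.pi fun _ : Fin k => signLaw) :=
  integral_prod_mul f g

theorem integral_pi_signLaw_mul (s h : Fin k) :
    ∫ a, a s * a h ∂(Measure.pi fun _ : Fin k => signLaw) = if s = h then 1 else 0 := by
  have heval : ∀ s, ∫ a, a s ∂(Measure.pi fun _ : Fin k => signLaw) = 0 := fun s => by
    rw [integral_eval, integral_signLaw]
    norm_num
  split_ifs with hsh
  · subst hsh
    have : ∀ᵐ a ∂(Measure.pi fun _ : Fin k => signLaw), a s * a s = 1 := by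
      filter_upwards [ae_abs_eq_one_pi_signLaw] with a ha
      rw [← abs_mul_abs_self, ha s, one_mul]
    rw [integral_congr_ae this]
    simp
  · have hind : iIndepFun (fun (s : Fin k) (a : Fin k → ℝ) => a s)
        (Measure.pi fun _ : Fin k => signLaw) :=
      iIndepFun_pi (X := fun _ => id) fun _ => aemeasurable_id
    have := (hind.indepFun hsh).integral_fun_mul_eq_mul_integral
      (measurable_pi_apply s).aestronglyMeasurable (measurable_pi_apply h).aestronglyMeasurable
    rw [this, heval, zero_mul]

theorem measurable_relu : Measurable relu := measurable_id.max measurable_const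

/-- A random sign makes the output of a neuron sub-Gaussian:
`𝔼 e^{t A σ(x)} = 𝔼 cosh(t σ(x)) ≤ 𝔼 cosh(t x)` for `x ∼ N(0, 1)`. -/
theorem hasSubgaussianMGF_sign_mul_relu {z : EuclideanSpace ℝ (Fin d)} (hz : ‖z‖ = 1) (s : Fin k) :
    HasSubgaussianMGF (fun p : EuclideanSpace ℝ (Fin d) × (Fin k → ℝ) =>
      p.2 s * relu (inner ℝ p.1 z)) 1 (neuronLaw d k) := by
  have hmp : MeasurePreserving (fun p : EuclideanSpace ℝ (Fin d) × (Fin k → ℝ) =>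
      ((inner ℝ p.1 z : ℝ), p.2 s)) (neuronLaw d k) ((gaussianReal 0 1).prod signLaw) :=
    (measurePreserving_inner hz).prod (measurePreserving_eval (fun _ : Fin k => signLaw) s)
  suffices H : HasSubgaussianMGF (fun q : ℝ × ℝ => q.2 * relu q.1) 1
      ((gaussianReal 0 1).prod signLaw) by
    have := HasSubgaussianMGF.of_map hmp.aemeasurable (by rwa [hmp.map_eq])
    exact this
  have hcosh : ∀ t x : ℝ, |x| = 1 → ∀ y : ℝ, Real.exp (t * (x * relu y)) ≤
      Real.exp (t * y) + Real.exp (-t * y) + 1 := by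
    intro t x hx y
    have h1 := Real.exp_pos (t * y)
    have h2 := Real.exp_pos (-t * y)
    rcases le_total y 0 with hy | hy
    · rw [relu, max_eq_right hy]
      simp only [mul_zero, Real.exp_zero]
      linarith
    · rw [relu, max_eq_left hy]
      rcases (abs_eq zero_le_one).1 hx with rfl | rfl
      · rw [one_mul]; linarith
      · have : t * (-1 * y) = -t * y := by ring
        rw [this]; linarith
  have hgi : ∀ t : ℝ, Integrable (fun x => Real.exp (t * x)) (gaussianReal 0 1) := fun t =>
    integrable_exp_mul_gaussianReal t
  have hint : ∀ t : ℝ, Integrable (fun q : ℝ × ℝ => Real.exp (t * (q.2 * relu q.1)))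
      ((gaussianReal 0 1).prod signLaw) := by
    intro t
    have hdom : Integrable (fun q : ℝ × ℝ => Real.exp (t * q.1) + Real.exp (-t * q.1) + 1)
        ((gaussianReal 0 1).prod signLaw) :=
      (((hgi t).add (hgi (-t))).add (integrable_const 1)).comp_fst signLaw
    refine hdom.mono' ?_ ?_
    · exact (Real.measurable_exp.comp ((measurable_snd.mul
        (measurable_relu.comp measurable_fst)).const_mul t)).aestronglyMeasurable
    · have : ∀ᵐ q ∂((gaussianReal 0 1).prod signLaw), |q.2| = 1 :=
        measurePreserving_snd.quasiMeasurePreserving.ae ae_abs_eq_one_signLaw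
      filter_upwards [this] with q hq
      rw [Real.norm_eq_abs, abs_of_pos (Real.exp_pos _)]
      exact hcosh t q.2 hq q.1
  refine ⟨hint, fun t => ?_⟩
  have hmgf : ∀ t : ℝ, ∫ x, Real.exp (t * x) ∂(gaussianReal 0 1) = Real.exp (t ^ 2 / 2) := by
    intro t
    have := congrFun (mgf_fun_id_gaussianReal (μ := 0) (v := 1)) t
    simpa [mgf] using this
  have hle : ∀ x : ℝ, (Real.exp (t * (-1 * relu x)) + Real.exp (t * (1 * relu x))) / 2 ≤
      (Real.exp (t * x) + Real.exp (-t * x)) / 2 := by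
    intro x
    have h1 : (Real.exp (t * (-1 * relu x)) + Real.exp (t * (1 * relu x))) / 2 =
        Real.cosh (t * relu x) := by
      rw [Real.cosh_eq, add_comm]; ring_nf
    have h2 : (Real.exp (t * x) + Real.exp (-t * x)) / 2 = Real.cosh (t * x) := by
      rw [Real.cosh_eq]; ring_nf
    rw [h1, h2, Real.cosh_le_cosh, abs_mul, abs_mul, abs_of_nonneg (relu_nonneg x)]
    refine mul_le_mul_of_nonneg_left ?_ (abs_nonneg t)
    exact max_le (le_abs_self x) (abs_nonneg x)
  calc mgf (fun q : ℝ × ℝ => q.2 * relu q.1) ((gaussianReal 0 1).prod signLaw) t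
      = ∫ x, ∫ y, Real.exp (t * (y * relu x)) ∂signLaw ∂(gaussianReal 0 1) :=
        integral_prod _ (hint t)
    _ = ∫ x, (Real.exp (t * (-1 * relu x)) + Real.exp (t * (1 * relu x))) / 2
          ∂(gaussianReal 0 1) := by simp only [integral_signLaw]
    _ ≤ ∫ x, (Real.exp (t * x) + Real.exp (-t * x)) / 2 ∂(gaussianReal 0 1) :=
        integral_mono_of_nonneg (Filter.Eventually.of_forall fun x => by positivity)
          (((hgi t).add (hgi (-t))).div_const 2) (Filter.Eventually.of_forall hle)
    _ = Real.exp ((1 : NNReal) * t ^ 2 / 2) := by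
        rw [integral_div, integral_add (hgi t) (hgi (-t)), hmgf, hmgf]
        simp

end Neuron

/-! ### Anti-concentration of the outputs -/

/-- Gaussian integration by parts along a ReLU unit. The boundary terms at the kink from the two
half-lines cancel, since `ψ (b + c * relu x)` is continuous there. -/
theorem integral_deriv_relu_gaussianReal {ψ ψ' : ℝ → ℝ} (hψ : ∀ x, HasDerivAt ψ (ψ' x) x)
    (hψ'm : Measurable ψ') {K L : ℝ} (hK : ∀ x, |ψ x| ≤ K) (hL : ∀ x, |ψ' x| ≤ L) (b c : ℝ) :
    ∫ x, ψ' (b + c * relu x) * (c * if 0 < x then 1 else 0) ∂(gaussianReal 0 1) =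
      ∫ x, x * ψ (b + c * relu x) ∂(gaussianReal 0 1) := by
  set φ : ℝ → ℝ := gaussianPDFReal 0 1 with hφ
  have hφe : ∀ x, φ x = (√(2 * Real.pi))⁻¹ * Real.exp (-(1 / 2) * x ^ 2) := by
    intro x
    simp only [hφ, gaussianPDFReal, NNReal.coe_one, mul_one, sub_zero]
    congr 2
    ring
  have hφd : ∀ x, HasDerivAt φ (-(x * φ x)) x := by
    intro x
    have h1 : HasDerivAt (fun x : ℝ => (√(2 * Real.pi))⁻¹ * Real.exp (-(1 / 2) * x ^ 2))
        ((√(2 * Real.pi))⁻¹ * (Real.exp (-(1 / 2) * x ^ 2) *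
          (-(1 / 2) * (((2 : ℕ) : ℝ) * x ^ (2 - 1))))) x :=
      (((hasDerivAt_pow 2 x).const_mul _).exp).const_mul _
    have h2 : φ = fun x : ℝ => (√(2 * Real.pi))⁻¹ * Real.exp (-(1 / 2) * x ^ 2) := funext hφe
    rw [h2]
    refine h1.congr_deriv ?_
    norm_num
    ring
  have hφi : Integrable φ := integrable_gaussianPDFReal 0 1
  have hxφi : Integrable fun x => x * φ x := by
    have := (integrable_mul_exp_neg_mul_sq (b := 1 / 2) (by norm_num)).const_mul
      (√(2 * Real.pi))⁻¹
    refine this.congr (Filter.Eventually.of_forall fun x => ?_)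
    simp only [hφe]
    ring
  have hψc : Continuous ψ := continuous_iff_continuousAt.2 fun x => (hψ x).continuousAt
  -- On each half-line the integrand is affine in the argument of `ψ`, with slope `c` or `0`. The
  -- boundary terms at infinity vanish: the functions and their derivatives are integrable.
  have hbp : ∀ c : ℝ,
      Integrable (fun x => φ x * ψ (b + c * x)) ∧
      Integrable (fun x => -(x * φ x) * ψ (b + c * x) + φ x * (ψ' (b + c * x) * c)) ∧
      ∀ x, HasDerivAt (fun x => φ x * ψ (b + c * x))
        (-(x * φ x) * ψ (b + c * x) + φ x * (ψ' (b + c * x) * c)) x := by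
    intro c
    have hm1 : AEStronglyMeasurable (fun x => ψ (b + c * x)) volume :=
      (hψc.comp (by fun_prop)).aestronglyMeasurable
    have hm2 : AEStronglyMeasurable (fun x => ψ' (b + c * x) * c) volume :=
      ((hψ'm.comp (by fun_prop)).mul_const c).aestronglyMeasurable
    refine ⟨hφi.mul_bdd hm1 (Filter.Eventually.of_forall fun x => hK _),
      (hxφi.neg.mul_bdd hm1 (Filter.Eventually.of_forall fun x => hK _)).add
        (hφi.mul_bdd (c := L * |c|) hm2 (Filter.Eventually.of_forall fun x => ?_)), fun x => ?_⟩
    · rw [Real.norm_eq_abs, abs_mul]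
      exact mul_le_mul_of_nonneg_right (hL _) (abs_nonneg _)
    · have h1 : HasDerivAt (fun x : ℝ => b + c * x) c x := by
        simpa using ((hasDerivAt_id x).const_mul c).const_add b
      exact (hφd x).mul ((hψ (b + c * x)).comp x h1)
  obtain ⟨i1, i2, d1⟩ := hbp c
  obtain ⟨j1, j2, d2⟩ := hbp 0
  have hpos : ∫ x in Set.Ioi 0, (-(x * φ x) * ψ (b + c * x) + φ x * (ψ' (b + c * x) * c)) =
      0 - φ 0 * ψ (b + c * 0) :=
    integral_Ioi_of_hasDerivAt_of_tendsto' (fun x _ => d1 x) i2.integrableOn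
      (tendsto_zero_of_hasDerivAt_of_integrableOn_Ioi (a := 0) (fun x _ => d1 x)
        i2.integrableOn i1.integrableOn)
  have hneg : ∫ x in Set.Iic 0, (-(x * φ x) * ψ (b + 0 * x) + φ x * (ψ' (b + 0 * x) * 0)) =
      φ 0 * ψ (b + 0 * 0) - 0 :=
    integral_Iic_of_hasDerivAt_of_tendsto' (fun x _ => d2 x) j2.integrableOn
      (tendsto_zero_of_hasDerivAt_of_integrableOn_Iic (a := 0) (fun x _ => d2 x)
        j2.integrableOn j1.integrableOn)
  set D : ℝ → ℝ := fun x => φ x * (ψ' (b + c * relu x) * (c * if 0 < x then 1 else 0)) -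
    φ x * (x * ψ (b + c * relu x)) with hD
  have hDpos : Set.EqOn (fun x => -(x * φ x) * ψ (b + c * x) + φ x * (ψ' (b + c * x) * c)) D
      (Set.Ioi 0) := by
    intro x hx
    have hx : 0 < x := hx
    simp only [hD, relu, max_eq_left hx.le, if_pos hx]
    ring
  have hDneg : Set.EqOn (fun x => -(x * φ x) * ψ (b + 0 * x) + φ x * (ψ' (b + 0 * x) * 0)) D
      (Set.Iic 0) := by
    intro x hx
    have hx : x ≤ 0 := hx
    simp only [hD, relu, max_eq_right hx, if_neg (not_lt.2 hx)]
    ring_nf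
  have hDi : ∫ x, D x = 0 := by
    rw [← intervalIntegral.integral_Iic_add_Ioi (b := 0)
      (j2.integrableOn.congr_fun hDneg measurableSet_Iic)
      (i2.integrableOn.congr_fun hDpos measurableSet_Ioi),
      ← setIntegral_congr_fun measurableSet_Ioi hDpos,
      ← setIntegral_congr_fun measurableSet_Iic hDneg, hpos, hneg]
    simp
  have hmr : Measurable fun x : ℝ => b + c * relu x := (measurable_relu.const_mul c).const_add b
  have k1 : Integrable fun x => φ x * (ψ' (b + c * relu x) * (c * if 0 < x then 1 else 0)) := by
    refine hφi.mul_bdd (c := L * |c|) ?_ (Filter.Eventually.of_forall fun x => ?_)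
    · exact ((hψ'm.comp hmr).mul ((Measurable.ite measurableSet_Ioi measurable_const
        measurable_const).const_mul c)).aestronglyMeasurable
    · rw [Real.norm_eq_abs, abs_mul]
      refine mul_le_mul (hL _) ?_ (abs_nonneg _) ((abs_nonneg _).trans (hL 0))
      split_ifs <;> simp
  have k2 : Integrable fun x => φ x * (x * ψ (b + c * relu x)) := by
    have := hxφi.mul_bdd (hψc.measurable.comp hmr).aestronglyMeasurable
      (Filter.Eventually.of_forall fun x => hK (b + c * relu x))
    refine this.congr (Filter.Eventually.of_forall fun x => ?_)
    simp only [Function.comp]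
    ring
  rw [integral_gaussianReal_eq_integral_smul one_ne_zero,
    integral_gaussianReal_eq_integral_smul one_ne_zero]
  simp only [smul_eq_mul]
  have := integral_sub k1 k2
  rw [show (∫ x, (φ x * (ψ' (b + c * relu x) * (c * if 0 < x then 1 else 0)) -
    φ x * (x * ψ (b + c * relu x)))) = 0 from hDi] at this
  linarith

/-- Resampling one coordinate of a product measure preserves it. -/
theorem measurePreserving_update {ι α : Type*} [Fintype ι] [DecidableEq ι] [MeasurableSpace α]
    (μ : Measure α) [IsProbabilityMeasure μ] (r : ι) :
    MeasurePreserving (fun q : (ι → α) × α => Function.update q.1 r q.2)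
      ((Measure.pi fun _ : ι => μ).prod μ) (Measure.pi fun _ : ι => μ) := by
  have hmeas : Measurable fun q : (ι → α) × α => Function.update q.1 r q.2 := by
    rw [measurable_pi_iff]
    intro i
    by_cases hi : i = r
    · subst hi
      simpa using measurable_snd
    · simp only [Function.update_of_ne hi]
      exact (measurable_pi_apply i).comp measurable_fst
  refine ⟨hmeas, (Measure.pi_eq fun s hs => ?_).symm⟩
  rw [Measure.map_apply hmeas (MeasurableSet.univ_pi hs)]
  have hpre : (fun q : (ι → α) × α => Function.update q.1 r q.2) ⁻¹' Set.univ.pi s =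
      (Set.univ.pi (Function.update s r Set.univ)) ×ˢ s r := by
    ext q
    simp only [Set.mem_preimage, Set.mem_pi, Set.mem_univ, true_imp_iff, Set.mem_prod]
    constructor
    · refine fun h => ⟨fun i => ?_, by simpa using h r⟩
      by_cases hi : i = r
      · subst hi; simp
      · simpa [hi] using h i
    · rintro ⟨h1, h2⟩ i
      by_cases hi : i = r
      · subst hi; simpa using h2
      · simpa [hi] using h1 i
  rw [hpre, Measure.prod_prod, Measure.pi_pi, ← Finset.mul_prod_erase _ _ (Finset.mem_univ r),
    ← Finset.mul_prod_erase _ (fun i => μ (s i)) (Finset.mem_univ r)]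
  rw [Function.update_self, measure_univ, one_mul, mul_comm]
  congr 1
  refine Finset.prod_congr rfl fun i hi => ?_
  rw [Function.update_of_ne (Finset.ne_of_mem_erase hi)]

/-- Gaussian integration by parts in the `r`-th argument of a sum of ReLU units. -/
theorem integral_deriv_sum_relu {m : ℕ} {ψ ψ' : ℝ → ℝ} (hψ : ∀ x, HasDerivAt ψ (ψ' x) x)
    (hψ'm : Measurable ψ') {K L : ℝ} (hK : ∀ x, |ψ x| ≤ K) (hL : ∀ x, |ψ' x| ≤ L) (b : ℝ)
    (c : Fin m → ℝ) (r : Fin m) :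
    ∫ x, ψ' (b + ∑ q, c q * relu (x q)) * (c r * if 0 < x r then 1 else 0)
        ∂(Measure.pi fun _ : Fin m => gaussianReal 0 1) =
      ∫ x, x r * ψ (b + ∑ q, c q * relu (x q))
        ∂(Measure.pi fun _ : Fin m => gaussianReal 0 1) := by
  have hψc : Continuous ψ := continuous_iff_continuousAt.2 fun x => (hψ x).continuousAt
  have hX : Measurable fun x : Fin m → ℝ => b + ∑ q, c q * relu (x q) :=
    (Finset.measurable_sum _ fun q _ =>
      (measurable_relu.comp (measurable_pi_apply q)).const_mul (c q)).const_add b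
  have hup := measurePreserving_update (gaussianReal 0 1) r
  have hsum : ∀ (x : Fin m → ℝ) (y : ℝ),
      b + ∑ q, c q * relu (Function.update x r y q) =
        (b + ∑ q ∈ Finset.univ.erase r, c q * relu (x q)) + c r * relu y := by
    intro x y
    rw [← Finset.add_sum_erase _ _ (Finset.mem_univ r), Function.update_self]
    have : ∑ q ∈ Finset.univ.erase r, c q * relu (Function.update x r y q) =
        ∑ q ∈ Finset.univ.erase r, c q * relu (x q) :=
      Finset.sum_congr rfl fun q hq => by rw [Function.update_of_ne (Finset.ne_of_mem_erase hq)]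
    rw [this]
    ring
  have m1 : Measurable fun x : Fin m → ℝ =>
      ψ' (b + ∑ q, c q * relu (x q)) * (c r * if 0 < x r then 1 else 0) :=
    (hψ'm.comp hX).mul ((Measurable.ite (measurableSet_lt measurable_const
      (measurable_pi_apply r)) measurable_const measurable_const).const_mul _)
  have m2 : Measurable fun x : Fin m → ℝ => x r * ψ (b + ∑ q, c q * relu (x q)) :=
    (measurable_pi_apply r).mul (hψc.measurable.comp hX)
  have i1 : Integrable (fun x : Fin m → ℝ =>
      ψ' (b + ∑ q, c q * relu (x q)) * (c r * if 0 < x r then 1 else 0))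
      (Measure.pi fun _ : Fin m => gaussianReal 0 1) := by
    refine Integrable.of_bound m1.aestronglyMeasurable (L * |c r|)
      (Filter.Eventually.of_forall fun x => ?_)
    rw [Real.norm_eq_abs, abs_mul]
    refine mul_le_mul (hL _) ?_ (abs_nonneg _) ((abs_nonneg _).trans (hL 0))
    split_ifs <;> simp
  have i2 : Integrable (fun x : Fin m → ℝ => x r * ψ (b + ∑ q, c q * relu (x q)))
      (Measure.pi fun _ : Fin m => gaussianReal 0 1) :=
    (integrable_eval (μ := fun _ : Fin m => gaussianReal 0 1) (i := r)
      IsGaussian.integrable_id).mul_bdd (hψc.measurable.comp hX).aestronglyMeasurable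
      (Filter.Eventually.of_forall fun x => hK _)
  have hswap : ∀ F : (Fin m → ℝ) → ℝ, Measurable F →
      Integrable F (Measure.pi fun _ : Fin m => gaussianReal 0 1) →
      ∫ x, F x ∂(Measure.pi fun _ : Fin m => gaussianReal 0 1) =
        ∫ x, ∫ y, F (Function.update x r y) ∂(gaussianReal 0 1)
          ∂(Measure.pi fun _ : Fin m => gaussianReal 0 1) := by
    intro F hF hFi
    conv_lhs => rw [← hup.map_eq, integral_map hup.aemeasurable hF.aestronglyMeasurable]
    exact integral_prod _ (hup.integrable_comp_of_integrable hFi)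
  rw [hswap _ m1 i1, hswap _ m2 i2]
  refine integral_congr_ae (Filter.Eventually.of_forall fun x => ?_)
  simp only [hsum, Function.update_self]
  exact integral_deriv_relu_gaussianReal hψ hψ'm hK hL _ _

theorem integral_abs_sum_mul_le {m : ℕ} {c : Fin m → ℝ} (hc : ∑ r, c r ^ 2 ≤ 1) :
    Integrable (fun x : Fin m → ℝ => ∑ r, c r * x r)
        (Measure.pi fun _ : Fin m => gaussianReal 0 1) ∧
      ∫ x, |∑ r, c r * x r| ∂(Measure.pi fun _ : Fin m => gaussianReal 0 1) ≤ 1 := by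
  have hmem : ∀ r : Fin m, MemLp (fun y : ℝ => c r * y) 2 (gaussianReal 0 1) := fun r =>
    IsGaussian.memLp_two_id.const_mul _
  have hmem' : MemLp (fun x : Fin m → ℝ => ∑ r, c r * x r) 2
      (Measure.pi fun _ : Fin m => gaussianReal 0 1) :=
    memLp_finsetSum _ fun r _ => (hmem r).comp_measurePreserving
      (measurePreserving_eval (fun _ : Fin m => gaussianReal 0 1) r)
  have hint := hmem'.integrable one_le_two
  refine ⟨hint, ?_⟩
  have hmean : ∫ x, ∑ r, c r * x r ∂(Measure.pi fun _ : Fin m => gaussianReal 0 1) = 0 := by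
    rw [integral_finsetSum _ fun r _ => (integrable_eval (μ := fun _ : Fin m => gaussianReal 0 1)
      (i := r) IsGaussian.integrable_id).const_mul (c r)]
    refine Finset.sum_eq_zero fun r _ => ?_
    rw [integral_const_mul, integral_eval]
    simp
  have hvar := variance_sum_pi (μ := fun _ : Fin m => gaussianReal 0 1)
    (X := fun r y => c r * y) hmem
  have hfun : (∑ r : Fin m, fun x : Fin m → ℝ => c r * x r) = fun x => ∑ r, c r * x r := by
    ext x; simp
  rw [hfun, variance_of_integral_eq_zero hmem'.aemeasurable hmean] at hvar
  have hsq : ∫ x, (∑ r, c r * x r) ^ 2 ∂(Measure.pi fun _ : Fin m => gaussianReal 0 1) ≤ 1 := by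
    refine (le_of_eq hvar).trans (le_trans (le_of_eq ?_) hc)
    refine Finset.sum_congr rfl fun r _ => ?_
    rw [variance_const_mul, variance_fun_id_gaussianReal]
    simp
  have hdom : Integrable (fun x : Fin m → ℝ => (1 + (∑ r, c r * x r) ^ 2) / 2)
      (Measure.pi fun _ : Fin m => gaussianReal 0 1) :=
    ((integrable_const 1).add hmem'.integrable_sq).div_const 2
  calc _ ≤ ∫ x, (1 + (∑ r, c r * x r) ^ 2) / 2
        ∂(Measure.pi fun _ : Fin m => gaussianReal 0 1) := by
        refine integral_mono hint.abs hdom fun x => ?_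
        nlinarith [sq_nonneg (|∑ r, c r * x r| - 1), sq_abs (∑ r, c r * x r)]
    _ ≤ 1 := by
        rw [integral_div, integral_add (integrable_const 1) hmem'.integrable_sq]
        simp only [integral_const, probReal_univ, smul_eq_mul, mul_one]
        linarith

/-- Anti-concentration for a sum of ReLU units with Gaussian arguments, in integrated form: moving
along the direction `c` increases the sum at rate `∑_r c_r² 1{x_r > 0}`, so integration by parts
against a bounded primitive `ψ` of `ψ'` controls `ψ'` of the sum, weighted by this rate. -/
theorem integral_deriv_mul_sum_le {m : ℕ} {ψ ψ' : ℝ → ℝ} (hψ : ∀ x, HasDerivAt ψ (ψ' x) x)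
    (hψ'm : Measurable ψ') {K L : ℝ} (hK : ∀ x, |ψ x| ≤ K) (hL : ∀ x, |ψ' x| ≤ L) (b : ℝ)
    {c : Fin m → ℝ} (hc : ∑ r, c r ^ 2 ≤ 1) :
    ∫ x, ψ' (b + ∑ q, c q * relu (x q)) * ∑ r, c r ^ 2 * (if 0 < x r then 1 else 0)
        ∂(Measure.pi fun _ : Fin m => gaussianReal 0 1) ≤ K := by
  have hψc : Continuous ψ := continuous_iff_continuousAt.2 fun x => (hψ x).continuousAt
  have hX : Measurable fun x : Fin m → ℝ => b + ∑ q, c q * relu (x q) :=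
    (Finset.measurable_sum _ fun q _ =>
      (measurable_relu.comp (measurable_pi_apply q)).const_mul (c q)).const_add b
  have i1 : ∀ r, Integrable (fun x : Fin m → ℝ =>
      ψ' (b + ∑ q, c q * relu (x q)) * (c r * if 0 < x r then 1 else 0))
      (Measure.pi fun _ : Fin m => gaussianReal 0 1) := fun r => by
    refine Integrable.of_bound ((hψ'm.comp hX).mul ((Measurable.ite (measurableSet_lt
      measurable_const (measurable_pi_apply r)) measurable_const
        measurable_const).const_mul _)).aestronglyMeasurable (L * |c r|)
      (Filter.Eventually.of_forall fun x => ?_)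
    rw [Real.norm_eq_abs, abs_mul]
    refine mul_le_mul (hL _) ?_ (abs_nonneg _) ((abs_nonneg _).trans (hL 0))
    split_ifs <;> simp
  have hbd : ∀ᵐ x ∂(Measure.pi fun _ : Fin m => gaussianReal 0 1),
      ‖ψ (b + ∑ q, c q * relu (x q))‖ ≤ K := Filter.Eventually.of_forall fun x => hK _
  have hmψ : AEStronglyMeasurable (fun x : Fin m → ℝ => ψ (b + ∑ q, c q * relu (x q)))
      (Measure.pi fun _ : Fin m => gaussianReal 0 1) :=
    (hψc.measurable.comp hX).aestronglyMeasurable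
  have i2 : ∀ r, Integrable (fun x : Fin m → ℝ => x r * ψ (b + ∑ q, c q * relu (x q)))
      (Measure.pi fun _ : Fin m => gaussianReal 0 1) := fun r =>
    (integrable_eval (μ := fun _ : Fin m => gaussianReal 0 1) (i := r)
      IsGaussian.integrable_id).mul_bdd hmψ hbd
  obtain ⟨hY, hY1⟩ := integral_abs_sum_mul_le hc
  have hK0 : 0 ≤ K := (abs_nonneg _).trans (hK 0)
  calc _ = ∑ r, c r * ∫ x, ψ' (b + ∑ q, c q * relu (x q)) * (c r * if 0 < x r then 1 else 0)
          ∂(Measure.pi fun _ : Fin m => gaussianReal 0 1) := by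
        simp only [← integral_const_mul]
        rw [← integral_finsetSum _ fun r _ => (i1 r).const_mul (c r)]
        refine integral_congr_ae (Filter.Eventually.of_forall fun x => ?_)
        simp only [Finset.mul_sum]
        refine Finset.sum_congr rfl fun r _ => ?_
        ring
    _ = ∑ r, c r * ∫ x, x r * ψ (b + ∑ q, c q * relu (x q))
          ∂(Measure.pi fun _ : Fin m => gaussianReal 0 1) := by
        simp only [integral_deriv_sum_relu hψ hψ'm hK hL]
    _ = ∫ x, (∑ r, c r * x r) * ψ (b + ∑ q, c q * relu (x q))
          ∂(Measure.pi fun _ : Fin m => gaussianReal 0 1) := by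
        simp only [← integral_const_mul]
        rw [← integral_finsetSum _ fun r _ => (i2 r).const_mul (c r)]
        refine integral_congr_ae (Filter.Eventually.of_forall fun x => ?_)
        simp only [Finset.sum_mul]
        refine Finset.sum_congr rfl fun r _ => ?_
        ring
    _ ≤ ∫ x, |∑ r, c r * x r| * K ∂(Measure.pi fun _ : Fin m => gaussianReal 0 1) := by
        refine integral_mono (hY.mul_bdd hmψ hbd) (hY.abs.mul_const K) fun x => ?_
        refine (le_abs_self _).trans ?_
        simp only [abs_mul]
        exact mul_le_mul_of_nonneg_left (hK _) (abs_nonneg _)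
    _ ≤ K := by
        rw [integral_mul_const]
        exact mul_le_of_le_one_left hK0 hY1

theorem half_le_gaussianReal_Ioi : 1 / 2 ≤ (gaussianReal 0 1).real (Set.Ioi 0) := by
  have hna : NullSingletonClass (gaussianReal 0 1) :=
    nullSingletonClass_gaussianReal one_ne_zero
  have h1 : (gaussianReal 0 1).real (Set.Iio 0) = (gaussianReal 0 1).real (Set.Ioi 0) := by
    have h := gaussianReal_map_neg (μ := 0) (v := 1)
    rw [neg_zero] at h
    conv_lhs => rw [← h]
    rw [measureReal_def, Measure.map_apply measurable_neg measurableSet_Iio, measureReal_def]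
    congr 2
    ext x
    simp
  have h2 : (gaussianReal 0 1).real (Set.Iic 0) = (gaussianReal 0 1).real (Set.Iio 0) := by
    rw [measureReal_def, measureReal_def, measure_congr Iio_ae_eq_Iic]
  have h3 := probReal_add_probReal_compl (μ := gaussianReal 0 1) (measurableSet_Iic (a := (0 : ℝ)))
  rw [Set.compl_Iic, h2, h1] at h3
  linarith

/-! ### Probabilities of the exceptional events -/

theorem integrable_pow_four {Ω : Type*} [MeasurableSpace Ω] {μ : Measure Ω} {X : Ω → ℝ}
    {c : NNReal} (h : HasSubgaussianMGF X c μ) :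
    Integrable (fun ω => X ω ^ 4) μ := by
  have h1 : MemLp X (4 : ℕ) μ := by simpa using h.memLp 4
  refine (h1.integrable_norm_pow (by norm_num)).congr (Filter.Eventually.of_forall fun ω => ?_)
  simp [Even.pow_abs (by decide : Even 4)]

section Markov

variable {Ω ι : Type*} [MeasurableSpace Ω] {μ : Measure Ω} [IsProbabilityMeasure μ] [Fintype ι]

theorem measureReal_lt_sum_sq_le {X : ι → Ω → ℝ} {q c : ℝ} (hc : 0 < c)
    (hi : ∀ i, Integrable (fun ω => X i ω ^ 2) μ) (hq : ∀ i, ∫ ω, X i ω ^ 2 ∂μ ≤ q) :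
    μ.real {ω | c < ∑ i, X i ω ^ 2} ≤ Fintype.card ι * q / c := by
  have h1 := mul_meas_ge_le_integral_of_nonneg (μ := μ) (f := fun ω => ∑ i, X i ω ^ 2)
    (Filter.Eventually.of_forall fun ω => Finset.sum_nonneg fun i _ => sq_nonneg _)
    (integrable_finsetSum _ fun i _ => hi i) c
  have h2 : ∫ ω, ∑ i, X i ω ^ 2 ∂μ ≤ Fintype.card ι * q := by
    rw [integral_finsetSum _ fun i _ => hi i]
    refine (Finset.sum_le_sum fun i _ => hq i).trans ?_
    simp
  have h3 : μ.real {ω | c < ∑ i, X i ω ^ 2} ≤ μ.real {ω | c ≤ ∑ i, X i ω ^ 2} :=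
    measureReal_mono fun ω (hω : c < _) => le_of_lt hω
  rw [le_div_iff₀ hc, mul_comm]
  exact (mul_le_mul_of_nonneg_left h3 hc.le).trans (h1.trans h2)

/-- Markov's inequality for the square of a sum of squares. Its bound decays like `c⁻²`, so that an
event of probability `δ` costs a factor `δ^{-1/2}` in `c` instead of `δ⁻¹`. -/
theorem measureReal_lt_sum_sq_le_of_pow_four {X : ι → Ω → ℝ} {q c : ℝ} (hc : 0 < c)
    (hi : ∀ i, Integrable (fun ω => X i ω ^ 4) μ) (hq : ∀ i, ∫ ω, X i ω ^ 4 ∂μ ≤ q) :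
    μ.real {ω | c < ∑ i, X i ω ^ 2} ≤ (Fintype.card ι : ℝ) ^ 2 * q / c ^ 2 := by
  rcases isEmpty_or_nonempty ι with hι | hι
  · have : {ω | c < ∑ i, X i ω ^ 2} = ∅ := by
      ext ω
      simpa using hc.le
    rw [this]
    simp
  have hcard : (0 : ℝ) < Fintype.card ι := by exact_mod_cast Fintype.card_pos
  have hsub : {ω | c < ∑ i, X i ω ^ 2} ⊆ {ω | c ^ 2 / Fintype.card ι < ∑ i, (X i ω ^ 2) ^ 2} := by
    intro ω (hω : c < _)
    have h1 : (∑ i, X i ω ^ 2) ^ 2 ≤ Fintype.card ι * ∑ i, (X i ω ^ 2) ^ 2 :=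
      sq_sum_le_card_mul_sum_sq
    have h2 : c ^ 2 < (∑ i, X i ω ^ 2) ^ 2 := pow_lt_pow_left₀ hω hc.le two_ne_zero
    change c ^ 2 / Fintype.card ι < _
    rw [div_lt_iff₀ hcard, mul_comm]
    exact h2.trans_le h1
  have h4 : ∀ i ω, (X i ω ^ 2) ^ 2 = X i ω ^ 4 := fun i ω => by ring
  refine (measureReal_mono hsub).trans ((measureReal_lt_sum_sq_le (X := fun i ω => X i ω ^ 2)
    (q := q) (by positivity) (fun i => by simpa only [h4] using hi i)
    fun i => by simpa only [h4] using hq i).trans (le_of_eq ?_))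
  field_simp

end Markov

section Events

variable {d m k n : ℕ} {Z : Fin n → EuclideanSpace ℝ (Fin d)}

theorem measurable_network (z : EuclideanSpace ℝ (Fin d)) (s : Fin k) :
    Measurable fun p : (Fin m → EuclideanSpace ℝ (Fin d)) × (Fin m → Fin k → ℝ) =>
      network p.2 p.1 z s := by
  refine (Finset.measurable_sum _ fun r _ => ?_).const_mul (1 / √(m : ℝ))
  have h1 : Measurable fun p : (Fin m → EuclideanSpace ℝ (Fin d)) × (Fin m → Fin k → ℝ) =>
      p.2 r s := by fun_prop
  have h2 : Measurable fun p : (Fin m → EuclideanSpace ℝ (Fin d)) × (Fin m → Fin k → ℝ) =>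
      (inner ℝ (p.1 r) z : ℝ) := by fun_prop
  exact h1.mul (measurable_relu.comp h2)

/-- With high probability the outputs at initialization are bounded in mean square. -/
theorem measureReal_lt_sum_network_sq_le (hm : 0 < m) (hZ : ∀ i, ‖Z i‖ = 1) {c : ℝ} (hc : 0 < c) :
    (initLaw d m k).real {p | c < ∑ s, ∑ i, network p.2 p.1 (Z i) s ^ 2} ≤
      33 * (n * k : ℝ) ^ 2 / c ^ 2 := by
  have hsub : ∀ (i : Fin n) (s : Fin k), HasSubgaussianMGF
      (fun p : (Fin m → EuclideanSpace ℝ (Fin d)) × (Fin m → Fin k → ℝ) =>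
        ∑ r, p.2 r s * relu (inner ℝ (p.1 r) (Z i))) m (initLaw d m k) := fun i s => by
    refine hasSubgaussianMGF_sum_neurons ?_ (hasSubgaussianMGF_sign_mul_relu (hZ i) s)
    have h1 : Measurable fun p : EuclideanSpace ℝ (Fin d) × (Fin k → ℝ) => p.2 s := by fun_prop
    have h2 : Measurable fun p : EuclideanSpace ℝ (Fin d) × (Fin k → ℝ) =>
      (inner ℝ p.1 (Z i) : ℝ) := by fun_prop
    exact h1.mul (measurable_relu.comp h2)
  have h4 : ∀ (i : Fin n) (s : Fin k)
      (p : (Fin m → EuclideanSpace ℝ (Fin d)) × (Fin m → Fin k → ℝ)),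
      network p.2 p.1 (Z i) s ^ 4 =
        1 / (m : ℝ) ^ 2 * (∑ r, p.2 r s * relu (inner ℝ (p.1 r) (Z i))) ^ 4 := fun i s p => by
    have : (√(m : ℝ)) ^ 4 = (m : ℝ) ^ 2 := by
      rw [show (4 : ℕ) = 2 * 2 from rfl, pow_mul, Real.sq_sqrt (Nat.cast_nonneg _)]
    simp only [network]
    rw [mul_pow, div_pow, one_pow, this]
  have key := measureReal_lt_sum_sq_le_of_pow_four (μ := initLaw d m k)
    (X := fun (q : Fin k × Fin n) p => network p.2 p.1 (Z q.2) q.1) (q := 33) hc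
    (fun q => by
      simp only [h4]
      exact (integrable_pow_four (hsub q.2 q.1)).const_mul _)
    (fun q => by
      simp only [h4]
      rw [integral_const_mul]
      have := integral_pow_four_le (hsub q.2 q.1)
      have hm' : (0 : ℝ) < m := by exact_mod_cast hm
      rw [NNReal.coe_natCast] at this
      rw [one_div, inv_mul_le_iff₀ (by positivity), mul_comm]
      exact this)
  simp only [Fintype.sum_prod_type, Fintype.card_prod, Fintype.card_fin, Nat.cast_mul] at key
  refine key.trans (le_of_eq ?_)
  ring

/-- The contribution of a single neuron to an entry of the tangent kernel. -/
noncomputable def gramTerm (Z : Fin n → EuclideanSpace ℝ (Fin d)) (s : Fin k) (i : Fin n)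
    (h : Fin k) (j : Fin n) (q : EuclideanSpace ℝ (Fin d) × (Fin k → ℝ)) : ℝ :=
  q.2 s * q.2 h * (active (Z i) q.1 * active (Z j) q.1) * inner ℝ (Z i) (Z j)

theorem measurable_gramTerm (s : Fin k) (i : Fin n) (h : Fin k) (j : Fin n) :
    Measurable (gramTerm Z s i h j) := by
  have h1 : ∀ s, Measurable fun p : EuclideanSpace ℝ (Fin d) × (Fin k → ℝ) => p.2 s :=
    fun s => by fun_prop
  have h2 : ∀ i, Measurable fun p : EuclideanSpace ℝ (Fin d) × (Fin k → ℝ) =>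
    active (Z i) p.1 := fun i => (measurable_active (Z i)).comp measurable_fst
  exact (((h1 s).mul (h1 h)).mul ((h2 i).mul (h2 j))).mul_const _

theorem gram_slope_eq (W : Fin m → EuclideanSpace ℝ (Fin d)) (A : Fin m → Fin k → ℝ)
    (s : Fin k) (i : Fin n) (h : Fin k) (j : Fin n) :
    gram Z A (slope Z W) s i h j = 1 / (m : ℝ) * ∑ r, gramTerm Z s i h j (W r, A r) := rfl

theorem integral_gramTerm (s : Fin k) (i : Fin n) (h : Fin k) (j : Fin n) :
    ∫ q, gramTerm Z s i h j q ∂(neuronLaw d k) = if s = h then ntkGram Z i j else 0 := by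
  have h1 : ∀ q : EuclideanSpace ℝ (Fin d) × (Fin k → ℝ), gramTerm Z s i h j q =
      (active (Z i) q.1 * active (Z j) q.1 * inner ℝ (Z i) (Z j)) * (q.2 s * q.2 h) := fun q => by
    unfold gramTerm; ring
  simp only [h1]
  rw [integral_neuronLaw_mul (fun w => active (Z i) w * active (Z j) w * inner ℝ (Z i) (Z j))
    (fun a => a s * a h), integral_pi_signLaw_mul, ← ntkGram_apply]
  split_ifs <;> simp

theorem ae_abs_gramTerm_le (hZ : ∀ i, ‖Z i‖ = 1) (s : Fin k) (i : Fin n) (h : Fin k) (j : Fin n) :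
    ∀ᵐ q ∂(neuronLaw d k), |gramTerm Z s i h j q| ≤ 1 := by
  filter_upwards [ae_abs_eq_one_neuronLaw] with q hq
  unfold gramTerm
  rw [abs_mul, abs_mul, abs_mul, abs_mul, hq, hq, one_mul, one_mul]
  refine mul_le_one₀ (mul_le_one₀ (abs_active_le _ _) (abs_nonneg _) (abs_active_le _ _))
    (abs_nonneg _) ?_
  simpa [hZ] using abs_real_inner_le_norm (Z i) (Z j)

/-- With high probability the initial tangent kernel is close to `H^∞` on the diagonal blocks and
to `0` off them. -/
theorem measureReal_lt_sum_gram_sub_sq_le (hm : 0 < m) (hZ : ∀ i, ‖Z i‖ = 1) {c : ℝ}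
    (hc : 0 < c) :
    (initLaw d m k).real {p | c < ∑ s, ∑ i, ∑ h, ∑ j,
      (gram Z p.2 (slope Z p.1) s i h j - if s = h then ntkGram Z i j else 0) ^ 2} ≤
      33 * (n * k : ℝ) ^ 4 / (m ^ 2 * c ^ 2) := by
  have hm' : (0 : ℝ) < m := by exact_mod_cast hm
  set f : Fin k → Fin n → Fin k → Fin n → EuclideanSpace ℝ (Fin d) × (Fin k → ℝ) → ℝ :=
    fun s i h j q => gramTerm Z s i h j q - if s = h then ntkGram Z i j else 0 with hf
  have hsub : ∀ s i h j, HasSubgaussianMGF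
      (fun p : (Fin m → EuclideanSpace ℝ (Fin d)) × (Fin m → Fin k → ℝ) =>
        ∑ r, f s i h j (p.1 r, p.2 r)) m (initLaw d m k) := fun s i h j => by
    refine hasSubgaussianMGF_sum_neurons ((measurable_gramTerm s i h j).sub_const _) ?_
    have := hasSubgaussianMGF_of_mem_Icc (μ := neuronLaw d k) (a := -1) (b := 1)
      (measurable_gramTerm (Z := Z) s i h j).aemeasurable
      ((ae_abs_gramTerm_le hZ s i h j).mono fun q hq => abs_le.1 hq)
    rw [integral_gramTerm] at this
    have h1 : (‖(1 : ℝ) - -1‖₊ / 2) ^ 2 = 1 := by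
      have : ‖(1 : ℝ) - -1‖₊ = 2 := by
        ext
        norm_num
      rw [this]
      norm_num
    rwa [h1] at this
  have heq : ∀ s i h j (p : (Fin m → EuclideanSpace ℝ (Fin d)) × (Fin m → Fin k → ℝ)),
      gram Z p.2 (slope Z p.1) s i h j - (if s = h then ntkGram Z i j else 0) =
        1 / (m : ℝ) * ∑ r, f s i h j (p.1 r, p.2 r) := fun s i h j p => by
    rw [gram_slope_eq, hf]
    simp only [Finset.sum_sub_distrib, Finset.sum_const, Finset.card_univ, Fintype.card_fin,
      nsmul_eq_mul]
    field_simp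
  have key := measureReal_lt_sum_sq_le_of_pow_four (μ := initLaw d m k)
    (X := fun (q : Fin k × Fin n × Fin k × Fin n) p => 1 / (m : ℝ) *
      ∑ r, f q.1 q.2.1 q.2.2.1 q.2.2.2 (p.1 r, p.2 r)) (q := 33 / (m : ℝ) ^ 2) hc
    (fun q => by
      simp only [mul_pow]
      exact (integrable_pow_four (hsub q.1 q.2.1 q.2.2.1 q.2.2.2)).const_mul _)
    (fun q => by
      simp only [mul_pow]
      rw [integral_const_mul]
      have := integral_pow_four_le (hsub q.1 q.2.1 q.2.2.1 q.2.2.2)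
      rw [NNReal.coe_natCast] at this
      calc _ ≤ (1 / (m : ℝ)) ^ 4 * (33 * (m : ℝ) ^ 2) :=
            mul_le_mul_of_nonneg_left this (by positivity)
        _ = _ := by field_simp)
  simp only [Fintype.sum_prod_type, Fintype.card_prod, Fintype.card_fin, Nat.cast_mul,
    ← heq] at key
  refine key.trans (le_of_eq ?_)
  field_simp

/-- The probability that a standard Gaussian lies within `R` of the kink. -/
noncomputable def nearProb (R : ℝ) : ℝ := (gaussianReal 0 1).real {x | |x| ≤ R}

theorem nearProb_le {R : ℝ} (hR : 0 ≤ R) : nearProb R ≤ R := by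
  have hset : {x : ℝ | |x| ≤ R} = Set.Icc (-R) R := by
    ext x; simp [abs_le]
  have hpdf : ∀ x, gaussianPDFReal 0 1 x ≤ 1 / 2 := by
    intro x
    unfold gaussianPDFReal
    have h1 : Real.exp (-(x - 0) ^ 2 / (2 * ((1 : NNReal) : ℝ))) ≤ 1 := by
      rw [Real.exp_le_one_iff]
      have : 0 ≤ (x - 0) ^ 2 := sq_nonneg _
      simp only [NNReal.coe_one, mul_one]
      linarith
    have h2 : (√(2 * Real.pi * ((1 : NNReal) : ℝ)))⁻¹ ≤ 1 / 2 := by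
      rw [one_div]
      refine inv_anti₀ two_pos (Real.le_sqrt_of_sq_le ?_)
      have := Real.pi_gt_three
      simp only [NNReal.coe_one, mul_one]
      linarith
    calc _ ≤ 1 / 2 * 1 := mul_le_mul h2 h1 (Real.exp_pos _).le (by norm_num)
      _ = _ := mul_one _
  rw [nearProb, hset, measureReal_def, gaussianReal_apply_eq_integral 0 one_ne_zero,
    ENNReal.toReal_ofReal (integral_nonneg fun x => gaussianPDFReal_nonneg 0 1 x)]
  calc ∫ x in Set.Icc (-R) R, gaussianPDFReal 0 1 x ≤ ∫ x in Set.Icc (-R) R, (1 / 2 : ℝ) :=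
        setIntegral_mono_on (integrable_gaussianPDFReal 0 1).integrableOn
          (integrableOn_const (by simp)) measurableSet_Icc fun x _ => hpdf x
    _ = R := by
        rw [setIntegral_const, measureReal_def, Real.volume_Icc,
          ENNReal.toReal_ofReal (by linarith)]
        simp only [smul_eq_mul]
        ring

/-- The contribution of a single neuron to the second-layer covariance of the neurons near the
kink of `z`. -/
noncomputable def nearTerm (R : ℝ) (z : EuclideanSpace ℝ (Fin d)) (s h : Fin k)
    (q : EuclideanSpace ℝ (Fin d) × (Fin k → ℝ)) : ℝ :=
  (if |(inner ℝ q.1 z : ℝ)| ≤ R then 1 else 0) * (q.2 s * q.2 h)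

theorem measurable_nearTerm (R : ℝ) (z : EuclideanSpace ℝ (Fin d)) (s h : Fin k) :
    Measurable (nearTerm R z s h) := by
  have h1 : ∀ s, Measurable fun p : EuclideanSpace ℝ (Fin d) × (Fin k → ℝ) => p.2 s :=
    fun s => by fun_prop
  have h2 : Measurable fun p : EuclideanSpace ℝ (Fin d) × (Fin k → ℝ) =>
      |(inner ℝ p.1 z : ℝ)| := by fun_prop
  exact (Measurable.ite (measurableSet_le h2 measurable_const) measurable_const
    measurable_const).mul ((h1 s).mul (h1 h))

theorem integral_near {z : EuclideanSpace ℝ (Fin d)} (hz : ‖z‖ = 1) (R : ℝ) :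
    ∫ w, (if |(inner ℝ w z : ℝ)| ≤ R then (1 : ℝ) else 0)
      ∂(stdGaussian (EuclideanSpace ℝ (Fin d))) = nearProb R := by
  have hS : MeasurableSet {x : ℝ | |x| ≤ R} :=
    measurableSet_le (by fun_prop) measurable_const
  have hmp := measurePreserving_inner hz
  have h1 : ∫ x, Set.indicator {x : ℝ | |x| ≤ R} (fun _ => (1 : ℝ)) x ∂(gaussianReal 0 1) =
      nearProb R := by
    rw [integral_indicator hS, setIntegral_const, nearProb]
    simp
  rw [← h1, ← hmp.map_eq, integral_map hmp.aemeasurable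
    (measurable_const.indicator hS).aestronglyMeasurable]
  rfl

theorem integral_nearTerm {z : EuclideanSpace ℝ (Fin d)} (hz : ‖z‖ = 1) (R : ℝ) (s h : Fin k) :
    ∫ q, nearTerm R z s h q ∂(neuronLaw d k) = if s = h then nearProb R else 0 := by
  unfold nearTerm
  rw [integral_neuronLaw_mul (fun w => if |(inner ℝ w z : ℝ)| ≤ R then (1 : ℝ) else 0)
    (fun a => a s * a h), integral_pi_signLaw_mul, integral_near hz]
  split_ifs <;> simp

theorem ae_nearTerm_sq_eq (R : ℝ) (z : EuclideanSpace ℝ (Fin d)) (s h : Fin k) :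
    ∀ᵐ q ∂(neuronLaw d k), nearTerm R z s h q ^ 2 = nearTerm R z s s q := by
  filter_upwards [ae_abs_eq_one_neuronLaw] with q hq
  have e1 : ∀ s, q.2 s * q.2 s = 1 := fun s => by rw [← abs_mul_abs_self, hq s, one_mul]
  unfold nearTerm
  rw [mul_pow, show (q.2 s * q.2 h) ^ 2 = (q.2 s * q.2 s) * (q.2 h * q.2 h) by ring, e1, e1]
  split_ifs <;> simp

/-- With high probability the neurons near a kink are few, and their second-layer weights have
nearly uncorrelated coordinates. -/
theorem measureReal_lt_sum_near_sub_sq_le (hZ : ∀ i, ‖Z i‖ = 1) {R c : ℝ} (hR : 0 ≤ R)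
    (hc : 0 < c) :
    (initLaw d m k).real {p | c < ∑ i, ∑ s, ∑ h,
      (∑ r, nearKink R Z p.1 r i * (p.2 r s * p.2 r h) -
        m * if s = h then nearProb R else 0) ^ 2} ≤ n * k ^ 2 * (m * R) / c := by
  have hmem : ∀ i s h, MemLp (nearTerm R (Z i) s h) 2 (neuronLaw d k) := fun i s h => by
    refine MemLp.of_bound (measurable_nearTerm R (Z i) s h).aestronglyMeasurable 1 ?_
    filter_upwards [ae_abs_eq_one_neuronLaw] with q hq
    unfold nearTerm
    rw [Real.norm_eq_abs, abs_mul, abs_mul, hq, hq]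
    split_ifs <;> simp
  have hsq : ∀ i s h, ∫ q, nearTerm R (Z i) s h q ^ 2 ∂(neuronLaw d k) ≤ R := fun i s h => by
    rw [integral_congr_ae (ae_nearTerm_sq_eq R (Z i) s h), integral_nearTerm (hZ i), if_pos rfl]
    exact nearProb_le hR
  have key := measureReal_lt_sum_sq_le (μ := initLaw d m k)
    (X := fun (q : Fin n × Fin k × Fin k) p =>
      ∑ r, nearTerm R (Z q.1) q.2.1 q.2.2 (p.1 r, p.2 r) -
        m * if q.2.1 = q.2.2 then nearProb R else 0) (q := m * R) hc
    (fun q => ((integral_sum_neurons_sub_sq_le (measurable_nearTerm R (Z q.1) q.2.1 q.2.2)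
      (hmem _ _ _) (hsq _ _ _)).1.sub (memLp_const _)).integrable_sq)
    (fun q => by
      rw [← integral_nearTerm (hZ q.1)]
      exact (integral_sum_neurons_sub_sq_le (measurable_nearTerm R (Z q.1) q.2.1 q.2.2)
        (hmem _ _ _) (hsq _ _ _)).2)
  simp only [Fintype.sum_prod_type, Fintype.card_prod, Fintype.card_fin, Nat.cast_mul] at key
  refine le_trans key (le_of_eq ?_)
  ring

/-- Anti-concentration: an output at initialization is unlikely to be close to a given value. -/
theorem measureReal_abs_network_sub_le (hm : 0 < m) {z : EuclideanSpace ℝ (Fin d)} (hz : ‖z‖ = 1)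
    (s : Fin k) (a : ℝ) {ε : ℝ} (hε : 0 < ε) :
    (initLaw d m k).real {p | |network p.2 p.1 z s - a| ≤ ε} ≤ 8 * Real.pi * ε + 16 / m := by
  have hm' : (0 : ℝ) < m := by exact_mod_cast hm
  -- `ψ'` dominates the indicator of `[-ε, ε]` and has a primitive `ψ` bounded by `2 π ε`.
  set ψ : ℝ → ℝ := fun x => 2 * ε * (Real.arctan (x / ε) + Real.pi / 2) with hψdef
  set ψ' : ℝ → ℝ := fun x => 2 * (1 / (1 + (x / ε) ^ 2)) with hψ'def
  have hψ : ∀ x, HasDerivAt ψ (ψ' x) x := by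
    intro x
    have h1 : HasDerivAt (fun x : ℝ => x / ε) (1 / ε) x := (hasDerivAt_id x).div_const ε
    have h2 := ((h1.arctan).add_const (Real.pi / 2)).const_mul (2 * ε)
    refine h2.congr_deriv ?_
    simp only [hψ'def]
    field_simp
  have hψ'm : Measurable ψ' := by
    refine Continuous.measurable (continuous_const.mul (continuous_const.div (by fun_prop) ?_))
    intro x
    positivity
  have hK : ∀ x, |ψ x| ≤ 2 * Real.pi * ε := by
    intro x
    have h1 := Real.neg_pi_div_two_lt_arctan (x / ε)
    have h2 := Real.arctan_lt_pi_div_two (x / ε)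
    simp only [hψdef]
    rw [abs_of_nonneg (mul_nonneg (by positivity) (by linarith))]
    nlinarith
  have hψ'0 : ∀ x, 0 ≤ ψ' x := fun x => by
    simp only [hψ'def]
    positivity
  have hL : ∀ x, |ψ' x| ≤ 2 := by
    intro x
    rw [abs_of_nonneg (hψ'0 x)]
    simp only [hψ'def]
    have : 1 / (1 + (x / ε) ^ 2) ≤ 1 := by
      rw [div_le_one (by positivity)]
      have := sq_nonneg (x / ε)
      linarith
    linarith
  have hone : ∀ x, |x| ≤ ε → 1 ≤ ψ' x := by
    intro x hx
    have h1 : (x / ε) ^ 2 ≤ 1 := by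
      rw [div_pow, div_le_one (by positivity)]
      exact sq_le_sq' (by linarith [(abs_le.1 hx).1]) (abs_le.1 hx).2
    simp only [hψ'def]
    rw [mul_one_div, le_div_iff₀ (by positivity)]
    linarith
  set pos : EuclideanSpace ℝ (Fin d) → ℝ := fun w => if 0 < (inner ℝ w z : ℝ) then 1 else 0
    with hpos
  have hposm : Measurable pos :=
    Measurable.ite (measurableSet_lt measurable_const (by fun_prop)) measurable_const
      measurable_const
  have hpos0 : ∀ w, 0 ≤ pos w := fun w => by simp only [hpos]; split_ifs <;> norm_num
  have hpos1 : ∀ w, |pos w| ≤ 1 := fun w => by simp only [hpos]; split_ifs <;> norm_num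
  -- `ψ'` of the deviation from `a`, weighted by the fraction of active neurons: the weight is the rate
  -- that `integral_deriv_mul_sum_le` comes with.
  set G : (Fin m → EuclideanSpace ℝ (Fin d)) × (Fin m → Fin k → ℝ) → ℝ := fun p =>
    ψ' (network p.2 p.1 z s - a) * (1 / (m : ℝ) * ∑ r, pos (p.1 r)) with hG
  have hGm : Measurable G :=
    (hψ'm.comp ((measurable_network z s).sub_const a)).mul
      ((Finset.measurable_sum _ fun r _ => hposm.comp
        ((measurable_pi_apply r).comp measurable_fst)).const_mul _)
  have hfrac : ∀ W : Fin m → EuclideanSpace ℝ (Fin d), |1 / (m : ℝ) * ∑ r, pos (W r)| ≤ 1 := by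
    intro W
    rw [abs_mul, abs_of_nonneg (by positivity : 0 ≤ 1 / (m : ℝ)), one_div, inv_mul_le_iff₀ hm']
    refine (Finset.abs_sum_le_sum_abs _ _).trans ((Finset.sum_le_sum fun r _ => hpos1 (W r)).trans
      ?_)
    simp
  have hGi : Integrable G (initLaw d m k) := by
    refine Integrable.of_bound hGm.aestronglyMeasurable (2 * 1)
      (Filter.Eventually.of_forall fun p => ?_)
    rw [Real.norm_eq_abs, abs_mul]
    exact mul_le_mul (hL _) (hfrac _) (abs_nonneg _) zero_le_two
  have hG0 : ∀ p, 0 ≤ G p := fun p =>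
    mul_nonneg (hψ'0 _) (mul_nonneg (by positivity) (Finset.sum_nonneg fun r _ => hpos0 _))
  have hGle : ∫ p, G p ∂(initLaw d m k) ≤ 2 * Real.pi * ε := by
    unfold initLaw at hGi ⊢
    rw [integral_prod_symm _ hGi]
    have hA : ∀ᵐ A ∂(Measure.pi fun _ : Fin m => Measure.pi fun _ : Fin k => signLaw),
        ∀ r s, |A r s| = 1 := ae_all_iff.2 fun r =>
      (measurePreserving_eval (fun _ : Fin m => Measure.pi fun _ : Fin k => signLaw)
        r).quasiMeasurePreserving.ae ae_abs_eq_one_pi_signLaw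
    have hle : ∀ᵐ A ∂(Measure.pi fun _ : Fin m => Measure.pi fun _ : Fin k => signLaw),
        ∫ W, G (W, A) ∂(Measure.pi fun _ : Fin m => stdGaussian (EuclideanSpace ℝ (Fin d))) ≤
          2 * Real.pi * ε := by
      filter_upwards [hA] with A hA
      have hmp := measurePreserving_pi (fun _ : Fin m => stdGaussian (EuclideanSpace ℝ (Fin d)))
        (fun _ : Fin m => gaussianReal 0 1) (fun _ => measurePreserving_inner hz)
      have hcsq : ∀ r, (1 / √(m : ℝ) * A r s) ^ 2 = 1 / (m : ℝ) := fun r => by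
        rw [mul_pow, div_pow, one_pow, Real.sq_sqrt hm'.le, ← sq_abs (A r s), hA, one_pow, mul_one]
      have h1 := integral_deriv_mul_sum_le hψ hψ'm hK hL (-a)
        (c := fun r => 1 / √(m : ℝ) * A r s) (by
          simp only [hcsq]
          simp only [Finset.sum_const, Finset.card_univ, Fintype.card_fin, nsmul_eq_mul]
          rw [mul_one_div, div_self hm'.ne'])
      simp only [hcsq, ← Finset.mul_sum] at h1
      refine le_trans (le_of_eq ?_) h1
      rw [← hmp.map_eq, integral_map hmp.aemeasurable]
      · refine integral_congr_ae (Filter.Eventually.of_forall fun W => ?_)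
        simp only [hG, hpos, network]
        congr 2
        rw [Finset.mul_sum, sub_eq_neg_add]
        congr 1
        refine Finset.sum_congr rfl fun r _ => ?_
        ring
      · refine Measurable.aestronglyMeasurable ((hψ'm.comp ((Finset.measurable_sum _ fun q _ =>
          (measurable_relu.comp (measurable_pi_apply q)).const_mul _).const_add _)).mul
          ((Finset.measurable_sum _ fun r _ => Measurable.ite (measurableSet_lt measurable_const
            (measurable_pi_apply r)) measurable_const measurable_const).const_mul _))
    refine (integral_mono_ae hGi.integral_prod_right (integrable_const _) hle).trans ?_
    simp
  -- Up to probability `16 / m` at least a quarter of the neurons are active, by Chebyshev's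
  -- inequality, and then the weight is at least `1 / 4`.
  have hmem : MemLp (fun q : EuclideanSpace ℝ (Fin d) × (Fin k → ℝ) => pos q.1) 2
      (neuronLaw d k) :=
    MemLp.of_bound (hposm.comp measurable_fst).aestronglyMeasurable 1
      (Filter.Eventually.of_forall fun q => hpos1 q.1)
  have hsq1 : ∫ q, pos q.1 ^ 2 ∂(neuronLaw d k) ≤ 1 := by
    refine (integral_mono hmem.integrable_sq (integrable_const 1) fun q => ?_).trans (by simp)
    exact (sq_le_one_iff_abs_le_one _).2 (hpos1 q.1)
  obtain ⟨hSmem, hSvar⟩ := integral_sum_neurons_sub_sq_le (m := m) (hposm.comp measurable_fst)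
    hmem hsq1
  have hmean : 1 / 2 ≤ ∫ q, pos q.1 ∂(neuronLaw d k) := by
    have hmp := (measurePreserving_inner hz).comp (measurePreserving_fst
      (μ := stdGaussian (EuclideanSpace ℝ (Fin d))) (ν := Measure.pi fun _ : Fin k => signLaw))
    have h1 : ∫ x, Set.indicator (Set.Ioi 0) (fun _ => (1 : ℝ)) x ∂(gaussianReal 0 1) =
        ∫ q, pos q.1 ∂(neuronLaw d k) := by
      rw [← hmp.map_eq, integral_map hmp.aemeasurable
        (measurable_const.indicator measurableSet_Ioi).aestronglyMeasurable]
      rfl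
    rw [← h1, integral_indicator measurableSet_Ioi, setIntegral_const]
    simpa using half_le_gaussianReal_Ioi
  set e : ℝ := ∫ q, pos q.1 ∂(neuronLaw d k) with he
  have hfew := measureReal_lt_sum_sq_le (ι := Unit) (μ := initLaw d m k)
    (X := fun _ p => ∑ r, pos (p.1 r) - m * e) (q := m * 1) (c := (m / 4 : ℝ) ^ 2 / 1)
    (by positivity) (fun _ => (hSmem.sub (memLp_const _)).integrable_sq) (fun _ => hSvar)
  have hmarkov := mul_meas_ge_le_integral_of_nonneg (Filter.Eventually.of_forall hG0) hGi (1 / 4)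
  have hcover : {p | |network p.2 p.1 z s - a| ≤ ε} ⊆ {p | 1 / 4 ≤ G p} ∪
      {p | (m / 4 : ℝ) ^ 2 / 1 < ∑ _i : Unit, (∑ r, pos (p.1 r) - m * e) ^ 2} := by
    intro p (hp : _ ≤ ε)
    by_cases hS : (m : ℝ) / 4 ≤ ∑ r, pos (p.1 r)
    · left
      have h1 := hone _ hp
      have h2 : 1 / 4 ≤ 1 / (m : ℝ) * ∑ r, pos (p.1 r) := by
        rw [one_div_mul_eq_div, le_div_iff₀ hm']
        linarith
      change 1 / 4 ≤ G p
      calc (1 / 4 : ℝ) = 1 * (1 / 4) := (one_mul _).symm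
        _ ≤ _ := mul_le_mul h1 h2 (by norm_num) (hψ'0 _)
    · right
      rw [not_le] at hS
      have h1 : (m : ℝ) / 2 ≤ m * e := by nlinarith
      have h2 : (m : ℝ) / 4 < m * e - ∑ r, pos (p.1 r) := by linarith
      simp only [Set.mem_ofPred_eq, Finset.univ_unique, Finset.sum_const, Finset.card_singleton,
        one_smul, div_one]
      nlinarith
  have hun := (measureReal_mono hcover).trans (measureReal_union_le (μ := initLaw d m k) _ _)
  have h16 : ((Fintype.card Unit : ℕ) : ℝ) * ((m : ℝ) * 1) / ((m / 4 : ℝ) ^ 2 / 1) = 16 / m := by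
    simp only [Fintype.card_unit]
    field_simp
    norm_num
  rw [h16] at hfew
  linarith

end Events

/-! ### The initialization is good with high probability -/

section Good

variable {d m k n : ℕ} {Z : Fin n → EuclideanSpace ℝ (Fin d)}
  {M : Fin n → EuclideanSpace ℝ (Fin k)} {R B ε τ C L : ℝ}

theorem sum_residual_sq_le (hM : ∀ i, ‖M i‖ ≤ C) (W : Fin m → EuclideanSpace ℝ (Fin d))
    (A : Fin m → Fin k → ℝ) :
    ∑ s, ∑ i, residual Z M A W s i ^ 2 ≤
      2 * (∑ s, ∑ i, network A W (Z i) s ^ 2) + 2 * (n * C ^ 2) := by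
  have h1 : ∑ s, ∑ i, M i s ^ 2 ≤ n * C ^ 2 := by
    rw [Finset.sum_comm]
    have : ∀ i, ∑ s, M i s ^ 2 ≤ C ^ 2 := fun i => by
      rw [← EuclideanSpace.real_norm_sq_eq]
      exact pow_le_pow_left₀ (norm_nonneg _) (hM i) 2
    refine (Finset.sum_le_sum fun i _ => this i).trans ?_
    simp
  calc ∑ s, ∑ i, residual Z M A W s i ^ 2
      ≤ ∑ s, ∑ i, (2 * network A W (Z i) s ^ 2 + 2 * M i s ^ 2) := by
        refine Finset.sum_le_sum fun s _ => Finset.sum_le_sum fun i _ => ?_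
        unfold residual
        nlinarith [sq_nonneg (network A W (Z i) s + M i s)]
    _ = 2 * (∑ s, ∑ i, network A W (Z i) s ^ 2) + 2 * ∑ s, ∑ i, M i s ^ 2 := by
        simp only [Finset.sum_add_distrib, Finset.mul_sum]
    _ ≤ _ := by linarith

/-- Deterministic part: sums of squared deviations control the properties in `GoodInit`. One data
point `i₀` suffices for the lower bound on the residuals, and the deviation of the matrix
`∑_r 1{near} A_r A_rᵀ` from its mean `m · nearProb R · I` in Frobenius norm bounds both the number
of neurons near a kink (by a diagonal entry) and the quadratic form of their weights. -/
theorem goodInit_of_le (hk : 0 < k) (hR : 0 ≤ R) (hε : 0 ≤ ε) (hM : ∀ i, ‖M i‖ ≤ C)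
    (hB : 2 * L + 2 * (n * C ^ 2) ≤ B ^ 2) (i₀ : Fin n)
    {W : Fin m → EuclideanSpace ℝ (Fin d)} {A : Fin m → Fin k → ℝ}
    (hA : ∀ r s, |A r s| = 1)
    (h1 : ∑ s, ∑ i, network A W (Z i) s ^ 2 ≤ L)
    (h2 : ∀ s, ε < |network A W (Z i₀) s - M i₀ s|)
    (h3 : ∑ s, ∑ i, ∑ h, ∑ j,
      (gram Z A (slope Z W) s i h j - if s = h then ntkGram Z i j else 0) ^ 2 ≤ τ ^ 2)
    (h4 : ∑ i, ∑ s, ∑ h, (∑ r, nearKink R Z W r i * (A r s * A r h) -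
      m * if s = h then nearProb R else 0) ^ 2 ≤ (R * m) ^ 2) :
    GoodInit Z M (ntkGram Z) R B ε τ W A := by
  have hRm : 0 ≤ R * m := by positivity
  have hp : m * nearProb R ≤ R * m := by
    rw [mul_comm]
    exact mul_le_mul_of_nonneg_right (nearProb_le hR) (Nat.cast_nonneg _)
  set T : Fin n → Fin k → Fin k → ℝ := fun i s h => ∑ r, nearKink R Z W r i * (A r s * A r h) -
    m * if s = h then nearProb R else 0 with hT
  have hTi : ∀ i, ∑ s, ∑ h, T i s h ^ 2 ≤ (R * m) ^ 2 := fun i =>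
    (Finset.single_le_sum (f := fun i => ∑ s, ∑ h, T i s h ^ 2)
      (fun i _ => by positivity) (Finset.mem_univ i)).trans h4
  refine ⟨hA, ?_, fun s => ?_, fun s => ?_, fun i => ?_, fun i v => ?_⟩
  · exact (sum_residual_sq_le hM W A).trans (by linarith)
  · refine le_trans ?_ (Finset.single_le_sum (f := fun i => residual Z M A W s i ^ 2)
      (fun i _ => sq_nonneg _) (Finset.mem_univ i₀))
    rw [← sq_abs (residual Z M A W s i₀)]
    exact pow_le_pow_left₀ hε (h2 s).le 2
  · exact (Finset.single_le_sum (f := fun s => ∑ i, ∑ h, ∑ j,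
      (gram Z A (slope Z W) s i h j - if s = h then ntkGram Z i j else 0) ^ 2)
      (fun s _ => by positivity) (Finset.mem_univ s)).trans h3
  · have hs : T i ⟨0, hk⟩ ⟨0, hk⟩ ^ 2 ≤ (R * m) ^ 2 :=
      ((Finset.single_le_sum (f := fun h => T i ⟨0, hk⟩ h ^ 2) (fun h _ => sq_nonneg _)
        (Finset.mem_univ _)).trans (Finset.single_le_sum (f := fun s => ∑ h, T i s h ^ 2)
        (fun s _ => by positivity) (Finset.mem_univ _))).trans (hTi i)
    have hTe : T i ⟨0, hk⟩ ⟨0, hk⟩ = ∑ r, nearKink R Z W r i - m * nearProb R := by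
      simp only [hT, if_true]
      congr 1
      refine Finset.sum_congr rfl fun r _ => ?_
      rw [← abs_mul_abs_self, hA, one_mul, mul_one]
    have := (abs_le.1 (abs_le_of_sq_le_sq hs hRm)).2
    rw [hTe] at this
    linarith
  · have e1 : ∑ r, nearKink R Z W r i * (∑ h, A r h * v h) ^ 2 =
        ∑ q : Fin k × Fin k, (v q.1 * v q.2) * T i q.1 q.2 +
          m * nearProb R * ∑ h, v h ^ 2 := by
      have e2 : ∑ q : Fin k × Fin k, (v q.1 * v q.2) * T i q.1 q.2 =
          ∑ q : Fin k × Fin k, (v q.1 * v q.2) * ∑ r, nearKink R Z W r i * (A r q.1 * A r q.2) -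
          m * nearProb R * ∑ h, v h ^ 2 := by
        have e3 : m * nearProb R * ∑ h, v h ^ 2 = ∑ q : Fin k × Fin k,
            (v q.1 * v q.2) * (m * if q.1 = q.2 then nearProb R else 0) := by
          rw [Fintype.sum_prod_type, Finset.mul_sum]
          refine Finset.sum_congr rfl fun s _ => ?_
          rw [Finset.sum_eq_single s]
          · simp
            ring
          · intro h _ hh
            simp [Ne.symm hh]
          · simp
        rw [e3, ← Finset.sum_sub_distrib]
        refine Finset.sum_congr rfl fun q _ => ?_
        simp only [hT]
        ring
      rw [e2, sub_add_cancel]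
      simp only [Finset.mul_sum]
      rw [Finset.sum_comm]
      refine Finset.sum_congr rfl fun r _ => ?_
      rw [sq, Finset.sum_mul_sum, Fintype.sum_prod_type, Finset.mul_sum]
      refine Finset.sum_congr rfl fun s _ => ?_
      rw [Finset.mul_sum]
      refine Finset.sum_congr rfl fun h _ => ?_
      ring
    have e4 : ∑ q : Fin k × Fin k, (v q.1 * v q.2) * T i q.1 q.2 ≤
        (∑ h, v h ^ 2) * (R * m) := by
      refine (Real.sum_mul_le_sqrt_mul_sqrt _ _ _).trans ?_
      have e5 : ∑ q : Fin k × Fin k, (v q.1 * v q.2) ^ 2 = (∑ h, v h ^ 2) ^ 2 := by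
        simp only [Fintype.sum_prod_type, mul_pow]
        rw [sq, Finset.sum_mul_sum]
      have e6 : ∑ q : Fin k × Fin k, T i q.1 q.2 ^ 2 ≤ (R * m) ^ 2 := by
        rw [Fintype.sum_prod_type]
        exact hTi i
      rw [e5, Real.sqrt_sq (Finset.sum_nonneg fun h _ => sq_nonneg _)]
      exact mul_le_mul_of_nonneg_left (Real.sqrt_le_iff.2 ⟨hRm, e6⟩)
        (Finset.sum_nonneg fun h _ => sq_nonneg _)
    rw [e1]
    have hv : 0 ≤ ∑ h, v h ^ 2 := Finset.sum_nonneg fun h _ => sq_nonneg _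
    have := mul_le_mul_of_nonneg_right hp hv
    linarith

theorem ofReal_one_sub_le_measure_diff {Ω : Type*} [MeasurableSpace Ω] {μ : Measure Ω}
    [IsProbabilityMeasure μ] {S N : Set Ω} (hS : μ Sᶜ = 0) (hN : MeasurableSet N) {δ : ℝ}
    (h : μ.real N ≤ δ) : ENNReal.ofReal (1 - δ) ≤ μ (S \ N) := by
  rw [Set.sdiff_eq, Set.inter_comm, measure_inter_conull hS, ← ofReal_measureReal,
    probReal_compl_eq_one_sub hN]
  exact ENNReal.ofReal_le_ofReal (by linarith)

theorem measurableSet_abs_eq_one :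
    MeasurableSet {p : (Fin m → EuclideanSpace ℝ (Fin d)) × (Fin m → Fin k → ℝ) |
      ∀ r s, |p.2 r s| = 1} := by
  simp only [Set.ofPred_forall]
  refine MeasurableSet.iInter fun r => MeasurableSet.iInter fun s => ?_
  exact measurableSet_eq_fun (by fun_prop) measurable_const

theorem measurable_sum_network_sq :
    Measurable fun p : (Fin m → EuclideanSpace ℝ (Fin d)) × (Fin m → Fin k → ℝ) =>
      ∑ s, ∑ i, network p.2 p.1 (Z i) s ^ 2 :=
  Finset.measurable_sum _ fun s _ => Finset.measurable_sum _ fun i _ =>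
    (measurable_network (Z i) s).pow_const 2

theorem measurable_gram_slope (s : Fin k) (i : Fin n) (h : Fin k) (j : Fin n) :
    Measurable fun p : (Fin m → EuclideanSpace ℝ (Fin d)) × (Fin m → Fin k → ℝ) =>
      gram Z p.2 (slope Z p.1) s i h j := by
  simp only [gram_slope_eq]
  refine Measurable.const_mul (Finset.measurable_sum _ fun r _ => ?_) _
  exact (measurable_gramTerm s i h j).comp (measurePreserving_neuron r).measurable

theorem measurable_sum_near (i : Fin n) (s h : Fin k) :
    Measurable fun p : (Fin m → EuclideanSpace ℝ (Fin d)) × (Fin m → Fin k → ℝ) =>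
      ∑ r, nearKink R Z p.1 r i * (p.2 r s * p.2 r h) := by
  refine Finset.measurable_sum _ fun r _ => ?_
  have h1 := (measurable_nearTerm R (Z i) s h).comp
    (measurePreserving_neuron (d := d) (m := m) (k := k) r).measurable
  exact h1

theorem measurable_sum_gram_sub_sq :
    Measurable fun p : (Fin m → EuclideanSpace ℝ (Fin d)) × (Fin m → Fin k → ℝ) =>
      ∑ s, ∑ i, ∑ h, ∑ j,
        (gram Z p.2 (slope Z p.1) s i h j - if s = h then ntkGram Z i j else 0) ^ 2 :=
  Finset.measurable_sum _ fun s _ => Finset.measurable_sum _ fun i _ =>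
    Finset.measurable_sum _ fun h _ => Finset.measurable_sum _ fun j _ =>
      ((measurable_gram_slope s i h j).sub_const _).pow_const 2

theorem measurable_sum_near_sub_sq :
    Measurable fun p : (Fin m → EuclideanSpace ℝ (Fin d)) × (Fin m → Fin k → ℝ) =>
      ∑ i, ∑ s, ∑ h, (∑ r, nearKink R Z p.1 r i * (p.2 r s * p.2 r h) -
        m * if s = h then nearProb R else 0) ^ 2 :=
  Finset.measurable_sum _ fun i _ => Finset.measurable_sum _ fun s _ =>
    Finset.measurable_sum _ fun h _ => ((measurable_sum_near i s h).sub_const _).pow_const 2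

/-- If each of the four bad events has probability at most `δ / 4`, the initialization is good
with probability at least `1 - δ`. -/
theorem exists_goodInit_event (hn : 0 < n) (hm : 0 < m) (hk : 0 < k) (hZ : ∀ i, ‖Z i‖ = 1)
    (hM : ∀ i, ‖M i‖ ≤ C) (hR : 0 < R) (hε : 0 < ε) (hτ : 0 < τ) (hL : 0 < L)
    (hB : 2 * L + 2 * (n * C ^ 2) ≤ B ^ 2) {δ : ℝ}
    (b1 : 33 * (n * k : ℝ) ^ 2 / L ^ 2 ≤ δ / 4)
    (b2 : k * (8 * Real.pi * ε + 16 / m) ≤ δ / 4)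
    (b3 : 33 * (n * k : ℝ) ^ 4 / (m ^ 2 * (τ ^ 2) ^ 2) ≤ δ / 4)
    (b4 : n * k ^ 2 * (m * R) / (R * m) ^ 2 ≤ δ / 4) :
    ∃ E : Set ((Fin m → EuclideanSpace ℝ (Fin d)) × (Fin m → Fin k → ℝ)),
      MeasurableSet E ∧ ENNReal.ofReal (1 - δ) ≤ initLaw d m k E ∧
        ∀ W A, (W, A) ∈ E → GoodInit Z M (ntkGram Z) R B ε τ W A := by
  have hRm : 0 < (R * m) ^ 2 := by
    have : (0 : ℝ) < m := by exact_mod_cast hm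
    positivity
  have v1 := measureReal_lt_sum_network_sq_le (d := d) (k := k) hm hZ hL
  have v2 : ∀ s, (initLaw d m k).real {p | |network p.2 p.1 (Z ⟨0, hn⟩) s - M ⟨0, hn⟩ s| ≤ ε} ≤
      8 * Real.pi * ε + 16 / m := fun s =>
    measureReal_abs_network_sub_le hm (hZ ⟨0, hn⟩) s (M ⟨0, hn⟩ s) hε
  have v3 := measureReal_lt_sum_gram_sub_sq_le (d := d) (k := k) hm hZ (pow_pos hτ 2)
  have v4 := measureReal_lt_sum_near_sub_sq_le (d := d) (m := m) (k := k) hZ hR.le hRm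
  have m1 := measurableSet_lt (measurable_const (a := L))
    (measurable_sum_network_sq (d := d) (m := m) (k := k) (Z := Z))
  have m2 : ∀ s, MeasurableSet {p : (Fin m → EuclideanSpace ℝ (Fin d)) × (Fin m → Fin k → ℝ) |
      |network p.2 p.1 (Z ⟨0, hn⟩) s - M ⟨0, hn⟩ s| ≤ ε} := fun s =>
    measurableSet_le ((continuous_abs.measurable.comp
      ((measurable_network (Z ⟨0, hn⟩) s).sub_const _))) measurable_const
  have m3 := measurableSet_lt (measurable_const (a := τ ^ 2))
    (measurable_sum_gram_sub_sq (d := d) (m := m) (k := k) (Z := Z))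
  have m4 := measurableSet_lt (measurable_const (a := (R * m) ^ 2))
    (measurable_sum_near_sub_sq (d := d) (m := m) (k := k) (Z := Z) (R := R))
  refine ⟨_ \ (_ ∪ (⋃ s, _) ∪ _ ∪ _), measurableSet_abs_eq_one.diff
    (((m1.union (MeasurableSet.iUnion m2)).union m3).union m4), ?_, ?_⟩
  · refine ofReal_one_sub_le_measure_diff ae_abs_eq_one_initLaw
      (((m1.union (MeasurableSet.iUnion m2)).union m3).union m4) ?_
    refine (measureReal_union_le _ _).trans ?_
    refine (add_le_add_left (measureReal_union_le _ _) _).trans ?_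
    refine (add_le_add_left (add_le_add_left (measureReal_union_le _ _) _) _).trans ?_
    have v5 := (measureReal_iUnion_fintype_le (μ := initLaw d m k) fun s =>
      {p | |network p.2 p.1 (Z ⟨0, hn⟩) s - M ⟨0, hn⟩ s| ≤ ε}).trans
        (Finset.sum_le_sum fun s _ => v2 s)
    rw [Finset.sum_const, Finset.card_univ, Fintype.card_fin, nsmul_eq_mul] at v5
    linarith
  · rintro W A ⟨hA, hnot⟩
    simp only [Set.mem_union, Set.mem_iUnion, not_or, not_exists] at hnot
    obtain ⟨⟨⟨n1, n2⟩, n3⟩, n4⟩ := hnot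
    exact goodInit_of_le hk hR.le hε.le hM hB ⟨0, hn⟩ hA (not_lt.1 n1)
      (fun s => not_le.1 (n2 s)) (not_lt.1 n3) (not_lt.1 n4)

end Good

/-! ### The choice of the parameters -/

/-- The choice of the parameters. `L`, `τ` and `ε` are dictated by the probabilities of the bad
events, `B` by `L` and the size of the targets (whence `D`), and `R` by the condition
`2 (τ + 4 n R) B ≤ lam ε` on the coupling. The essential lower bound on the width `m` comes from the
last inequality, where `(2 (n k / m)^{1/2} B / (lam R))²` is of order `n⁵ k⁵ / (m δ³ lam⁴)`. -/
theorem exists_parameters {n k m δ lam D : ℝ} (hn : 1 ≤ n) (hk : 1 ≤ k) (hm : 0 < m)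
    (hδ : 0 < δ) (hδ1 : δ < 1) (hlam : 0 < lam) (hlam1 : lam ≤ 1) (hD : 24 ≤ D)
    (hbase : 10 ^ 8 * D ^ 2 * (k ^ 5 * n ^ 6) ≤ m * (δ ^ 3 * lam ^ 4)) :
    ∃ R B ε τ L : ℝ, 0 < R ∧ 0 < B ∧ 0 < ε ∧ 0 < τ ∧ 0 < L ∧
      B ^ 2 = 2 * L + (D - 24) * (n * k / √δ) ∧
      33 * (n * k) ^ 2 / L ^ 2 ≤ δ / 4 ∧
      k * (8 * Real.pi * ε + 16 / m) ≤ δ / 4 ∧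
      33 * (n * k) ^ 4 / (m ^ 2 * (τ ^ 2) ^ 2) ≤ δ / 4 ∧
      n * k ^ 2 * (m * R) / (R * m) ^ 2 ≤ δ / 4 ∧
      2 * (τ + 4 * n * R) * √k ≤ lam ∧
      2 * (τ + 4 * n * R) * B ≤ lam * ε ∧
      2 * √(n * k / m) * B / lam < R := by
  obtain ⟨σ, hσ, hσ2, hσe⟩ : ∃ σ : ℝ, 0 < σ ∧ σ ^ 2 = δ ∧ √δ = σ :=
    ⟨√δ, Real.sqrt_pos.2 hδ, Real.sq_sqrt hδ.le, rfl⟩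
  rw [hσe]
  have hσ1 : σ ≤ 1 := by
    by_contra! h
    linarith [one_lt_pow₀ h two_ne_zero]
  have hδσ : δ ≤ σ := by
    rw [← hσ2, sq]
    exact mul_le_of_le_one_left hσ.le hσ1
  have hn0 : 0 < n := by linarith
  have hk0 : 0 < k := by linarith
  have hD0 : 0 < D := by linarith
  have hD1 : 1 ≤ D := by linarith
  have hDD : D ≤ D ^ 2 := le_self_pow₀ hD1 two_ne_zero
  have hnk : 1 ≤ n * k := one_le_mul_of_one_le_of_one_le hn hk
  have hDn : 1 ≤ D * n := one_le_mul_of_one_le_of_one_le hD1 hn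
  have hDnk : k ≤ D * n * k := le_mul_of_one_le_left hk0.le hDn
  obtain ⟨B, hB, hB2⟩ : ∃ B : ℝ, 0 < B ∧ B ^ 2 = D * n * k / σ :=
    ⟨√(D * n * k / σ), Real.sqrt_pos.2 (by positivity), Real.sq_sqrt (by positivity)⟩
  have hB4 : B ^ 4 = D ^ 2 * n ^ 2 * k ^ 2 / δ := by
    rw [show B ^ 4 = (B ^ 2) ^ 2 by ring, hB2, ← hσ2]; ring
  have hB1 : k ≤ B ^ 2 := by
    rw [hB2, le_div_iff₀ hσ]
    exact (mul_le_of_le_one_right hk0.le hσ1).trans hDnk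
  have hBone : 1 ≤ B := by
    by_contra! h
    linarith [pow_lt_one₀ hB.le h two_ne_zero]
  have hBδ : δ * B ≤ D * n * k := by
    have h1 : B ≤ B ^ 2 := le_self_pow₀ hBone two_ne_zero
    have h2 : σ * B ^ 2 = D * n * k := by rw [hB2]; field_simp
    calc δ * B ≤ σ * B ^ 2 := mul_le_mul hδσ h1 hB.le hσ.le
      _ = _ := h2
  obtain ⟨ε, hεdef⟩ : ∃ ε : ℝ, ε = δ / (208 * k) := ⟨_, rfl⟩
  have hε : 0 < ε := by rw [hεdef]; positivity
  have hε1 : ε ≤ 1 := by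
    rw [hεdef, div_le_one (by positivity)]
    linarith
  obtain ⟨R, hRdef⟩ : ∃ R : ℝ, R = lam * ε / (16 * n * B) := ⟨_, rfl⟩
  have hR : 0 < R := by rw [hRdef]; positivity
  obtain ⟨τ, hτ, hτ2⟩ : ∃ τ : ℝ, 0 < τ ∧ τ ^ 2 = 12 * n ^ 2 * k ^ 2 / (m * σ) :=
    ⟨√(12 * n ^ 2 * k ^ 2 / (m * σ)), Real.sqrt_pos.2 (by positivity),
      Real.sq_sqrt (by positivity)⟩
  obtain ⟨X, hX⟩ : ∃ X : ℝ, X = D ^ 2 * (k ^ 5 * n ^ 6) := ⟨_, rfl⟩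
  have hX0 : 0 < X := by rw [hX]; positivity
  have hbase4 : 10 ^ 8 * X ≤ m * δ ^ 3 * lam ^ 4 := by
    rw [hX]
    calc _ = 10 ^ 8 * D ^ 2 * (k ^ 5 * n ^ 6) := by ring
      _ ≤ _ := hbase
      _ = _ := by ring
  have hmδ : 0 < m * δ ^ 3 := by positivity
  have hbase2 : 10 ^ 8 * X ≤ m * δ ^ 3 * lam ^ 2 :=
    hbase4.trans (mul_le_mul_of_nonneg_left
      (pow_le_pow_of_le_one hlam.le hlam1 (by norm_num)) hmδ.le)
  have hbase1 : 10 ^ 8 * X ≤ m * δ ^ 3 * lam :=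
    hbase4.trans (mul_le_mul_of_nonneg_left
      (by simpa using pow_le_pow_of_le_one hlam.le hlam1 (by norm_num : 1 ≤ 4)) hmδ.le)
  have hpow : ∀ a b : ℕ, a ≤ 5 → b ≤ 6 → k ^ a * n ^ b ≤ k ^ 5 * n ^ 6 := fun a b ha hb =>
    mul_le_mul (pow_le_pow_right₀ hk ha) (pow_le_pow_right₀ hn hb) (by positivity) (by positivity)
  have hDX : ∀ a b : ℕ, a ≤ 5 → b ≤ 6 → D * (k ^ a * n ^ b) ≤ X := fun a b ha hb => by
    rw [hX]
    exact mul_le_mul hDD (hpow a b ha hb) (by positivity) (by positivity)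
  -- Each of the two parts of the coupling takes up half of the budget.
  have hRB : 8 * n * R * B = lam * ε / 2 := by
    rw [hRdef]; field_simp; norm_num
  have hτB : 2 * τ * B ≤ lam * ε / 2 := by
    have h1 : (4 * τ * B) ^ 2 ≤ (lam * ε) ^ 2 := by
      have e1 : (4 * τ * B) ^ 2 = 192 * D * n ^ 3 * k ^ 3 / (m * δ) := by
        rw [mul_pow, mul_pow, hτ2, hB2, ← hσ2]
        field_simp
        norm_num
      have e2 : (lam * ε) ^ 2 = lam ^ 2 * δ ^ 2 / (43264 * k ^ 2) := by
        rw [hεdef]; field_simp; norm_num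
      rw [e1, e2, div_le_div_iff₀ (by positivity) (by positivity)]
      have e3 := hDX 5 3 le_rfl (by norm_num)
      calc 192 * D * n ^ 3 * k ^ 3 * (43264 * k ^ 2) = 8306688 * (D * (k ^ 5 * n ^ 3)) := by ring
        _ ≤ m * δ ^ 3 * lam ^ 2 := by linarith
        _ = _ := by ring
    have h2 := (abs_le.1 (abs_le_of_sq_le_sq h1 (by positivity))).2
    linarith
  have hκB : 2 * (τ + 4 * n * R) * B ≤ lam * ε := by
    calc _ = 2 * τ * B + 8 * n * R * B := by ring
      _ ≤ _ := by linarith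
  refine ⟨R, B, ε, τ, 12 * (n * k / σ), hR, hB, hε, hτ, by positivity, ?_, ?_, ?_, ?_, ?_, ?_,
    hκB, ?_⟩
  · rw [hB2]; ring
  · have : 33 * (n * k) ^ 2 / (12 * (n * k / σ)) ^ 2 = 33 / 144 * δ := by
      rw [← hσ2]; field_simp; norm_num
    rw [this]
    linarith
  · have h1 : 8 * Real.pi * ε * k ≤ δ / 8 := by
      have h0 : 8 * Real.pi * ε * k = Real.pi * (δ / 26) := by
        rw [hεdef]; field_simp; norm_num
      rw [h0]
      have := mul_le_mul_of_nonneg_right Real.pi_lt_d2.le (by positivity : 0 ≤ δ / 26)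
      linarith
    have h2 : 16 / m * k ≤ δ / 8 := by
      rw [div_mul_eq_mul_div, div_le_iff₀ hm]
      have e1 : k ≤ X := by
        have := hDX 1 0 (by norm_num) (by norm_num)
        simp only [pow_one, pow_zero, mul_one] at this
        exact (le_mul_of_one_le_left hk0.le hD1).trans this
      have e2 : m * δ ^ 3 * lam ≤ m * δ := by
        calc m * δ ^ 3 * lam ≤ m * δ ^ 3 * 1 := mul_le_mul_of_nonneg_left hlam1 hmδ.le
          _ ≤ m * δ := by
            rw [mul_one]
            exact mul_le_mul_of_nonneg_left
              (by simpa using pow_le_pow_of_le_one hδ.le hδ1.le (by norm_num : 1 ≤ 3)) hm.le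
      linarith
    linarith
  · have : 33 * (n * k) ^ 4 / (m ^ 2 * (τ ^ 2) ^ 2) = 33 / 144 * δ := by
      rw [hτ2, ← hσ2]; field_simp; norm_num
    rw [this]
    linarith
  · have : n * k ^ 2 * (m * R) / (R * m) ^ 2 = 3328 * n ^ 2 * k ^ 3 * B / (m * lam * δ) := by
      rw [hRdef, hεdef]; field_simp; norm_num
    rw [this, div_le_iff₀ (by positivity)]
    have e3 := hDX 4 3 (by norm_num) (by norm_num)
    have e7 : δ * (3328 * n ^ 2 * k ^ 3 * B) ≤ δ * (δ / 4 * (m * lam * δ)) := by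
      calc _ = 3328 * (n ^ 2 * k ^ 3) * (δ * B) := by ring
        _ ≤ 3328 * (n ^ 2 * k ^ 3) * (D * n * k) :=
          mul_le_mul_of_nonneg_left hBδ (by positivity)
        _ = 3328 * (D * (k ^ 4 * n ^ 3)) := by ring
        _ ≤ m * δ ^ 3 * lam / 4 := by linarith
        _ = _ := by ring
    exact le_of_mul_le_mul_left e7 hδ
  · have h1 : √k ≤ B := Real.sqrt_le_iff.2 ⟨hB.le, hB1⟩
    calc _ ≤ 2 * (τ + 4 * n * R) * B := mul_le_mul_of_nonneg_left h1 (by positivity)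
      _ ≤ lam * ε := hκB
      _ ≤ lam := mul_le_of_le_one_right hlam.le hε1
  · have h1 : (2 * √(n * k / m) * B / lam) ^ 2 < R ^ 2 := by
      have e1 : (2 * √(n * k / m) * B / lam) ^ 2 = 4 * (n * k / m) * B ^ 2 / lam ^ 2 := by
        rw [div_pow, mul_pow, mul_pow, Real.sq_sqrt (by positivity)]
        norm_num
      have e2 : R ^ 2 = lam ^ 2 * δ ^ 2 / (11075584 * k ^ 2 * n ^ 2 * B ^ 2) := by
        rw [hRdef, hεdef]; field_simp; norm_num
      rw [e1, e2, div_lt_div_iff₀ (by positivity) (by positivity)]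
      have e5 : D ^ 2 * (k ^ 5 * n ^ 5) ≤ X := by
        rw [hX]
        exact mul_le_mul_of_nonneg_left (hpow 5 5 le_rfl (by norm_num)) (by positivity)
      have e6 : 4 * (n * k / m) * B ^ 2 * (11075584 * k ^ 2 * n ^ 2 * B ^ 2) =
          44302336 * (D ^ 2 * (k ^ 5 * n ^ 5)) / (m * δ) := by
        calc _ = 44302336 * (k ^ 3 * n ^ 3) / m * B ^ 4 := by ring
          _ = _ := by rw [hB4]; field_simp
      rw [e6, div_lt_iff₀ (by positivity)]
      calc 44302336 * (D ^ 2 * (k ^ 5 * n ^ 5)) < 10 ^ 8 * X := by linarith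
        _ ≤ _ := hbase4
        _ = _ := by ring
    exact lt_of_pow_lt_pow_left₀ 2 hR.le h1

end TwoLayerReLU

theorem theorem1 (C : ℝ) :
    ∃ K : ℝ, 0 < K ∧
      ∀ (n pN pL m : ℕ)
        (Z : Fin n → EuclideanSpace ℝ (Fin pN)) (M : Fin n → EuclideanSpace ℝ (Fin (1 + pL)))
        (δ : ℝ),
        (∀ i, ‖Z i‖ = 1) →
        (∀ i j, i ≠ j → LinearIndependent ℝ ![Z i, Z j]) →
        (∀ i, ‖M i‖ ≤ C) →
        0 < δ → δ < 1 →
        K * ((1 + pL : ℝ) ^ 5 * (n : ℝ) ^ 6 /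
          (δ ^ 3 * TwoLayerReLU.leastEigenvalue Z ^ 4)) ≤ (m : ℝ) →
        ∃ E : Set ((Fin m → EuclideanSpace ℝ (Fin pN)) × (Fin m → Fin (1 + pL) → ℝ)),
          MeasurableSet E ∧
          ENNReal.ofReal (1 - δ) ≤ TwoLayerReLU.initLaw pN m (1 + pL) E ∧
          ∀ W₀ A, (W₀, A) ∈ E →
            ∀ W : ℝ → Fin m → EuclideanSpace ℝ (Fin pN),
              TwoLayerReLU.IsGradientFlow Z M A W₀ W →
              ∀ t : ℝ, 0 ≤ t → ∀ s : Fin (1 + pL),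
                ‖TwoLayerReLU.outputs Z A (W t) s - TwoLayerReLU.targets M s‖ ^ 2 ≤
                  Real.exp (-TwoLayerReLU.leastEigenvalue Z * t) *
                    ‖TwoLayerReLU.outputs Z A (W 0) s - TwoLayerReLU.targets M s‖ ^ 2 := by
  have hC : 0 ≤ C ^ 2 := sq_nonneg C
  -- In the bound on the initial residuals `24` comes from the outputs and `2 C²` from the targets.
  refine ⟨10 ^ 8 * (24 + 2 * C ^ 2) ^ 2, by positivity, ?_⟩
  intro n pN pL m Z M δ hZ hlin hM hδ hδ1 hmK
  rcases Nat.eq_zero_or_pos n with rfl | hn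
  · -- Without data both sides vanish, on the whole space.
    refine ⟨Set.univ, MeasurableSet.univ, ?_, ?_⟩
    · rw [measure_univ]
      exact ENNReal.ofReal_le_one.2 (by linarith)
    · intro W₀ A _ W _ t _ s
      simp [TwoLayerReLU.norm_sq_outputs_sub_targets]
  have hlam := TwoLayerReLU.leastEigenvalue_pos hn hZ hlin
  have hn1 : (1 : ℝ) ≤ n := by exact_mod_cast hn
  have hk1 : (1 : ℝ) ≤ ((1 + pL : ℕ) : ℝ) := by exact_mod_cast Nat.le_add_right 1 pL
  have hk0 : (0 : ℝ) < ((1 + pL : ℕ) : ℝ) := by linarith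
  have hm0 : (0 : ℝ) < m := lt_of_lt_of_le (by positivity) hmK
  have hσ := Real.sqrt_pos.2 hδ
  obtain ⟨R, B, ε, τ, L, hR, hB, hε, hτ, hL, hB2, b1, b2, b3, b4, c1, c2, c3⟩ :=
    TwoLayerReLU.exists_parameters (D := 24 + 2 * C ^ 2) hn1 hk1 hm0 hδ hδ1 hlam
      (TwoLayerReLU.leastEigenvalue_le_one hn hZ) (by linarith) (by
        rw [← mul_div_assoc, div_le_iff₀ (by positivity)] at hmK
        rw [Nat.cast_add, Nat.cast_one]
        exact hmK)
  have hBC : 2 * L + 2 * (n * C ^ 2) ≤ B ^ 2 := by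
    have h1 : (n : ℝ) ≤ n * ((1 + pL : ℕ) : ℝ) / √δ := by
      rw [le_div_iff₀ hσ]
      exact mul_le_mul_of_nonneg_left ((Real.sqrt_le_one.2 hδ1.le).trans hk1) (by linarith)
    have h2 := mul_le_mul_of_nonneg_left h1 (by positivity : 0 ≤ 2 * C ^ 2)
    rw [hB2]
    linarith
  obtain ⟨E, hEm, hEp, hE⟩ := TwoLayerReLU.exists_goodInit_event (d := pN) hn
    (by exact_mod_cast hm0) (Nat.add_pos_left one_pos pL) hZ hM hR hε hτ hL hBC b1 b2 b3 b4
  refine ⟨E, hEm, hEp, fun W₀ A hWA W hW t ht s => ?_⟩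
  rw [TwoLayerReLU.norm_sq_outputs_sub_targets, TwoLayerReLU.norm_sq_outputs_sub_targets]
  exact (hE W₀ A hWA).sum_sq_residual_le hW hZ hτ.le hB.le hlam
    TwoLayerReLU.leastEigenvalue_mul_sum_sq_le c1 c2 c3 ht s
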